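/- **Setting.** Let $n\in\{2,3\}$ and let $\Omega\subset\mathbb R^n$ be bounded and open. Let $\mathbf C=(C_{ijkl})$ satisfy $C_{ijkl}=C_{jikl}=C_{klij}$ and, for some $c,c'>0$, $c\,|A^{\rm sym}|^2\le w(A):=\tfrac12\,\mathbf CA:A\le c'|A|^2$ for all $A\in\mathbb R^{n\times n}$. Let $K\subset\overline\Omega$ be a crack set: closed, countably $\mathcal H^{n-1}$-rectifiable, $\mathcal H^{n-1}(K)<\infty$, $\mathcal H^{n-1}(K\cap\partial\Omega)=0$. Boundary values are understood as traces: $u=u^0$ on $\partial\Omega$ means that $r^{-n}\int_{\Omega\cap B(x,r)}|u(y)-u^0(x)|\,dy\to0$ as $r\to0$ for $\mathcal H^{n-1}$-a.e. $x\in\partial\Omega$, and $H^{1/2}(\partial\Omega)$ is the space of traces of $W^{1,2}(\Omega,\mathbb R^n)$ with the quotient norm. An *equilibrium displacement* $u(K,u^0)$ is a $u\in W^{1,2}(\Omega\setminus K,\mathbb R^n)$ with $u=u^0$ on $\partial\Omega$ and $\int_{\Omega\setminus K}\mathbf C\nabla u:\nabla v\,dx=0$ for all $v\in W^{1,2}(\Omega\setminus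 K,\mathbb R^n)$ with $v=0$ on $\partial\Omega$. The Dirichlet-to-Neumann map $\mathbf T(K)$ is $\langle\mathbf T(K)u^0,v^0\rangle=\int_{\Omega\setminus K}\mathbf C\nabla u(K,u^0):\nabla v\,dx$ for any $v\in W^{1,2}(\Omega\setminus K,\mathbb R^n)$ with $v=v^0$ on $\partial\Omega$ (the weak form of $\int_{\partial\Omega}\sigma\mathbf n\cdot v^0\,d\mathcal H^{n-1}$, $\sigma=\mathbf C\nabla u(K,u^0)$). Let $s\ge \frac n2+2$ be an integer and let $D_c^{s,2,\infty}(\Omega)$ be the set of $C^1$ diffeomorphisms of $\Omega$, extended by the identity outside $\Omega$, that are limits in $W^{s,2}\cap L^\infty(\Omega,\mathbb R^n)$ of $C^\infty$ diffeomorphisms $\psi$ of $\Omega$ such that $\psi-\mathrm{id}$ has compact support in $\Omega$. A *smooth crack propagation curve* is a $C^1$ curve (in the $W^{s,2}\cap L^\infty$ norm) $[0,T]\ni t\mapsto\phi_t\in D_c^{s,2,\infty}(\Omega)$, $T>0$, with $\phi_0=\mathrm{id}$ and $\phi_t(K)\subset\phi_{t'}(K)$ for $t<t'$. Put $\eta_t=\dot\phi_t\circ\phi_t^{-1}$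 and $\mathbf T(\phi_t)=\mathbf T(\phi_t(K))$, and define, for an equilibrium displacement $u$ for the crack $\phi_t(K)$, $$K2_t(u)=\int_\Omega\Big\{-\tfrac12(\mathbf C\nabla u:\nabla u)\,\mathrm{div}\,\eta_t+(\mathbf C\nabla u)_{ij}(\nabla u)_{ik}(\nabla\eta_t)_{kj}\Big\}dx,$$ with $(\nabla u)_{ik}=\partial_ku_i$, $(\nabla\eta)_{kj}=\partial_j\eta_k$ and summation over repeated indices. **Proposition.** Let $t\mapsto\phi_t$ be a smooth crack propagation curve. (1) Let $u^0\in H^{1/2}(\partial\Omega)$ and, for every $t\in[0,T]$, let $u_t=u(\phi_t,u^0)$ be an equilibrium displacement for the crack $\phi_t(K)$ and the boundary value $u^0$. Then for every $t\in[0,T]$ the integrand below is integrable, and for every $t\in[0,T)$ the upper right Dini derivative of $\tau\mapsto\langle\mathbf T(\phi_\tau)u^0,u^0\rangle$ at $t$ is at most $$\int_\Omega\Big\{(\mathbf C\nabla u_t:\nabla u_t)\,\mathrm{div}\,\eta_t-2(\mathbf C\nabla u_t)_{ij}(\nabla u_t)_{ik}(\nabla\eta_t)_{kj}\Big\}dx.$$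 In particular $\langle\frac{d}{dt}[\mathbf T(\phi_t)]u^0,u^0\rangle$ is at most this integral whenever the derivative exists. If moreover $t\mapsto u_t\circ\phi_t\in W^{1,2}(\Omega\setminus K,\mathbb R^n)$ is $C^1$ (so that $(u_t\circ\phi_t,\phi_t)$ is a balanced fracture curve), then the derivative exists (relative to $[0,T]$) and satisfies this inequality for every $t\in[0,T]$. (2) Let $t\mapsto u^0(t)$ be a $C^1$ curve $[0,T]\to H^{1/2}(\partial\Omega)$ and, for every $t\in[0,T]$, let $u_t=u(\phi_t,u^0(t))$ be an equilibrium displacement. Let $P(t)=\langle\mathbf T(\phi_t)u^0(t),\dot u^0(t)\rangle$ and let $\mathcal E(t)=P(t)-\frac{d}{dt}\int_\Omega w(\nabla u_t)\,dx$ be the energy release rate. For every $t\in[0,T)$ the upper right Dini derivative of $\tau\mapsto\int_\Omega w(\nabla u_\tau)\,dx$ at $t$ is at most $P(t)-K2_t(u_t)$; in particular $$\mathcal E(t)\ \ge\ K2_t(u_t)=K2(\phi_t,\eta_t,u^0(t))$$ whenever the derivative in $\mathcal E(t)$ exists. If moreover $t\mapsto u_t\circ\phi_t\in W^{1,2}(\Omega\setminus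 K,\mathbb R^n)$ is $C^1$, then that derivative exists and $\mathcal E(t)\ge K2_t(u_t)$ for every $t\in[0,T]$. -/

import Mathlib

open MeasureTheory Set Filter Topology
open scoped ENNReal ContDiff

namespace BrittleCrack

noncomputable section

/-- Euclidean `n`-space. -/
abbrev E (n : ℕ) : Type := EuclideanSpace ℝ (Fin n)

/-- Real `n × n` matrices; a displacement gradient has entries `(∇u) i j = ∂u_i/∂x_j`. -/
abbrev Mat (n : ℕ) : Type := Matrix (Fin n) (Fin n) ℝ

/-- A fourth order tensor, `C i j k l`. -/
abbrev Tensor4 (n : ℕ) : Type := Fin n → Fin n → Fin n → Fin n → ℝ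

variable {n : ℕ}

/-! ### Linear elasticity -/

/-- The stress `(C A)_{ij} = ∑_{k,l} C_{ijkl} A_{kl}`. -/
def stress (C : Tensor4 n) (A : Mat n) : Mat n :=
  fun i j => ∑ k, ∑ l, C i j k l * A k l

/-- The contraction `A : B = ∑_{i,j} A_{ij} B_{ij}`. -/
def contract (A B : Mat n) : ℝ := ∑ i, ∑ j, A i j * B i j

/-- The energy density `w(A) = (1/2) C A : A`. -/
def energyDensity (C : Tensor4 n) (A : Mat n) : ℝ := 1 / 2 * contract (stress C A) A

/-- The elasticity tensor: symmetries `C_{ijkl} = C_{jikl} = C_{klij}` and the growth condition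
`c |A^sym|² ≤ w(A) ≤ c' |A|²`. -/
structure IsElasticityTensor (C : Tensor4 n) : Prop where
  minor_symm : ∀ i j k l, C i j k l = C j i k l
  major_symm : ∀ i j k l, C i j k l = C k l i j
  growth : ∃ c c' : ℝ, 0 < c ∧ 0 < c' ∧ ∀ A : Mat n,
    c * ∑ i, ∑ j, ((A i j + A j i) / 2) ^ 2 ≤ energyDensity C A ∧
      energyDensity C A ≤ c' * ∑ i, ∑ j, A i j ^ 2

/-! ### Weak derivatives and Sobolev norms -/

/-- `g` is the weak partial derivative of order `k`, in the coordinate directions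
`J 0, …, J (k-1)`, of the scalar function `f` on the open set `U`. -/
def HasWeakPartial (U : Set (E n)) (k : ℕ) (J : Fin k → Fin n) (f g : E n → ℝ) : Prop :=
  LocallyIntegrableOn f U ∧ LocallyIntegrableOn g U ∧
    ∀ ζ : E n → ℝ, ContDiff ℝ ∞ ζ → HasCompactSupport ζ → tsupport ζ ⊆ U →
      ∫ x in U, f x * iteratedFDeriv ℝ k ζ x (fun l => EuclideanSpace.single (J l) 1) =
        (-1) ^ k * ∫ x in U, g x * ζ x

/-- The `W^{m,2}(U, ℝⁿ)` norm of a vector field, `∞` when the field is not in this space: the sum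
of the `L²` norms of all weak partial derivatives of order at most `m` of all components. -/
def sobolevNorm (m : ℕ) (U : Set (E n)) (f : E n → E n) : ℝ≥0∞ :=
  ∑ k ∈ Finset.range (m + 1), ∑ J : Fin k → Fin n, ∑ i : Fin n,
    ⨅ (g : E n → ℝ) (_ : HasWeakPartial U k J (fun x => f x i) g),
      eLpNorm g 2 (volume.restrict U)

/-- The norm of `W^{m,2,∞}(U, ℝⁿ) = W^{m,2} ∩ L^∞`. -/
def sobolevInfNorm (m : ℕ) (U : Set (E n)) (f : E n → E n) : ℝ≥0∞ :=
  max (volume U * eLpNorm f ⊤ (volume.restrict U)) (sobolevNorm m U f)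

/-- `u ∈ W^{1,2}(U, ℝⁿ)` with weak gradient `G`. -/
def MemW12 (U : Set (E n)) (u : E n → E n) (G : E n → Mat n) : Prop :=
  (∀ i, MemLp (fun x => u x i) 2 (volume.restrict U)) ∧
  (∀ i j, MemLp (fun x => G x i j) 2 (volume.restrict U)) ∧
  ∀ i j, HasWeakPartial U 1 (fun _ => j) (fun x => u x i) (fun x => G x i j)

/-- `u = g` on `∂Ω` in the sense of traces: at `ℋ^{n-1}`-almost every `x ∈ ∂Ω`,
`r^{-n} ∫_{Ω ∩ B(x,r)} |u(y) - g(x)| dy → 0` as `r → 0`. -/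
def HasTrace (Ω : Set (E n)) (u g : E n → E n) : Prop :=
  ∀ᵐ x ∂((Measure.hausdorffMeasure ((n : ℝ) - 1)).restrict (frontier Ω)),
    Tendsto (fun r : ℝ =>
        (ENNReal.ofReal (r ^ n))⁻¹ * ∫⁻ y in Ω ∩ Metric.ball x r, ‖u y - g x‖ₑ)
      (𝓝[>] 0) (𝓝 0)

/-- The norm of the trace space `H^{1/2}(∂Ω, ℝⁿ)` of `W^{1,2}(Ω, ℝⁿ)`: the infimum of the
`W^{1,2}(Ω)` norms of the extensions of `g`; it is `∞` outside the space. Only the values of `g`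
on `∂Ω` matter. -/
def hHalfNorm (Ω : Set (E n)) (g : E n → E n) : ℝ≥0∞ :=
  ⨅ (u : E n → E n) (_ : HasTrace Ω u g), sobolevNorm 1 Ω u

/-- `f` is a `C¹` curve on `[0, T]`, with velocity `v`, in the space of fields on which the
extended norm `N` is finite. -/
structure IsC1Curve (N : (E n → E n) → ℝ≥0∞) (T : ℝ) (f v : ℝ → E n → E n) : Prop where
  mem : ∀ t ∈ Icc 0 T, N (f t) < ⊤
  deriv : ∀ t ∈ Icc 0 T,
    Tendsto (fun t' => N (fun x => (t' - t)⁻¹ • (f t' x - f t x) - v t x))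
      (𝓝[Icc 0 T \ {t}] t) (𝓝 0)
  cont : ∀ t ∈ Icc 0 T,
    Tendsto (fun t' => N (fun x => v t' x - v t x)) (𝓝[Icc 0 T] t) (𝓝 0)

/-! ### Cracks and equilibrium -/

/-- A crack set of the body `Ω`: a closed countably rectifiable subset of the closure of `Ω`, of
finite area, which meets `∂Ω` in a set of area zero. -/
structure IsCrackSet (Ω K : Set (E n)) : Prop where
  closed : IsClosed K
  subset : K ⊆ closure Ω
  finite_area : Measure.hausdorffMeasure ((n : ℝ) - 1) K < ⊤
  rectifiable : ∃ f : ℕ → EuclideanSpace ℝ (Fin (n - 1)) → E n,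
    (∀ i, ∃ L, LipschitzWith L (f i)) ∧
      Measure.hausdorffMeasure ((n : ℝ) - 1) (K \ ⋃ i, range (f i)) = 0
  boundary_null : Measure.hausdorffMeasure ((n : ℝ) - 1) (K ∩ frontier Ω) = 0

/-- `u`, with gradient `G`, is an equilibrium displacement `u(K, u₀)`: the weak solution in
`W^{1,2}(Ω \ K)` of `div σ(∇u) = 0` in `Ω \ K`, `σ(∇u) n = 0` on both sides of `K`,
`u = u₀` on `∂Ω`. The test fields are those of `W^{1,2}(Ω \ K)` that vanish on `∂Ω`; they are
free on `K`. -/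
structure IsEquilibrium (C : Tensor4 n) (Ω K : Set (E n)) (u₀ u : E n → E n) (G : E n → Mat n) :
    Prop where
  mem : MemW12 (Ω \ K) u G
  trace : HasTrace Ω u u₀
  weak : ∀ (v : E n → E n) (H : E n → Mat n), MemW12 (Ω \ K) v H → HasTrace Ω v (fun _ => 0) →
    ∫ x in Ω \ K, contract (stress C (G x)) (H x) = 0

open Classical in
/-- The Dirichlet-to-Neumann map of `Ω` with the crack `K`, as a duality product
`⟨T(K) u₀, v₀⟩ = ∫_{∂Ω} σ(∇u(K,u₀)) n · v₀`. The normal stress is the element of `H^{-1/2}(∂Ω)`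
given by Green's formula: `∫_{Ω \ K} σ(∇u(K,u₀)) : ∇v`, for any `v ∈ W^{1,2}(Ω \ K)` with
`v = v₀` on `∂Ω`. The value does not depend on `v`, nor on the equilibrium displacement. -/
def dirichletToNeumann (C : Tensor4 n) (Ω K : Set (E n)) (u₀ v₀ : E n → E n) : ℝ :=
  if h : ∃ p : (E n → Mat n) × (E n → Mat n),
      (∃ u, IsEquilibrium C Ω K u₀ u p.1) ∧ ∃ v, MemW12 (Ω \ K) v p.2 ∧ HasTrace Ω v v₀
  then ∫ x in Ω \ K, contract (stress C (h.choose.1 x)) (h.choose.2 x)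
  else 0

/-- The elastic energy `∫ w(∇u)` of the body with the (Lebesgue null) crack `K`. -/
def elasticEnergy (C : Tensor4 n) (Ω K : Set (E n)) (G : E n → Mat n) : ℝ :=
  ∫ x in Ω \ K, energyDensity C (G x)

/-! ### Crack propagation curves

Diffeomorphisms of `Ω` that are the identity at `∂Ω` are extended by the identity to bijections
of the whole space, so that they also act on the points of `K` on `∂Ω`. -/

/-- The group `M_c` of smooth diffeomorphisms of `Ω` such that `φ - 1` has compact support
in `Ω`. -/
def smoothDiffeos (Ω : Set (E n)) : Set (Equiv.Perm (E n)) :=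
  {φ | ContDiff ℝ ∞ φ ∧ ContDiff ℝ ∞ φ.symm ∧
    HasCompactSupport (fun x => φ x - x) ∧ tsupport (fun x => φ x - x) ⊆ Ω}

/-- The group `D_c^{s,2,∞}(Ω)`: the closure of `M_c`, for the `W^{s,2,∞}` norm, among the `C¹`
diffeomorphisms of `Ω`. -/
def sobolevDiffeos (s : ℕ) (Ω : Set (E n)) : Set (Equiv.Perm (E n)) :=
  {φ | (∀ x ∉ Ω, φ x = x) ∧ ContDiffOn ℝ 1 φ Ω ∧ ContDiffOn ℝ 1 φ.symm Ω ∧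
    ∀ ε > 0, ∃ ψ ∈ smoothDiffeos Ω, sobolevInfNorm s Ω (fun x => φ x - ψ x) < ε}

/-- An `s`-smooth crack propagation curve on `[0, T]` with initial crack `K`. The displacement
`φ_t - 1` is a `C¹` curve in `W^{s,2,∞}`. -/
structure IsCrackCurve (Ω K : Set (E n)) (s : ℕ) (T : ℝ) (φ : ℝ → Equiv.Perm (E n)) : Prop where
  pos : 0 < T
  mem : ∀ t ∈ Icc 0 T, φ t ∈ sobolevDiffeos s Ω
  c1 : ∃ v, IsC1Curve (sobolevInfNorm s Ω) T (fun t x => φ t x - x) v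
  start : φ 0 = 1
  mono : ∀ t t', 0 ≤ t → t < t' → t' ≤ T → φ t '' K ⊆ φ t' '' K

/-- The velocity field `η_t = φ̇_t ∘ φ_t⁻¹`. -/
def velocity (T : ℝ) (φ : ℝ → Equiv.Perm (E n)) (t : ℝ) (x : E n) : E n :=
  derivWithin (fun τ => φ τ ((φ t).symm x)) (Icc 0 T) t

/-- The gradient `(∇η)_{kj} = ∂η_k/∂x_j` of a vector field. -/
def grad (η : E n → E n) (x : E n) : Mat n :=
  fun k j => fderiv ℝ η x (EuclideanSpace.single j 1) k

/-- The divergence of a vector field. -/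
def divergence (η : E n → E n) (x : E n) : ℝ := ∑ i, grad η x i i

/-- The sum `∑_{i,j,k} (C G)_{ij} G_{ik} H_{kj}`. -/
def eshelbyTerm (C : Tensor4 n) (G H : Mat n) : ℝ :=
  ∑ i, ∑ j, ∑ k, stress C G i j * G i k * H k j

/-- The generalized Rice integral `K2(φ, η, u₀)`, in terms of the crack `K = φ(K₀)` and of the
gradient `G` of an equilibrium displacement `u(φ, u₀)`. -/
def riceIntegral (C : Tensor4 n) (Ω K : Set (E n)) (η : E n → E n) (G : E n → Mat n) : ℝ :=
  ∫ x in Ω \ K, (-(1 / 2) * contract (stress C (G x)) (G x) * divergence η x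
    + eshelbyTerm C (G x) (grad η x))

/-- The integrand `(C G : G) div η - 2 (C G)_{ij} G_{ik} (∇η)_{kj}`, with `G = ∇u`. -/
def variationIntegrand (C : Tensor4 n) (η : E n → E n) (G : E n → Mat n) (x : E n) : ℝ :=
  contract (stress C (G x)) (G x) * divergence η x - 2 * eshelbyTerm C (G x) (grad η x)

/-- The function `t ↦ ⟨T(φ_t) u₀, u₀⟩`, where `T(φ_t) = T(φ_t(K))`. -/
def responseForm (C : Tensor4 n) (Ω K : Set (E n)) (φ : ℝ → Equiv.Perm (E n)) (u₀ : E n → E n)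
    (t : ℝ) : ℝ :=
  dirichletToNeumann C Ω (φ t '' K) u₀ u₀

/-- The elastic energy `t ↦ ∫ w(∇u_t)` of the body with the crack `φ_t(K)`, with `G_t = ∇u_t`. -/
def energyCurve (C : Tensor4 n) (Ω K : Set (E n)) (φ : ℝ → Equiv.Perm (E n))
    (G : ℝ → E n → Mat n) (t : ℝ) : ℝ :=
  elasticEnergy C Ω (φ t '' K) (G t)

/-- The power `P(t) = ∫_{∂Ω} σ_t n · u̇₀(t) = ⟨T(φ_t) u₀(t), u̇₀(t)⟩` communicated to the body, where
`g = u₀` and `g' = u̇₀`. -/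
def power (C : Tensor4 n) (Ω K : Set (E n)) (φ : ℝ → Equiv.Perm (E n)) (g g' : ℝ → E n → E n)
    (t : ℝ) : ℝ :=
  dirichletToNeumann C Ω (φ t '' K) (g t) (g' t)

/-- The displacements `u_t`, pulled back by `φ_t` to the initial configuration, form a `C¹` curve
in `W^{1,2}(Ω \ K)`. If the `u_t` are equilibrium displacements, `t ↦ (u_t ∘ φ_t, φ_t)` is then
a balanced fracture curve. -/
def IsC1FractureCurve (Ω K : Set (E n)) (T : ℝ) (φ : ℝ → Equiv.Perm (E n))
    (u : ℝ → E n → E n) : Prop :=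
  ∃ v, IsC1Curve (sobolevNorm 1 (Ω \ K)) T (fun t x => u t (φ t x)) v

/-- The energy release rate `ℰ(t) = P(t) - d/dt ∫ w(∇u_t)`. -/
def energyReleaseRate (C : Tensor4 n) (Ω K : Set (E n)) (T : ℝ) (φ : ℝ → Equiv.Perm (E n))
    (g g' : ℝ → E n → E n) (G : ℝ → E n → Mat n) (t : ℝ) : ℝ :=
  power C Ω K φ g g' t - derivWithin (energyCurve C Ω K φ G) (Icc 0 T) t

/-- The upper right Dini derivative of `f` at `t` is at most `b`. -/
def RightDiniLE (f : ℝ → ℝ) (t b : ℝ) : Prop :=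
  ∀ r > b, ∀ᶠ t' in 𝓝[>] t, (f t' - f t) / (t' - t) < r

end

end BrittleCrack

open MeasureTheory Set Filter Topology
open scoped ENNReal ContDiff

namespace BrittleCrack

noncomputable section

variable {n : ℕ}

/-! ### Weak derivatives -/

/-! Let `E(τ)` be twice the elastic energy at time `τ`, the integral of `C∇u_τ : ∇u_τ`, and let `ψ =
φ_τ ∘ φ_t⁻¹`. The map `ψ` carries the crack at time `t` onto the crack at time `τ` and fixes every
point outside `Ω`. Equilibrium displacements minimize the energy among fields with the same trace
(`IsEquilibrium.integral_le`), so each competitor bounds `E(τ)` from above. The competitor used is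
`(u_t + (τ - t) w_τ) ∘ ψ⁻¹`, where `w_τ` extends the slope of the boundary data. After the change of
variables `ψ`, its energy is an integral over the fixed set `Ω \ φ_t(K)` with the elasticity tensor
pulled back by `∇ψ`. Since `∇ψ = 1 + (τ - t)∇η_t + o(τ - t)` uniformly, the difference quotient
converges. The derivative of the tensor gives the integral of `variationIntegrand`, which is `-2 K2`
(`contract_stress_pullbackTensorDeriv`), and the boundary slope gives twice the power. Hence `E(τ) -
E(t) ≤ (τ - t) U(τ)` with `U` convergent to the asserted bound (`exists_upper_slope`), which
controls the upper right Dini derivative.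

If the pulled-back displacements form a `C¹` curve, the roles of the two times are exchanged: `u_τ ∘
ψ - (τ - t) w_τ` competes at time `t`. Its gradient tends to that of `u_t` in `L²`, so the opposite
inequality holds with a function of the same limit (`exists_lower_slope`), and the derivative exists
with equality. Part (1) is the case of constant boundary data: the power vanishes and the response
form is twice the energy.

Three analytic facts support this. An elementary embedding of `W^{n+1,2}` into `C¹`, for limits of
compactly supported fields, turns Sobolev convergence of the slopes of `φ` into uniform convergence
of their derivatives (`exists_hasFDerivAt_slope_limit`). The weak chain rule holds for
diffeomorphisms that are only `C¹`; it follows by mollifying continuous test fields with continuous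
divergence (`integral_mul_add_sum_integral_mul_eq_zero`). Traces survive composition because the
diffeomorphisms are Lipschitz and fix the boundary (`hasTrace_comp`). Equilibria need not be unique,
but they have the same stress almost everywhere, so the Dirichlet-to-Neumann map can be evaluated
with any of them (`dirichletToNeumann_eq`). -/

theorem integrable_mul_of_tsupport_subset {U : Set (E n)} {f ζ : E n → ℝ}
    (hf : LocallyIntegrableOn f U) (hζ : Continuous ζ) (hc : HasCompactSupport ζ)
    (hU : tsupport ζ ⊆ U) : Integrable (fun x => f x * ζ x) := by
  have h1 : IntegrableOn f (tsupport ζ) := hf.integrableOn_compact_subset hU hc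
  have h2 : IntegrableOn (fun x => f x * ζ x) (tsupport ζ) := by
    have := h1.mul_continuousOn hζ.continuousOn hc
    exact this
  rwa [integrableOn_iff_integrable_of_support_subset] at h2
  intro x hx
  apply subset_tsupport ζ
  intro h
  exact hx (by simp [h])

theorem setIntegral_mul_of_tsupport_subset {U : Set (E n)} {f ζ : E n → ℝ}
    (hU : tsupport ζ ⊆ U) : ∫ x in U, f x * ζ x = ∫ x, f x * ζ x := by
  apply setIntegral_eq_integral_of_forall_compl_eq_zero
  intro x hx
  rw [image_eq_zero_of_notMem_tsupport (fun h => hx (hU h)), mul_zero]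

/-- The iterated partial derivative in the coordinate directions `J` of a smooth function. -/
abbrev partialDeriv {k : ℕ} (J : Fin k → Fin n) (ζ : E n → ℝ) (x : E n) : ℝ :=
  iteratedFDeriv ℝ k ζ x (fun l => EuclideanSpace.single (J l) 1)

theorem contDiff_partialDeriv {k : ℕ} (J : Fin k → Fin n) {ζ : E n → ℝ} (h : ContDiff ℝ ∞ ζ) :
    ContDiff ℝ ∞ (partialDeriv J ζ) := by
  have h1 : ContDiff ℝ ∞ (iteratedFDeriv ℝ k ζ) := by
    apply h.iteratedFDeriv_right (i := k)
    exact_mod_cast le_top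
  exact (ContinuousMultilinearMap.apply ℝ (fun _ : Fin k => E n) ℝ
    (fun l => EuclideanSpace.single (J l) 1)).contDiff.comp h1

theorem tsupport_partialDeriv_subset {k : ℕ} (J : Fin k → Fin n) (ζ : E n → ℝ) :
    tsupport (partialDeriv J ζ) ⊆ tsupport ζ := by
  apply closure_minimal _ (isClosed_tsupport ζ)
  refine Subset.trans ?_ (support_iteratedFDeriv_subset (𝕜 := ℝ) k)
  intro x hx h
  apply hx
  simp [partialDeriv, h]

theorem hasCompactSupport_partialDeriv {k : ℕ} (J : Fin k → Fin n) {ζ : E n → ℝ}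
    (h : HasCompactSupport ζ) : HasCompactSupport (partialDeriv J ζ) :=
  h.of_isClosed_subset (isClosed_tsupport _) (tsupport_partialDeriv_subset J ζ)

theorem HasWeakPartial.integral_mul_partialDeriv {U : Set (E n)} {k : ℕ} {J : Fin k → Fin n}
    {f g : E n → ℝ} (h : HasWeakPartial U k J f g) {ζ : E n → ℝ} (hζ : ContDiff ℝ ∞ ζ)
    (hc : HasCompactSupport ζ) (hU : tsupport ζ ⊆ U) :
    ∫ x, f x * partialDeriv J ζ x = (-1) ^ k * ∫ x, g x * ζ x := by
  rw [← setIntegral_mul_of_tsupport_subset ((tsupport_partialDeriv_subset J ζ).trans hU),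
    ← setIntegral_mul_of_tsupport_subset hU]
  exact h.2.2 ζ hζ hc hU

theorem hasWeakPartial_of_integral {U : Set (E n)} {k : ℕ} {J : Fin k → Fin n} {f g : E n → ℝ}
    (hf : LocallyIntegrableOn f U) (hg : LocallyIntegrableOn g U)
    (h : ∀ ζ : E n → ℝ, ContDiff ℝ ∞ ζ → HasCompactSupport ζ → tsupport ζ ⊆ U →
      ∫ x, f x * partialDeriv J ζ x = (-1) ^ k * ∫ x, g x * ζ x) :
    HasWeakPartial U k J f g := by
  refine ⟨hf, hg, fun ζ hζ hc hU => ?_⟩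
  rw [setIntegral_mul_of_tsupport_subset hU]
  refine Eq.trans ?_ (h ζ hζ hc hU)
  exact setIntegral_mul_of_tsupport_subset ((tsupport_partialDeriv_subset J ζ).trans hU)

theorem HasWeakPartial.add {U : Set (E n)} {k : ℕ} {J : Fin k → Fin n} {f g f' g' : E n → ℝ}
    (h : HasWeakPartial U k J f g) (h' : HasWeakPartial U k J f' g') :
    HasWeakPartial U k J (fun x => f x + f' x) (fun x => g x + g' x) := by
  refine hasWeakPartial_of_integral (h.1.add h'.1) (h.2.1.add h'.2.1) fun ζ hζ hc hU => ?_
  have hU' := (tsupport_partialDeriv_subset J ζ).trans hU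
  have hc' := hasCompactSupport_partialDeriv J hc
  have hζ' := (contDiff_partialDeriv J hζ).continuous
  simp only [add_mul]
  rw [integral_add (integrable_mul_of_tsupport_subset h.1 hζ' hc' hU')
    (integrable_mul_of_tsupport_subset h'.1 hζ' hc' hU'),
    integral_add (integrable_mul_of_tsupport_subset h.2.1 hζ.continuous hc hU)
    (integrable_mul_of_tsupport_subset h'.2.1 hζ.continuous hc hU),
    h.integral_mul_partialDeriv hζ hc hU, h'.integral_mul_partialDeriv hζ hc hU, mul_add]

theorem HasWeakPartial.const_mul {U : Set (E n)} {k : ℕ} {J : Fin k → Fin n} {f g : E n → ℝ}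
    (h : HasWeakPartial U k J f g) (c : ℝ) :
    HasWeakPartial U k J (fun x => c * f x) (fun x => c * g x) := by
  refine hasWeakPartial_of_integral (h.1.smul c) (h.2.1.smul c) fun ζ hζ hc hU => ?_
  simp only [mul_assoc]
  rw [integral_const_mul, integral_const_mul, h.integral_mul_partialDeriv hζ hc hU]
  ring

theorem HasWeakPartial.mono {U V : Set (E n)} {k : ℕ} {J : Fin k → Fin n} {f g : E n → ℝ}
    (h : HasWeakPartial U k J f g) (hV : V ⊆ U) : HasWeakPartial V k J f g :=
  hasWeakPartial_of_integral (h.1.mono_set hV) (h.2.1.mono_set hV) fun _ hζ hc hU =>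
    h.integral_mul_partialDeriv hζ hc (hU.trans hV)

theorem ae_eq_restrict_of_integral_mul {U : Set (E n)} (hU : IsOpen U) {f g : E n → ℝ}
    (hf : LocallyIntegrableOn f U) (hg : LocallyIntegrableOn g U)
    (h : ∀ ζ : E n → ℝ, ContDiff ℝ ∞ ζ → HasCompactSupport ζ → tsupport ζ ⊆ U →
      ∫ x, f x * ζ x = ∫ x, g x * ζ x) : f =ᵐ[volume.restrict U] g := by
  have := hU.ae_eq_zero_of_integral_contDiff_smul_eq_zero (hf.sub hg) (fun ζ hζ hc hs => by
    have h1 := h ζ hζ hc hs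
    simp only [Pi.sub_apply, smul_eq_mul, mul_comm (ζ _), sub_mul]
    rw [integral_sub (integrable_mul_of_tsupport_subset hf hζ.continuous hc hs)
      (integrable_mul_of_tsupport_subset hg hζ.continuous hc hs), h1, sub_self])
  rw [Filter.EventuallyEq, ae_restrict_iff' hU.measurableSet]
  filter_upwards [this] with x hx hxU
  exact sub_eq_zero.1 (hx hxU)

theorem HasWeakPartial.unique {U : Set (E n)} (hU : IsOpen U) {k : ℕ} {J : Fin k → Fin n}
    {f g g' : E n → ℝ} (h : HasWeakPartial U k J f g) (h' : HasWeakPartial U k J f g') :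
    g =ᵐ[volume.restrict U] g' := by
  refine ae_eq_restrict_of_integral_mul hU h.2.1 h'.2.1 fun ζ hζ hc hs => ?_
  have := (h.integral_mul_partialDeriv hζ hc hs).symm.trans
    (h'.integral_mul_partialDeriv hζ hc hs)
  exact mul_left_cancel₀ (pow_ne_zero _ (by norm_num)) this

/-- An order-zero derivative of a test function is the function itself, so the order-zero term of
the Sobolev norm is the `L²` norm of the field. -/
theorem HasWeakPartial.ae_eq_of_zero {U : Set (E n)} (hU : IsOpen U) {J : Fin 0 → Fin n}
    {f g : E n → ℝ} (h : HasWeakPartial U 0 J f g) : f =ᵐ[volume.restrict U] g := by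
  refine ae_eq_restrict_of_integral_mul hU h.1 h.2.1 fun ζ hζ hc hs => ?_
  simpa [partialDeriv] using h.integral_mul_partialDeriv hζ hc hs

/-- The `L²` norm of a weak partial derivative, `∞` if there is none. -/
def weakPartialNorm (U : Set (E n)) (k : ℕ) (J : Fin k → Fin n) (f : E n → ℝ) : ℝ≥0∞ :=
  ⨅ (g : E n → ℝ) (_ : HasWeakPartial U k J f g), eLpNorm g 2 (volume.restrict U)

theorem weakPartialNorm_le_sobolevNorm {U : Set (E n)} {k m : ℕ} (hk : k ≤ m) (J : Fin k → Fin n)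
    (f : E n → E n) (i : Fin n) : weakPartialNorm U k J (fun x => f x i) ≤ sobolevNorm m U f := by
  have h1 : weakPartialNorm U k J (fun x => f x i) ≤
      ∑ i : Fin n, weakPartialNorm U k J (fun x => f x i) :=
    Finset.single_le_sum (f := fun i : Fin n => weakPartialNorm U k J (fun x => f x i))
      (fun _ _ => zero_le) (Finset.mem_univ i)
  have h2 : ∑ i : Fin n, weakPartialNorm U k J (fun x => f x i) ≤
      ∑ J : Fin k → Fin n, ∑ i : Fin n, weakPartialNorm U k J (fun x => f x i) :=
    Finset.single_le_sum
      (f := fun J : Fin k → Fin n => ∑ i : Fin n, weakPartialNorm U k J (fun x => f x i))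
      (fun _ _ => zero_le) (Finset.mem_univ J)
  have h3 : ∑ J : Fin k → Fin n, ∑ i : Fin n, weakPartialNorm U k J (fun x => f x i) ≤
      sobolevNorm m U f :=
    Finset.single_le_sum (f := fun k : ℕ => ∑ J : Fin k → Fin n, ∑ i : Fin n,
      weakPartialNorm U k J (fun x => f x i))
      (fun _ _ => zero_le) (Finset.mem_range.2 (Nat.lt_succ_of_le hk))
  exact h1.trans (h2.trans h3)

theorem weakPartialNorm_add_le (U : Set (E n)) (k : ℕ) (J : Fin k → Fin n) (f g : E n → ℝ) :
    weakPartialNorm U k J (fun x => f x + g x) ≤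
      weakPartialNorm U k J f + weakPartialNorm U k J g := by
  refine ENNReal.le_iInf₂_add_iInf₂ fun a ha b hb => ?_
  refine (iInf₂_le _ (ha.add hb)).trans ?_
  exact eLpNorm_add_le ha.2.1.aestronglyMeasurable hb.2.1.aestronglyMeasurable (by norm_num)

theorem weakPartialNorm_const_mul_le (U : Set (E n)) (k : ℕ) (J : Fin k → Fin n) (f : E n → ℝ)
    {c : ℝ} (hc : c ≠ 0) :
    weakPartialNorm U k J (fun x => c * f x) ≤ ‖c‖ₑ * weakPartialNorm U k J f := by
  unfold weakPartialNorm
  have h0 : ‖c‖ₑ ≠ 0 := by simpa using hc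
  -- A nonzero finite factor commutes with the infimum, even over an empty family, where the value
  -- is `∞`.
  rw [ENNReal.mul_iInf_of_ne h0 (by simp)]
  refine le_iInf fun a => ?_
  rw [ENNReal.mul_iInf_of_ne h0 (by simp)]
  refine le_iInf fun ha => ?_
  refine (iInf₂_le _ (ha.const_mul c)).trans ?_
  exact (eLpNorm_const_smul c a 2 _).le

theorem sobolevNorm_add_le (m : ℕ) (U : Set (E n)) (f g : E n → E n) :
    sobolevNorm m U (fun x => f x + g x) ≤ sobolevNorm m U f + sobolevNorm m U g := by
  simp only [sobolevNorm, ← Finset.sum_add_distrib]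
  refine Finset.sum_le_sum fun k _ => Finset.sum_le_sum fun J _ => Finset.sum_le_sum fun i _ => ?_
  exact weakPartialNorm_add_le U k J (fun x => f x i) (fun x => g x i)

theorem sobolevNorm_const_smul_le (m : ℕ) (U : Set (E n)) (f : E n → E n) {c : ℝ} (hc : c ≠ 0) :
    sobolevNorm m U (fun x => c • f x) ≤ ‖c‖ₑ * sobolevNorm m U f := by
  simp only [sobolevNorm, Finset.mul_sum]
  refine Finset.sum_le_sum fun k _ => Finset.sum_le_sum fun J _ => Finset.sum_le_sum fun i _ => ?_
  exact weakPartialNorm_const_mul_le U k J (fun x => f x i) hc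

theorem sobolevNorm_sub_le (m : ℕ) (U : Set (E n)) (f g : E n → E n) :
    sobolevNorm m U (fun x => f x - g x) ≤ sobolevNorm m U f + sobolevNorm m U g := by
  have h1 := sobolevNorm_const_smul_le m U g (c := -1) (by norm_num)
  have h2 := sobolevNorm_add_le m U f (fun x => (-1 : ℝ) • g x)
  simp only [neg_smul, one_smul, ← sub_eq_add_neg, enorm_neg, enorm_one, one_mul] at h1 h2
  exact h2.trans (by gcongr)

/-! ### The space `W^{1,2}` -/

theorem MemW12.add {U : Set (E n)} {u v : E n → E n} {G H : E n → Mat n} (hu : MemW12 U u G)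
    (hv : MemW12 U v H) : MemW12 U (fun x => u x + v x) (fun x => G x + H x) :=
  ⟨fun i => (hu.1 i).add (hv.1 i), fun i j => (hu.2.1 i j).add (hv.2.1 i j),
    fun i j => (hu.2.2 i j).add (hv.2.2 i j)⟩

theorem MemW12.const_smul {U : Set (E n)} {u : E n → E n} {G : E n → Mat n} (hu : MemW12 U u G)
    (c : ℝ) : MemW12 U (fun x => c • u x) (fun x => c • G x) :=
  ⟨fun i => (hu.1 i).const_mul c, fun i j => (hu.2.1 i j).const_mul c,
    fun i j => (hu.2.2 i j).const_mul c⟩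

theorem MemW12.sub {U : Set (E n)} {u v : E n → E n} {G H : E n → Mat n} (hu : MemW12 U u G)
    (hv : MemW12 U v H) : MemW12 U (fun x => u x - v x) (fun x => G x - H x) := by
  have := hu.add (hv.const_smul (-1))
  simpa only [neg_smul, one_smul, ← sub_eq_add_neg] using this

theorem MemW12.mono {U V : Set (E n)} {u : E n → E n} {G : E n → Mat n} (hu : MemW12 U u G)
    (hV : V ⊆ U) : MemW12 V u G :=
  ⟨fun i => (hu.1 i).mono_measure (Measure.restrict_mono_set _ hV),
    fun i j => (hu.2.1 i j).mono_measure (Measure.restrict_mono_set _ hV),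
    fun i j => (hu.2.2 i j).mono hV⟩

/-- By uniqueness of weak derivatives the infimum in the norm runs over one almost-everywhere class,
so any given gradient realizes it. -/
theorem MemW12.eLpNorm_le_sobolevNorm {U : Set (E n)} (hU : IsOpen U) {u : E n → E n}
    {G : E n → Mat n} (hu : MemW12 U u G) (i j : Fin n) :
    eLpNorm (fun x => G x i j) 2 (volume.restrict U) ≤ sobolevNorm 1 U u := by
  refine le_trans ?_ (weakPartialNorm_le_sobolevNorm le_rfl (fun _ => j) u i)
  refine le_iInf₂ fun g hg => ?_
  exact (eLpNorm_congr_ae ((hu.2.2 i j).unique hU hg)).le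

theorem exists_hasWeakPartial_of_sobolevNorm_lt_top {U : Set (E n)} {u : E n → E n} {k m : ℕ}
    (h : sobolevNorm m U u < ⊤) (hk : k ≤ m) (J : Fin k → Fin n) (i : Fin n) :
    ∃ g, HasWeakPartial U k J (fun x => u x i) g ∧ MemLp g 2 (volume.restrict U) := by
  have h1 := (weakPartialNorm_le_sobolevNorm hk J u i).trans_lt h
  simp only [weakPartialNorm, iInf_lt_iff] at h1
  obtain ⟨g, hg, hlt⟩ := h1
  exact ⟨g, hg, hg.2.1.aestronglyMeasurable, hlt⟩

theorem exists_memW12_of_sobolevNorm_lt_top {U : Set (E n)} (hU : IsOpen U) {u : E n → E n}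
    (h : sobolevNorm 1 U u < ⊤) : ∃ G, MemW12 U u G := by
  choose g hg hg2 using fun (i j : Fin n) =>
    exists_hasWeakPartial_of_sobolevNorm_lt_top h le_rfl (fun _ : Fin 1 => j) i
  refine ⟨fun x i j => g i j x, fun i => ?_, fun i j => hg2 i j, fun i j => hg i j⟩
  obtain ⟨f, hf, hf2⟩ := exists_hasWeakPartial_of_sobolevNorm_lt_top h zero_le_one Fin.elim0 i
  exact hf2.ae_eq (hf.ae_eq_of_zero hU).symm

/-! ### An elementary Sobolev embedding -/

/-- The partial derivative in the direction of the coordinate `i`. -/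
def coordDeriv (i : Fin n) (f : E n → ℝ) (x : E n) : ℝ := fderiv ℝ f x (EuclideanSpace.single i 1)

/-- The iterated partial derivative along a list of coordinates; the head acts last. -/
def coordDerivs : List (Fin n) → (E n → ℝ) → E n → ℝ
  | [], f => f
  | i :: l, f => coordDeriv i (coordDerivs l f)

theorem contDiff_coordDeriv (i : Fin n) {f : E n → ℝ} (hf : ContDiff ℝ ∞ f) :
    ContDiff ℝ ∞ (coordDeriv i f) :=
  (hf.fderiv_right (m := ∞) (by simp)).clm_apply contDiff_const

theorem tsupport_coordDeriv_subset (i : Fin n) (f : E n → ℝ) :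
    tsupport (coordDeriv i f) ⊆ tsupport f :=
  tsupport_fderiv_apply_subset ℝ _

theorem contDiff_coordDerivs (l : List (Fin n)) {f : E n → ℝ} (hf : ContDiff ℝ ∞ f) :
    ContDiff ℝ ∞ (coordDerivs l f) := by
  induction l with
  | nil => exact hf
  | cons i l ih => exact contDiff_coordDeriv i ih

theorem tsupport_coordDerivs_subset (l : List (Fin n)) (f : E n → ℝ) :
    tsupport (coordDerivs l f) ⊆ tsupport f := by
  induction l with
  | nil => exact subset_rfl
  | cons i l ih => exact (tsupport_coordDeriv_subset i _).trans ih

theorem hasCompactSupport_coordDerivs (l : List (Fin n)) {f : E n → ℝ} (hf : HasCompactSupport f) :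
    HasCompactSupport (coordDerivs l f) :=
  hf.of_isClosed_subset (isClosed_tsupport _) (tsupport_coordDerivs_subset l f)

theorem coordDerivs_append_singleton (l : List (Fin n)) (i : Fin n) (f : E n → ℝ) :
    coordDerivs (l ++ [i]) f = coordDerivs l (coordDeriv i f) := by
  induction l with
  | nil => rfl
  | cons j l ih => simp [coordDerivs, ih]

theorem partialDeriv_eq_coordDerivs {k : ℕ} (J : Fin k → Fin n) {f : E n → ℝ}
    (hf : ContDiff ℝ ∞ f) : partialDeriv J f = coordDerivs (List.ofFn J) f := by
  induction k with
  | zero => ext x; simp [partialDeriv, coordDerivs]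
  | succ k ih =>
    ext x
    have hd : DifferentiableAt ℝ (iteratedFDeriv ℝ k f) x := by
      refine (ContDiff.differentiable_iteratedFDeriv (n := ∞) ?_ hf) x
      exact_mod_cast WithTop.coe_lt_top k
    rw [partialDeriv, hd.iteratedFDeriv_succ_apply_left', List.ofFn_succ, coordDerivs,
      ← ih, coordDeriv]
    rfl

theorem integral_mul_coordDeriv {f ζ : E n → ℝ} (hf : ContDiff ℝ ∞ f) (hζ : ContDiff ℝ ∞ ζ)
    (hc : HasCompactSupport ζ) (i : Fin n) :
    ∫ x, f x * coordDeriv i ζ x = -∫ x, coordDeriv i f x * ζ x := by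
  have hc' : HasCompactSupport (coordDeriv i ζ) :=
    hc.of_isClosed_subset (isClosed_tsupport _) (tsupport_coordDeriv_subset i ζ)
  refine integral_mul_fderiv_eq_neg_fderiv_mul_of_integrable ?_ ?_ ?_
    (fun x _ => (hf.differentiable (by simp)) x) (fun x _ => (hζ.differentiable (by simp)) x)
  · exact ((contDiff_coordDeriv i hf).continuous.mul hζ.continuous).integrable_of_hasCompactSupport
      (hc.mul_left)
  · exact (hf.continuous.mul (contDiff_coordDeriv i hζ).continuous).integrable_of_hasCompactSupport
      (hc'.mul_left)
  · exact (hf.continuous.mul hζ.continuous).integrable_of_hasCompactSupport (hc.mul_left)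

theorem integral_mul_coordDerivs {f ζ : E n → ℝ} (hf : ContDiff ℝ ∞ f) (hζ : ContDiff ℝ ∞ ζ)
    (hc : HasCompactSupport ζ) (l : List (Fin n)) :
    ∫ x, f x * coordDerivs l ζ x = (-1) ^ l.length * ∫ x, coordDerivs l.reverse f x * ζ x := by
  induction l generalizing f with
  | nil => simp [coordDerivs]
  | cons i l ih =>
    rw [coordDerivs, integral_mul_coordDeriv hf (contDiff_coordDerivs l hζ)
      (hasCompactSupport_coordDerivs l hc), ih (contDiff_coordDeriv i hf), List.reverse_cons,
      coordDerivs_append_singleton, List.length_cons]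
    ring

/-- The classical derivative agrees almost everywhere with every weak one. Integration by parts
reverses the order of the directions; keeping the reversed list avoids any appeal to the symmetry of
mixed derivatives. -/
theorem eLpNorm_coordDerivs_le_weakPartialNorm {U : Set (E n)} (hU : IsOpen U) {f : E n → ℝ}
    (hf : ContDiff ℝ ∞ f) {k : ℕ} (J : Fin k → Fin n) :
    eLpNorm (coordDerivs (List.ofFn J).reverse f) 2 (volume.restrict U) ≤
      weakPartialNorm U k J f := by
  refine le_iInf₂ fun g hg => (eLpNorm_congr_ae ?_).le
  refine ae_eq_restrict_of_integral_mul hU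
    ((contDiff_coordDerivs _ hf).continuous.locallyIntegrable.locallyIntegrableOn U) hg.2.1
    fun ζ hζ hc hs => ?_
  have h1 := hg.integral_mul_partialDeriv hζ hc hs
  rw [partialDeriv_eq_coordDerivs J hζ, integral_mul_coordDerivs hf hζ hc, List.length_ofFn] at h1
  exact mul_left_cancel₀ (pow_ne_zero _ (by norm_num)) h1

/-- Each new coordinate is handled by the fundamental theorem of calculus on a line, where the
function vanishes near `-∞`; iterated integration then accumulates the coordinates in the list. -/
theorem enorm_le_lmarginal_coordDerivs {f : E n → ℝ} (hf : ContDiff ℝ ∞ f)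
    (hc : HasCompactSupport f) (l : List (Fin n)) (hl : l.Nodup) (x : Fin n → ℝ) :
    ‖f (WithLp.toLp 2 x)‖ₑ ≤ (lmarginal (fun _ => volume) l.toFinset
      (fun y => ‖coordDerivs l f (WithLp.toLp 2 y)‖ₑ)) x := by
  induction l with
  | nil => simp [coordDerivs]
  | cons i l ih =>
    rw [List.nodup_cons] at hl
    refine (ih hl.2).trans ?_
    have hm : ∀ l : List (Fin n),
        Measurable (fun y : Fin n → ℝ => ‖coordDerivs l f (WithLp.toLp 2 y)‖ₑ) := fun l =>
      (((contDiff_coordDerivs l hf).continuous.comp (PiLp.continuous_toLp 2 _)).enorm).measurable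
    rw [List.toFinset_cons, lmarginal_insert' _ (hm _) (by simpa using hl.1)]
    refine lmarginal_mono (fun y => ?_) x
    have hu : ContDiff ℝ 1 (fun z : Fin n → ℝ => coordDerivs l f (WithLp.toLp 2 z)) :=
      ((contDiff_coordDerivs l hf).of_le (by simp)).comp PiLp.contDiff_toLp
    have h2u : HasCompactSupport (fun z : Fin n → ℝ => coordDerivs l f (WithLp.toLp 2 z)) :=
      (hasCompactSupport_coordDerivs l hc).comp_homeomorph
        (PiLp.homeomorph 2 (fun _ : Fin n => ℝ)).symm
    calc ‖coordDerivs l f (WithLp.toLp 2 y)‖ₑ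
        ≤ ∫⁻ s in Iic (y i), ‖deriv ((fun z => coordDerivs l f (WithLp.toLp 2 z)) ∘
            Function.update y i) s‖ₑ := by
          apply le_trans (by simp) (HasCompactSupport.enorm_le_lintegral_Ici_deriv _ _ _)
          · exact hu.comp (by convert! contDiff_update 1 y i)
          · exact h2u.comp_isClosedEmbedding (isClosedEmbedding_update y i)
      _ ≤ ∫⁻ s, ‖deriv ((fun z => coordDerivs l f (WithLp.toLp 2 z)) ∘
            Function.update y i) s‖ₑ := setLIntegral_le_lintegral _ _
      _ = ∫⁻ s, ‖coordDerivs (i :: l) f (WithLp.toLp 2 (Function.update y i s))‖ₑ := by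
          congr with s
          congr 1
          have h1 : HasDerivAt (fun s => WithLp.toLp 2 (Function.update y i s))
              (EuclideanSpace.single i (1 : ℝ)) s := by
            have := (PiLp.hasFDerivAt_toLp (𝕜 := ℝ) 2 (Function.update y i s)).comp_hasDerivAt s
              (hasDerivAt_update y i s)
            exact this
          have h2 := ((contDiff_coordDerivs l hf).differentiable (by simp)
            (WithLp.toLp 2 (Function.update y i s))).hasFDerivAt.comp_hasDerivAt s h1
          exact h2.deriv

/-- With every coordinate in the list, the marginal is the whole `L¹` norm of the mixed derivative
of order `n`. Its support lies in `Ω`, so the Cauchy–Schwarz inequality passes to `L²` at the price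
of `|Ω|^{1/2}`. -/
theorem enorm_le_eLpNorm_coordDerivs {Ω : Set (E n)} {f : E n → ℝ}
    (hf : ContDiff ℝ ∞ f) (hc : HasCompactSupport f) (hs : tsupport f ⊆ Ω) (l : List (Fin n))
    (hl : l.Nodup) (hl' : ∀ i, i ∈ l) (x : E n) :
    ‖f x‖ₑ ≤ eLpNorm (coordDerivs l f) 2 (volume.restrict Ω) * volume Ω ^ (1 / 2 : ℝ) := by
  have h1 := enorm_le_lmarginal_coordDerivs hf hc l hl (WithLp.ofLp x)
  have h2 : l.toFinset = Finset.univ := by ext i; simp [hl']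
  rw [h2, lmarginal_univ] at h1
  have h3 : ∫⁻ y : Fin n → ℝ, ‖coordDerivs l f (WithLp.toLp 2 y)‖ₑ =
      ∫⁻ y, ‖coordDerivs l f y‖ₑ :=
    (PiLp.volume_preserving_toLp (Fin n)).lintegral_comp
      (contDiff_coordDerivs l hf).continuous.enorm.measurable
  have h4 : ∫⁻ y, ‖coordDerivs l f y‖ₑ = eLpNorm (coordDerivs l f) 1 (volume.restrict Ω) := by
    rw [eLpNorm_one_eq_lintegral_enorm, ← setLIntegral_eq_of_support_subset]
    intro y hy
    exact hs (tsupport_coordDerivs_subset l f (subset_tsupport _ fun h => hy (by simp [h])))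
  rw [← volume_pi, h3, h4] at h1
  refine h1.trans ?_
  have h5 := eLpNorm_le_eLpNorm_mul_rpow_measure_univ (μ := volume.restrict Ω) (p := 1) (q := 2)
    (by norm_num) (contDiff_coordDerivs l hf).continuous.aestronglyMeasurable
  rw [Measure.restrict_apply_univ] at h5
  norm_num at h5 ⊢
  exact h5

/-- A smooth field with compact support in `Ω`. -/
structure IsTestField (Ω : Set (E n)) (f : E n → E n) : Prop where
  contDiff : ContDiff ℝ ∞ f
  compact : HasCompactSupport f
  subset : tsupport f ⊆ Ω

theorem IsTestField.sub {Ω : Set (E n)} {f g : E n → E n} (hf : IsTestField Ω f)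
    (hg : IsTestField Ω g) : IsTestField Ω (fun x => f x - g x) :=
  ⟨hf.contDiff.sub hg.contDiff, hf.compact.sub hg.compact,
    (tsupport_sub f g).trans (union_subset hf.subset hg.subset)⟩

theorem IsTestField.const_smul {Ω : Set (E n)} {f : E n → E n} (hf : IsTestField Ω f) (c : ℝ) :
    IsTestField Ω (fun x => c • f x) :=
  ⟨hf.contDiff.const_smul c, hf.compact.smul_left (f := fun _ => c),
    (tsupport_smul_subset_right (fun _ => c) f).trans hf.subset⟩

theorem IsTestField.fderiv_eq_zero {Ω : Set (E n)} {f : E n → E n} (hf : IsTestField Ω f)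
    {x : E n} (hx : x ∉ Ω) : fderiv ℝ f x = 0 :=
  image_eq_zero_of_notMem_tsupport fun h => hx (hf.subset (tsupport_fderiv_subset ℝ h))

theorem enorm_le_sum_enorm_apply (v : E n) : ‖v‖ₑ ≤ ∑ i, ‖v i‖ₑ := by
  have h : v = ∑ i, v i • EuclideanSpace.single i (1 : ℝ) := by
    ext j
    simp [Pi.single_apply]
  calc ‖v‖ₑ = ‖∑ i, v i • EuclideanSpace.single i (1 : ℝ)‖ₑ := by rw [← h]
    _ ≤ ∑ i, ‖v i • EuclideanSpace.single i (1 : ℝ)‖ₑ := enorm_sum_le _ _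
    _ = ∑ i, ‖v i‖ₑ := by
      refine Finset.sum_congr rfl fun i _ => ?_
      rw [enorm_smul, ← ofReal_norm (EuclideanSpace.single i (1 : ℝ))]
      simp

theorem norm_clm_le_sum (A : E n →L[ℝ] E n) :
    ‖A‖ ≤ ∑ j, ‖A (EuclideanSpace.single j 1)‖ := by
  refine A.opNorm_le_bound (by positivity) fun v => ?_
  have h : v = ∑ i, v i • EuclideanSpace.single i (1 : ℝ) := by
    ext j
    simp [Pi.single_apply]
  calc ‖A v‖ = ‖∑ j, v j • A (EuclideanSpace.single j 1)‖ := by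
        conv_lhs => rw [h]
        simp [map_sum]
    _ ≤ ∑ j, ‖v j • A (EuclideanSpace.single j 1)‖ := norm_sum_le _ _
    _ ≤ ∑ j, ‖A (EuclideanSpace.single j 1)‖ * ‖v‖ := by
        refine Finset.sum_le_sum fun j _ => ?_
        rw [norm_smul, mul_comm]
        gcongr
        exact PiLp.norm_apply_le v j
    _ = _ := by rw [Finset.sum_mul]

theorem enorm_clm_le_sum (A : E n →L[ℝ] E n) :
    ‖A‖ₑ ≤ ∑ j, ∑ i, ‖A (EuclideanSpace.single j 1) i‖ₑ := by
  have h1 : ‖A‖ₑ ≤ ∑ j, ‖A (EuclideanSpace.single j 1)‖ₑ := by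
    rw [← ofReal_norm A]
    simp only [← ofReal_norm (A _)]
    rw [← ENNReal.ofReal_sum_of_nonneg (fun _ _ => norm_nonneg _)]
    exact ENNReal.ofReal_le_ofReal (norm_clm_le_sum A)
  exact h1.trans (Finset.sum_le_sum fun j _ => enorm_le_sum_enorm_apply _)

theorem contDiff_apply_of_contDiff {f : E n → E n} {m : WithTop ℕ∞} (hf : ContDiff ℝ m f)
    (i : Fin n) : ContDiff ℝ m (fun x => f x i) :=
  (EuclideanSpace.proj i : E n →L[ℝ] ℝ).contDiff.comp hf

theorem fderiv_apply_apply {f : E n → E n} {x : E n} (hf : DifferentiableAt ℝ f x) (i : Fin n)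
    (v : E n) : fderiv ℝ (fun x => f x i) x v = fderiv ℝ f x v i := by
  have := ((EuclideanSpace.proj i : E n →L[ℝ] ℝ).hasFDerivAt
    (x := f x)).comp x hf.hasFDerivAt
  have h2 : HasFDerivAt (fun x => f x i)
    ((EuclideanSpace.proj i : E n →L[ℝ] ℝ).comp (fderiv ℝ f x)) x := this
  rw [h2.fderiv]
  rfl

theorem tsupport_apply_subset (f : E n → E n) (i : Fin n) :
    tsupport (fun x => f x i) ⊆ tsupport f :=
  closure_mono fun x hx h => hx (by simp [h])

theorem IsTestField.enorm_apply_le {Ω : Set (E n)} (hΩ : IsOpen Ω) {s : ℕ} (hs : n + 1 ≤ s)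
    {f : E n → E n} (hf : IsTestField Ω f) (x : E n) (i : Fin n) :
    ‖f x i‖ₑ ≤ sobolevNorm s Ω f * volume Ω ^ (1 / 2 : ℝ) := by
  have hc : HasCompactSupport (fun x => f x i) :=
    hf.compact.of_isClosed_subset (isClosed_tsupport _) (tsupport_apply_subset f i)
  refine (enorm_le_eLpNorm_coordDerivs (contDiff_apply_of_contDiff hf.contDiff i) hc
    ((tsupport_apply_subset f i).trans hf.subset) (List.finRange n) (List.nodup_finRange n)
    (List.mem_finRange) x).trans ?_
  gcongr
  have h := eLpNorm_coordDerivs_le_weakPartialNorm hΩ (contDiff_apply_of_contDiff hf.contDiff i)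
    (List.finRange n).reverse.get
  rw [List.ofFn_get, List.reverse_reverse] at h
  exact h.trans (weakPartialNorm_le_sobolevNorm (by simp; omega) _ f i)

theorem IsTestField.enorm_fderiv_apply_le {Ω : Set (E n)} (hΩ : IsOpen Ω) {s : ℕ}
    (hs : n + 1 ≤ s) {f : E n → E n} (hf : IsTestField Ω f) (x : E n) (i j : Fin n) :
    ‖fderiv ℝ f x (EuclideanSpace.single j 1) i‖ₑ ≤
      sobolevNorm s Ω f * volume Ω ^ (1 / 2 : ℝ) := by
  have hd := contDiff_apply_of_contDiff hf.contDiff i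
  have hsub : tsupport (coordDeriv j fun x => f x i) ⊆ tsupport f :=
    (tsupport_coordDeriv_subset j _).trans (tsupport_apply_subset f i)
  have hc : HasCompactSupport (coordDeriv j fun x => f x i) :=
    hf.compact.of_isClosed_subset (isClosed_tsupport _) hsub
  rw [← fderiv_apply_apply (hf.contDiff.differentiable (by simp) x) i]
  refine (enorm_le_eLpNorm_coordDerivs (contDiff_coordDeriv j hd) hc
    (hsub.trans hf.subset) (List.finRange n) (List.nodup_finRange n)
    (List.mem_finRange) x).trans ?_
  gcongr
  -- The derivative in direction `j` is followed by one derivative in each coordinate: `n + 1`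
  -- derivatives in all, whence the condition `n + 1 ≤ s`.
  have h := eLpNorm_coordDerivs_le_weakPartialNorm hΩ hd (List.finRange n ++ [j]).reverse.get
  rw [List.ofFn_get, List.reverse_reverse, coordDerivs_append_singleton] at h
  exact h.trans (weakPartialNorm_le_sobolevNorm (by simp; omega) _ f i)

/-- The constant of the Sobolev embedding. -/
def embeddingConst (Ω : Set (E n)) : ℝ≥0∞ := (n + 1 : ℕ) * (n + 1 : ℕ) * volume Ω ^ (1 / 2 : ℝ)

theorem embeddingConst_ne_top {Ω : Set (E n)} (hΩ : Bornology.IsBounded Ω) :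
    embeddingConst Ω ≠ ⊤ :=
  ENNReal.mul_ne_top (ENNReal.mul_ne_top (by simp) (by simp))
    (ENNReal.rpow_ne_top_of_nonneg (by norm_num) hΩ.measure_lt_top.ne)

theorem IsTestField.enorm_le {Ω : Set (E n)} (hΩ : IsOpen Ω) {s : ℕ} (hs : n + 1 ≤ s)
    {f : E n → E n} (hf : IsTestField Ω f) (x : E n) :
    ‖f x‖ₑ ≤ embeddingConst Ω * sobolevNorm s Ω f := by
  calc ‖f x‖ₑ ≤ ∑ i : Fin n, ‖f x i‖ₑ := enorm_le_sum_enorm_apply _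
    _ ≤ ∑ i : Fin n, sobolevNorm s Ω f * volume Ω ^ (1 / 2 : ℝ) :=
        Finset.sum_le_sum fun i _ => hf.enorm_apply_le hΩ hs x i
    _ = (n : ℕ) * 1 * (sobolevNorm s Ω f * volume Ω ^ (1 / 2 : ℝ)) := by simp
    _ ≤ (n + 1 : ℕ) * (n + 1 : ℕ) * (sobolevNorm s Ω f * volume Ω ^ (1 / 2 : ℝ)) := by
        gcongr
        · simp
        · exact_mod_cast Nat.succ_pos n
    _ = _ := by rw [embeddingConst]; ring

theorem IsTestField.enorm_fderiv_le {Ω : Set (E n)} (hΩ : IsOpen Ω) {s : ℕ} (hs : n + 1 ≤ s)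
    {f : E n → E n} (hf : IsTestField Ω f) (x : E n) :
    ‖fderiv ℝ f x‖ₑ ≤ embeddingConst Ω * sobolevNorm s Ω f := by
  calc ‖fderiv ℝ f x‖ₑ ≤ ∑ j, ∑ i, ‖fderiv ℝ f x (EuclideanSpace.single j 1) i‖ₑ :=
        enorm_clm_le_sum _
    _ ≤ ∑ j : Fin n, ∑ i : Fin n, sobolevNorm s Ω f * volume Ω ^ (1 / 2 : ℝ) :=
        Finset.sum_le_sum fun j _ => Finset.sum_le_sum fun i _ =>
          hf.enorm_fderiv_apply_le hΩ hs x i j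
    _ = (n : ℕ) * (n : ℕ) * (sobolevNorm s Ω f * volume Ω ^ (1 / 2 : ℝ)) := by
        simp [mul_assoc]
    _ ≤ (n + 1 : ℕ) * (n + 1 : ℕ) * (sobolevNorm s Ω f * volume Ω ^ (1 / 2 : ℝ)) := by
        gcongr <;> simp
    _ = _ := by rw [embeddingConst]; ring

/-! ### `C¹` regularity of Sobolev limits of test fields. -/

theorem exists_hasFDerivAt_of_uniformCauchy {ι : Type*} {l : Filter ι} [NeBot l]
    {f : ι → E n → E n} {f' : ι → E n → E n →L[ℝ] E n} {g : E n → E n}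
    (hf : ∀ᶠ i in l, ∀ x, HasFDerivAt (f i) (f' i x) x)
    (hg : ∀ x, Tendsto (fun i => f i x) l (𝓝 (g x)))
    (hc : ∀ ε > 0, ∀ᶠ p in l ×ˢ l, ∀ x, ‖f' (p : ι × ι).1 x - f' p.2 x‖ < ε) :
    ∃ g' : E n → E n →L[ℝ] E n, (∀ x, HasFDerivAt g (g' x) x) ∧ TendstoUniformly f' g' l := by
  have hU : UniformCauchySeqOn f' l univ := by
    intro u hu
    obtain ⟨ε, hε, hεu⟩ := Metric.mem_uniformity_dist.1 hu
    filter_upwards [hc ε hε] with p hp x _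
    exact hεu (by rw [dist_eq_norm]; exact hp x)
  have hx : ∀ x, ∃ y, Tendsto (fun i => f' i x) l (𝓝 y) := fun x =>
    cauchy_map_iff_exists_tendsto.1 (hU.cauchy_map (mem_univ x))
  choose g' hg' using hx
  have hT : TendstoUniformly f' g' l :=
    tendstoUniformlyOn_univ.1 (hU.tendstoUniformlyOn_of_tendsto fun x _ => hg' x)
  refine ⟨g', fun x => ?_, hT⟩
  refine hasFDerivAt_of_tendstoUniformlyOnFilter (l := l) (f := f)
    ((tendstoUniformly_iff_tendstoUniformlyOnFilter.1 hT).mono_right le_top) ?_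
    (Eventually.of_forall hg)
  filter_upwards [hf.prod_inl (𝓝 x)] with p hp
  exact hp p.2

/-- A limit in `W^{s,2}`, and pointwise, of smooth fields with compact support in `Ω`. -/
def IsTestLimit (s : ℕ) (Ω : Set (E n)) (f : E n → E n) : Prop :=
  ∃ ψ : ℕ → E n → E n, (∀ k, IsTestField Ω (ψ k)) ∧
    Tendsto (fun k => sobolevNorm s Ω (fun x => ψ k x - f x)) atTop (𝓝 0) ∧
    ∀ x, Tendsto (fun k => ψ k x) atTop (𝓝 (f x))

theorem IsTestLimit.sub {s : ℕ} {Ω : Set (E n)} {f g : E n → E n} (hf : IsTestLimit s Ω f)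
    (hg : IsTestLimit s Ω g) : IsTestLimit s Ω (fun x => f x - g x) := by
  obtain ⟨a, ha, hN, hp⟩ := hf
  obtain ⟨b, hb, hN', hp'⟩ := hg
  refine ⟨fun k x => a k x - b k x, fun k => (ha k).sub (hb k), ?_, fun x => (hp x).sub (hp' x)⟩
  refine tendsto_of_tendsto_of_tendsto_of_le_of_le tendsto_const_nhds
    (by simpa using hN.add hN') (fun _ => zero_le) fun k => ?_
  have := sobolevNorm_sub_le s Ω (fun x => a k x - f x) (fun x => b k x - g x)
  refine le_trans (le_of_eq ?_) this
  congr 1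
  ext1 x
  exact sub_sub_sub_comm _ _ _ _

theorem IsTestLimit.const_smul {s : ℕ} {Ω : Set (E n)} {f : E n → E n} (hf : IsTestLimit s Ω f)
    {c : ℝ} (hc : c ≠ 0) : IsTestLimit s Ω (fun x => c • f x) := by
  obtain ⟨a, ha, hN, hp⟩ := hf
  refine ⟨fun k x => c • a k x, fun k => (ha k).const_smul c, ?_, fun x => (hp x).const_smul c⟩
  refine tendsto_of_tendsto_of_tendsto_of_le_of_le tendsto_const_nhds
    (by simpa using ENNReal.Tendsto.const_mul hN (a := ‖c‖ₑ) (by simp)) (fun _ => zero_le)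
    fun k => ?_
  have := sobolevNorm_const_smul_le s Ω (fun x => a k x - f x) hc
  refine le_trans (le_of_eq ?_) this
  congr 1
  ext1 x
  rw [smul_sub]

theorem norm_lt_of_enorm_lt_ofReal {F : Type*} [NormedAddCommGroup F] {x : F} {ε : ℝ}
    (h : ‖x‖ₑ < ENNReal.ofReal ε) : ‖x‖ < ε := by
  rw [← ofReal_norm] at h
  exact (ENNReal.ofReal_lt_ofReal_iff_of_nonneg (norm_nonneg _)).1 h

/-- Differences of the approximants are again test fields, so the embedding makes their derivatives
uniformly Cauchy on the whole space. -/
theorem exists_uniform_limit_of_testFields {s : ℕ} {Ω : Set (E n)} (hΩ : IsOpen Ω)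
    (hΩb : Bornology.IsBounded Ω) (hs : n + 1 ≤ s) {f : E n → E n} {ψ : ℕ → E n → E n}
    (hψ : ∀ k, IsTestField Ω (ψ k))
    (hN : Tendsto (fun k => sobolevNorm s Ω (fun x => ψ k x - f x)) atTop (𝓝 0))
    (hp : ∀ x, Tendsto (fun k => ψ k x) atTop (𝓝 (f x))) :
    ∃ f' : E n → E n →L[ℝ] E n, (∀ x, HasFDerivAt f (f' x) x) ∧
      TendstoUniformly (fun k => fderiv ℝ (ψ k)) f' atTop := by
  have hd : ∀ k x, HasFDerivAt (ψ k) (fderiv ℝ (ψ k) x) x := fun k x =>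
    ((hψ k).contDiff.differentiable (by simp) x).hasFDerivAt
  refine exists_hasFDerivAt_of_uniformCauchy (Eventually.of_forall hd) hp fun ε hε => ?_
  have h1 : Tendsto (fun p : ℕ × ℕ => embeddingConst Ω *
      (sobolevNorm s Ω (fun x => ψ p.1 x - f x) + sobolevNorm s Ω (fun x => ψ p.2 x - f x)))
      (atTop ×ˢ atTop) (𝓝 0) := by
    have := ENNReal.Tendsto.const_mul (a := embeddingConst Ω)
      ((hN.comp tendsto_fst).add (hN.comp tendsto_snd))
      (Or.inr (embeddingConst_ne_top hΩb))
    simpa using this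
  filter_upwards [h1.eventually_lt_const (ENNReal.ofReal_pos.2 hε)] with p hp x
  have h2 := ((hψ p.1).sub (hψ p.2)).enorm_fderiv_le hΩ hs x
  rw [fderiv_fun_sub (hd p.1 x).differentiableAt (hd p.2 x).differentiableAt] at h2
  refine norm_lt_of_enorm_lt_ofReal ((h2.trans ?_).trans_lt hp)
  gcongr
  refine le_trans (le_of_eq ?_) (sobolevNorm_sub_le s Ω _ _)
  congr 1
  ext1 x
  abel

theorem IsTestLimit.contDiff {s : ℕ} {Ω : Set (E n)} (hΩ : IsOpen Ω)
    (hΩb : Bornology.IsBounded Ω) (hs : n + 1 ≤ s) {f : E n → E n} (hf : IsTestLimit s Ω f) :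
    ContDiff ℝ 1 f := by
  obtain ⟨ψ, hψ, hN, hp⟩ := hf
  obtain ⟨f', hf', hu⟩ := exists_uniform_limit_of_testFields hΩ hΩb hs hψ hN hp
  rw [contDiff_one_iff_hasFDerivAt]
  refine ⟨f', hu.continuous (Frequently.of_forall fun k => ?_), hf'⟩
  exact (hψ k).contDiff.continuous_fderiv (by simp)

/-- This includes the points of `∂Ω`. It is what lets a diffeomorphism of `Ω` be continued by the
identity with a continuous derivative. -/
theorem IsTestLimit.fderiv_eq_zero {s : ℕ} {Ω : Set (E n)} (hΩ : IsOpen Ω)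
    (hΩb : Bornology.IsBounded Ω) (hs : n + 1 ≤ s) {f : E n → E n} (hf : IsTestLimit s Ω f)
    {x : E n} (hx : x ∉ Ω) : fderiv ℝ f x = 0 := by
  obtain ⟨ψ, hψ, hN, hp⟩ := hf
  obtain ⟨f', hf', hu⟩ := exists_uniform_limit_of_testFields hΩ hΩb hs hψ hN hp
  rw [(hf' x).fderiv]
  refine tendsto_nhds_unique (hu.tendsto_at x) ?_
  simp only [(hψ _).fderiv_eq_zero hx, tendsto_const_nhds]

theorem IsTestLimit.enorm_le {s : ℕ} {Ω : Set (E n)} (hΩ : IsOpen Ω)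
    (hΩb : Bornology.IsBounded Ω) (hs : n + 1 ≤ s) {f : E n → E n} (hf : IsTestLimit s Ω f)
    (x : E n) : ‖f x‖ₑ ≤ embeddingConst Ω * sobolevNorm s Ω f ∧
      ‖fderiv ℝ f x‖ₑ ≤ embeddingConst Ω * sobolevNorm s Ω f := by
  obtain ⟨ψ, hψ, hN, hp⟩ := hf
  obtain ⟨f', hf', hu⟩ := exists_uniform_limit_of_testFields hΩ hΩb hs hψ hN hp
  have hle : ∀ k, sobolevNorm s Ω (ψ k) ≤
      sobolevNorm s Ω f + sobolevNorm s Ω (fun x => ψ k x - f x) := fun k => by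
    refine le_trans (le_of_eq ?_) (sobolevNorm_add_le s Ω _ _)
    congr 1
    ext1 x
    abel
  have hlim : Tendsto (fun k => embeddingConst Ω *
      (sobolevNorm s Ω f + sobolevNorm s Ω (fun x => ψ k x - f x))) atTop
      (𝓝 (embeddingConst Ω * sobolevNorm s Ω f)) := by
    have := ENNReal.Tendsto.const_mul (a := embeddingConst Ω)
      (hN.const_add (sobolevNorm s Ω f)) (Or.inr (embeddingConst_ne_top hΩb))
    simpa using this
  constructor
  · refine le_of_tendsto_of_tendsto' (hp x).enorm hlim fun k => ?_
    exact ((hψ k).enorm_le hΩ hs x).trans (by gcongr; exact hle k)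
  · rw [(hf' x).fderiv]
    refine le_of_tendsto_of_tendsto' (hu.tendsto_at x).enorm hlim fun k => ?_
    exact ((hψ k).enorm_fderiv_le hΩ hs x).trans (by gcongr; exact hle k)

theorem sobolevNorm_sub_comm (s : ℕ) (Ω : Set (E n)) (f g : E n → E n) :
    sobolevNorm s Ω (fun x => f x - g x) ≤ sobolevNorm s Ω (fun x => g x - f x) := by
  have := sobolevNorm_const_smul_le s Ω (fun x => g x - f x) (c := -1) (by norm_num)
  simpa using this

/-- The essential supremum controls the error only almost everywhere; continuity on `Ω` upgrades
this to every point, and outside `Ω` all the maps are the identity. -/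
theorem isTestLimit_of_mem_sobolevDiffeos {s : ℕ} {Ω : Set (E n)} (hΩ : IsOpen Ω)
    (hΩb : Bornology.IsBounded Ω) {φ : Equiv.Perm (E n)} (hφ : φ ∈ sobolevDiffeos s Ω) :
    IsTestLimit s Ω (fun x => φ x - x) := by
  obtain ⟨hid, hc, -, happ⟩ := hφ
  choose ψ hψ hlt using fun k : ℕ => happ ((k : ℝ≥0∞) + 1)⁻¹ (by simp)
  have h0 : Tendsto (fun k : ℕ => ((k : ℝ≥0∞) + 1)⁻¹) atTop (𝓝 0) := by
    have := ENNReal.tendsto_inv_nat_nhds_zero.comp (tendsto_add_atTop_nat 1)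
    simpa [Function.comp_def] using this
  have h1 : Tendsto (fun k => sobolevInfNorm s Ω (fun x => φ x - ψ k x)) atTop (𝓝 0) :=
    tendsto_of_tendsto_of_tendsto_of_le_of_le tendsto_const_nhds h0 (fun _ => zero_le)
      fun k => (hlt k).le
  refine ⟨fun k x => ψ k x - x, fun k => ⟨(hψ k).1.sub contDiff_id, (hψ k).2.2.1, (hψ k).2.2.2⟩,
    ?_, fun x => ?_⟩
  · refine tendsto_of_tendsto_of_tendsto_of_le_of_le tendsto_const_nhds h1 (fun _ => zero_le)
      fun k => ?_
    simp only [sub_sub_sub_cancel_right]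
    exact (sobolevNorm_sub_comm s Ω _ _).trans (le_max_right _ _)
  · refine Tendsto.sub_const ?_ x
    by_cases hx : x ∈ Ω
    -- The `L^∞` part of the norm carries the factor `|Ω|`, which is positive and finite here and
    -- can be divided out.
    · have hpos : volume Ω ≠ 0 := (hΩ.measure_pos volume ⟨x, hx⟩).ne'
      have hle : ∀ k, volume Ω * ‖φ x - ψ k x‖ₑ ≤ sobolevInfNorm s Ω (fun x => φ x - ψ k x) := by
        intro k
        refine le_trans ?_ (le_max_left _ _)
        gcongr
        set b := eLpNorm (fun x => φ x - ψ k x) ⊤ (volume.restrict Ω) with hb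
        by_contra hlt
        rw [not_le] at hlt
        have hcont : ContinuousOn (fun x => ‖φ x - ψ k x‖ₑ) Ω :=
          (hc.continuousOn.sub (hψ k).1.continuous.continuousOn).enorm
        have hopen : IsOpen (Ω ∩ (fun x => ‖φ x - ψ k x‖ₑ) ⁻¹' Ioi b) :=
          hcont.isOpen_inter_preimage hΩ isOpen_Ioi
        -- If the bound failed at `x`, it would fail on a nonempty open set, which has positive
        -- measure.
        have hp := hopen.measure_pos volume ⟨x, hx, hlt⟩
        have hae : ∀ᵐ y ∂(volume.restrict Ω), ‖φ y - ψ k y‖ₑ ≤ b := by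
          rw [hb, eLpNorm_exponent_top]
          exact enorm_ae_le_eLpNormEssSup _ _
        rw [ae_restrict_iff' hΩ.measurableSet, ae_iff] at hae
        refine hp.ne' (measure_mono_null (fun y hy => ?_) hae)
        simp only [mem_ofPred_eq, Classical.not_imp, not_le]
        exact ⟨hy.1, hy.2⟩
      have h2 : Tendsto (fun k => volume Ω * ‖φ x - ψ k x‖ₑ) atTop (𝓝 0) :=
        tendsto_of_tendsto_of_tendsto_of_le_of_le tendsto_const_nhds h1 (fun _ => zero_le) hle
      have h4 := ENNReal.Tendsto.const_mul (a := (volume Ω)⁻¹) h2 (Or.inr (by simpa using hpos))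
      rw [tendsto_iff_edist_tendsto_0]
      simp only [← mul_assoc, ENNReal.inv_mul_cancel hpos hΩb.measure_lt_top.ne, one_mul,
        mul_zero] at h4
      simpa only [edist_comm _ (φ x), edist_eq_enorm_sub] using h4
    · have h3 : ∀ k, ψ k x = x := fun k => by
        have := image_eq_zero_of_notMem_tsupport fun h => hx ((hψ k).2.2.2 h)
        exact sub_eq_zero.1 this
      simp only [h3, hid x hx, tendsto_const_nhds]

/-! ### Testing weak derivatives with continuous fields -/

theorem HasWeakPartial.integral_mul_coordDeriv {U : Set (E n)} {k : Fin n}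
    {f g : E n → ℝ} (h : HasWeakPartial U 1 (fun _ => k) f g) {ζ : E n → ℝ} (hζ : ContDiff ℝ ∞ ζ)
    (hc : HasCompactSupport ζ) (hU : tsupport ζ ⊆ U) :
    ∫ x, f x * coordDeriv k ζ x = -∫ x, g x * ζ x := by
  have := h.integral_mul_partialDeriv hζ hc hU
  rw [partialDeriv_eq_coordDerivs _ hζ] at this
  simpa [coordDerivs] using this

/-- If `div b = a` in the sense of distributions and `a`, `b` are continuous with compact support,
then `b` can be used to test weak derivatives. -/
theorem integral_mul_add_sum_integral_mul_eq_zero {U K : Set (E n)} (hU : IsOpen U)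
    (hK : IsCompact K) (hKU : K ⊆ U) {a : E n → ℝ} {b : Fin n → E n → ℝ} (ha : Continuous a)
    (hb : ∀ k, Continuous (b k)) (ha0 : ∀ x ∉ K, a x = 0) (hb0 : ∀ k, ∀ x ∉ K, b k x = 0)
    (hab : ∀ f : E n → ℝ, ContDiff ℝ ∞ f →
      ∫ x, f x * a x + ∑ k, coordDeriv k f x * b k x = 0)
    {u : E n → ℝ} {G : Fin n → E n → ℝ} (hu : ∀ k, HasWeakPartial U 1 (fun _ => k) u (G k))
    (hu0 : LocallyIntegrableOn u U) :
    ∫ x, u x * a x + ∑ k, G k x * b k x = 0 := by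
  have cs : ∀ {g : E n → ℝ}, (∀ x ∉ K, g x = 0) → HasCompactSupport g := fun hg =>
    HasCompactSupport.intro hK hg
  obtain ⟨δ, hδ, hδU⟩ := hK.exists_cthickening_subset_open hU hKU
  set L := Metric.cthickening δ K with hL
  have hLc : IsCompact L := hK.cthickening
  have hKL : K ⊆ L := Metric.self_subset_cthickening K
  set M : ℝ := (∫ x in L, |u x|) + ∑ k, ∫ x in L, |G k x| with hM
  have hM0 : 0 ≤ M := by positivity
  have hGi : ∀ k, IntegrableOn (G k) L := fun k =>
    (hu k).2.1.integrableOn_compact_subset hδU hLc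
  have hui : IntegrableOn u L := hu0.integrableOn_compact_subset hδU hLc
  -- Mollification changes each integral by at most `η` times an `L¹` norm over the neighbourhood
  -- `L` of `K`, and it makes the identity exact.
  suffices H : ∀ η > 0, |∫ x, u x * a x + ∑ k, G k x * b k x| ≤ η * M by
    by_contra hne
    have hpos := abs_pos.2 hne
    have := H (|∫ x, u x * a x + ∑ k, G k x * b k x| / (2 * (M + 1))) (by positivity)
    rw [div_mul_eq_mul_div, le_div_iff₀ (by positivity)] at this
    nlinarith
  intro η hη
  have hunif : ∀ g : E n → ℝ, Continuous g → (∀ x ∉ K, g x = 0) →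
      ∃ r > 0, ∀ x y, dist x y < r → dist (g x) (g y) < η := fun g hg h0 => by
    have := Metric.uniformContinuous_iff.1 ((cs h0).uniformContinuous_of_continuous hg) η hη
    obtain ⟨r, hr, h⟩ := this
    exact ⟨r, hr, fun x y => @h x y⟩
  obtain ⟨r₀, hr₀, ha1⟩ := hunif a ha ha0
  choose r hr hb1 using fun k => hunif (b k) (hb k) (hb0 k)
  -- The mollification radius lies below all the moduli of continuity for `η`, and below `δ`, so
  -- that the mollified fields are supported in `L ⊆ U`.
  obtain ⟨ρ, hρ, hρ0, hρδ, hρr⟩ : ∃ ρ > 0, ρ ≤ r₀ ∧ ρ ≤ δ ∧ ∀ k, ρ ≤ r k := by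
    have h1 : ∀ᶠ ρ in 𝓝[>] (0 : ℝ), ∀ k, ρ ≤ r k := by
      rw [eventually_all]
      intro k
      exact (eventually_le_nhds (hr k)).filter_mono nhdsWithin_le_nhds
    have h2 : ∀ᶠ ρ in 𝓝[>] (0 : ℝ), ρ ≤ r₀ :=
      (eventually_le_nhds hr₀).filter_mono nhdsWithin_le_nhds
    have h3 : ∀ᶠ ρ in 𝓝[>] (0 : ℝ), ρ ≤ δ :=
      (eventually_le_nhds hδ).filter_mono nhdsWithin_le_nhds
    have h4 : ∀ᶠ ρ in 𝓝[>] (0 : ℝ), 0 < ρ := self_mem_nhdsWithin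
    obtain ⟨ρ, h⟩ := (h1.and (h2.and (h3.and h4))).exists
    exact ⟨ρ, h.2.2.2, h.2.1, h.2.2.1, h.1⟩
  let B : ContDiffBump (0 : E n) := ⟨ρ / 2, ρ, by positivity, by linarith⟩
  let w : E n → ℝ := B.normed volume
  have hw : ContDiff ℝ ∞ w := B.contDiff_normed
  have hwc : HasCompactSupport w := B.hasCompactSupport_normed
  let conv : (E n → ℝ) → E n → ℝ := fun g =>
    MeasureTheory.convolution w g (ContinuousLinearMap.lsmul ℝ ℝ) volume
  have conv_close : ∀ g : E n → ℝ, Continuous g →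
      (∀ x y, dist x y < ρ → dist (g x) (g y) < η) → ∀ x, |conv g x - g x| ≤ η := by
    intro g hg h x
    have := B.dist_normed_convolution_le (μ := volume) (g := g) (x₀ := x) (ε := η)
      hg.aestronglyMeasurable (fun y hy => (h y x hy).le)
    rwa [Real.dist_eq] at this
  have conv_zero : ∀ g : E n → ℝ, Continuous g → (∀ x ∉ K, g x = 0) → ∀ x ∉ L, conv g x = 0 := by
    intro g hg h x hx
    have h1 : ∀ y ∈ Metric.ball x ρ, y ∉ K := by
      intro y hy hyK
      apply hx
      rw [hL]
      refine Metric.mem_cthickening_of_dist_le x y δ K hyK ?_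
      rw [Metric.mem_ball, dist_comm] at hy
      exact hy.le.trans hρδ
    have h2 : g x = 0 := h x (h1 x (Metric.mem_ball_self hρ))
    have := B.dist_normed_convolution_le (μ := volume) (g := g) (x₀ := x) (ε := 0)
      hg.aestronglyMeasurable (fun y hy => by rw [h y (h1 y hy), h2, dist_self])
    rw [h2] at this
    exact dist_le_zero.1 this
  have conv_smooth : ∀ g : E n → ℝ, Continuous g → ContDiff ℝ ∞ (conv g) := fun g hg =>
    hwc.contDiff_convolution_left _ hw hg.locallyIntegrable
  have conv_apply : ∀ (g : E n → ℝ) (x : E n), conv g x = ∫ t, w t * g (x - t) := fun g x => rfl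
  have conv_deriv : ∀ g : E n → ℝ, Continuous g → ∀ k x,
      coordDeriv k (conv g) x = ∫ t, coordDeriv k w t * g (x - t) := by
    intro g hg k x
    have h1 := (hwc.hasFDerivAt_convolution_left (ContinuousLinearMap.lsmul ℝ ℝ)
      (hw.of_le (by simp)) (hg.locallyIntegrable (μ := volume)) x).fderiv
    rw [coordDeriv, h1, convolution_def, ContinuousLinearMap.integral_apply]
    · rfl
    · exact (hwc.fderiv ℝ).convolutionExists_left _ (hw.continuous_fderiv (by simp))
        hg.locallyIntegrable x
  have int_w : ∀ f g : E n → ℝ, Continuous f → HasCompactSupport f → Continuous g → ∀ x,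
      Integrable (fun t => f t * g (x - t)) := fun f g hf hfc hg x =>
    (hf.mul (hg.comp (continuous_const.sub continuous_id))).integrable_of_hasCompactSupport
      hfc.mul_right
  -- The mollification of `b` has the mollification of `a` as its classical divergence: the
  -- hypothesis `hab` is applied to the reflected and translated mollifier `y ↦ w (x - y)`.
  have conv_div : ∀ x, ∑ k, coordDeriv k (conv (b k)) x = conv a x := by
    intro x
    have hdw : ∀ k, Continuous (coordDeriv k w) := fun k => (contDiff_coordDeriv k hw).continuous
    have hdc : ∀ k, HasCompactSupport (coordDeriv k w) := fun k =>
      hwc.of_isClosed_subset (isClosed_tsupport _) (tsupport_coordDeriv_subset k w)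
    have h1 := hab (fun y => w (x - y)) (hw.comp (contDiff_const.sub contDiff_id))
    have h2 : ∀ k y, coordDeriv k (fun y => w (x - y)) y = -coordDeriv k w (x - y) := by
      intro k y
      have h3 := ((hw.differentiable (by simp) (x - y)).hasFDerivAt).comp y
        ((hasFDerivAt_id (𝕜 := ℝ) y).const_sub x)
      have h4 : fderiv ℝ (fun y => w (x - y)) y = _ := h3.fderiv
      rw [coordDeriv, h4]
      simp [coordDeriv]
    simp only [h2] at h1
    have h5 := integral_sub_left_eq_self
      (fun t => w t * a (x - t) + ∑ k, -coordDeriv k w t * b k (x - t)) volume x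
    simp only [sub_sub_cancel] at h5
    rw [h1, integral_add (int_w w a hw.continuous hwc ha x) (integrable_finsetSum _ fun k _ =>
      int_w (fun t => -coordDeriv k w t) (b k) (hdw k).neg (hdc k).neg (hb k) x),
      integral_finsetSum _ fun k _ =>
      int_w (fun t => -coordDeriv k w t) (b k) (hdw k).neg (hdc k).neg (hb k) x] at h5
    simp only [neg_mul, integral_neg, Finset.sum_neg_distrib] at h5
    simp only [conv_deriv _ (hb _), conv_apply]
    linarith
  have conv_supp : ∀ g : E n → ℝ, Continuous g → (∀ x ∉ K, g x = 0) → tsupport (conv g) ⊆ L := by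
    intro g hg h0
    refine closure_minimal (fun x hx => ?_) hLc.isClosed
    by_contra hxL
    exact hx (conv_zero g hg h0 x hxL)
  have conv_cs : ∀ g : E n → ℝ, Continuous g → (∀ x ∉ K, g x = 0) →
      HasCompactSupport (conv g) := fun g hg h0 =>
    hLc.of_isClosed_subset (isClosed_tsupport _) (conv_supp g hg h0)
  have supp : ∀ g : E n → ℝ, (∀ x ∉ K, g x = 0) → tsupport g ⊆ U := by
    intro g h0
    refine (closure_minimal (fun x hx => ?_) hK.isClosed).trans hKU
    by_contra hxL
    exact hx (h0 x hxL)
  have int1 : ∀ v g : E n → ℝ, LocallyIntegrableOn v U → Continuous g → (∀ x ∉ K, g x = 0) →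
      Integrable (fun x => v x * g x) := fun v g hv hg h0 =>
    integrable_mul_of_tsupport_subset hv hg (cs h0) (supp g h0)
  have int2 : ∀ v g : E n → ℝ, LocallyIntegrableOn v U → Continuous g → (∀ x ∉ K, g x = 0) →
      Integrable (fun x => v x * conv g x) := fun v g hv hg h0 =>
    integrable_mul_of_tsupport_subset hv (conv_smooth g hg).continuous (conv_cs g hg h0)
      ((conv_supp g hg h0).trans hδU)
  have est : ∀ v g : E n → ℝ, LocallyIntegrableOn v U → Continuous g → (∀ x ∉ K, g x = 0) →
      (∀ x y, dist x y < ρ → dist (g x) (g y) < η) →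
      |(∫ x, v x * g x) - ∫ x, v x * conv g x| ≤ η * ∫ x in L, |v x| := by
    intro v g hv hg h0 hu
    have hvL : IntegrableOn v L := hv.integrableOn_compact_subset hδU hLc
    rw [← integral_sub (int1 v g hv hg h0) (int2 v g hv hg h0),
      ← setIntegral_eq_integral_of_forall_compl_eq_zero (s := L) (fun x hx => by
        rw [h0 x fun h => hx (hKL h), conv_zero g hg h0 x hx]; simp), ← integral_const_mul]
    refine abs_integral_le_integral_abs.trans (integral_mono_of_nonneg
      (Eventually.of_forall fun x => abs_nonneg _) (hvL.abs.const_mul η)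
      (Eventually.of_forall fun x => ?_))
    have := conv_close g hg hu x
    rw [abs_sub_comm] at this
    simp only [← mul_sub, abs_mul]
    rw [mul_comm]
    gcongr
  -- The components of the mollified field are genuine test functions in `U`, so the definition of
  -- the weak derivative applies to each.
  have weak : ∫ x, u x * conv a x = -∑ k, ∫ x, G k x * conv (b k) x := by
    have hds : ∀ k, tsupport (coordDeriv k (conv (b k))) ⊆ U := fun k =>
      (tsupport_coordDeriv_subset k _).trans ((conv_supp _ (hb k) (hb0 k)).trans hδU)
    simp only [← conv_div, Finset.mul_sum]
    rw [integral_finsetSum _ fun k _ => integrable_mul_of_tsupport_subset hu0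
      (contDiff_coordDeriv k (conv_smooth _ (hb k))).continuous
      ((conv_cs _ (hb k) (hb0 k)).of_isClosed_subset (isClosed_tsupport _)
        (tsupport_coordDeriv_subset k _)) (hds k), ← Finset.sum_neg_distrib]
    exact Finset.sum_congr rfl fun k _ => (hu k).integral_mul_coordDeriv (conv_smooth _ (hb k))
      (conv_cs _ (hb k) (hb0 k)) ((conv_supp _ (hb k) (hb0 k)).trans hδU)
  rw [integral_add (int1 u a hu0 ha ha0) (integrable_finsetSum _ fun k _ =>
    int1 (G k) (b k) (hu k).2.1 (hb k) (hb0 k)), integral_finsetSum _ fun k _ =>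
    int1 (G k) (b k) (hu k).2.1 (hb k) (hb0 k)]
  have e1 := est u a hu0 ha ha0 fun x y h => ha1 x y (h.trans_le hρ0)
  have e2 : ∀ k, _ := fun k => est (G k) (b k) (hu k).2.1 (hb k) (hb0 k)
    fun x y h => hb1 k x y (h.trans_le (hρr k))
  calc |(∫ x, u x * a x) + ∑ k, ∫ x, G k x * b k x|
      = |((∫ x, u x * a x) - ∫ x, u x * conv a x) +
          ∑ k, ((∫ x, G k x * b k x) - ∫ x, G k x * conv (b k) x)| := by
        rw [weak, Finset.sum_sub_distrib]
        congr 1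
        ring
    _ ≤ η * (∫ x in L, |u x|) + ∑ k, η * ∫ x in L, |G k x| := by
        refine (abs_add_le _ _).trans (add_le_add e1 ?_)
        exact (Finset.abs_sum_le_sum_abs _ _).trans (Finset.sum_le_sum fun k _ => e2 k)
    _ = η * M := by rw [hM, mul_add, Finset.mul_sum]

/-! ### `C¹` diffeomorphisms that are the identity outside `Ω` -/

/-- A `C¹` diffeomorphism of the space that is, to first order, the identity outside `Ω`. -/
structure IsC1Diffeo (Ω : Set (E n)) (Φ : Equiv.Perm (E n)) : Prop where
  contDiff : ContDiff ℝ 1 Φ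
  contDiff_symm : ContDiff ℝ 1 Φ.symm
  eq_self : ∀ x ∉ Ω, Φ x = x
  fderiv_eq : ∀ x ∉ Ω, fderiv ℝ Φ x = ContinuousLinearMap.id ℝ (E n)

namespace IsC1Diffeo

variable {Ω : Set (E n)} {Φ Ψ : Equiv.Perm (E n)}

theorem hasFDerivAt (h : IsC1Diffeo Ω Φ) (x : E n) : HasFDerivAt Φ (fderiv ℝ Φ x) x :=
  (h.contDiff.differentiable (by simp) x).hasFDerivAt

theorem symm_eq_self (h : IsC1Diffeo Ω Φ) {x : E n} (hx : x ∉ Ω) : Φ.symm x = x := by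
  rw [Equiv.symm_apply_eq, h.eq_self x hx]

theorem fderiv_symm_comp (h : IsC1Diffeo Ω Φ) (x : E n) :
    (fderiv ℝ Φ.symm (Φ x)).comp (fderiv ℝ Φ x) = ContinuousLinearMap.id ℝ (E n) := by
  have h1 := ((h.contDiff_symm.differentiable (by simp) (Φ x)).hasFDerivAt).comp x (h.hasFDerivAt x)
  have h2 : (Φ.symm ∘ Φ : E n → E n) = id := by ext1 y; simp
  rw [h2] at h1
  exact h1.unique (hasFDerivAt_id x)

theorem symm (h : IsC1Diffeo Ω Φ) : IsC1Diffeo Ω Φ.symm where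
  contDiff := h.contDiff_symm
  contDiff_symm := h.contDiff
  eq_self _ hx := h.symm_eq_self hx
  fderiv_eq x hx := by
    have := h.fderiv_symm_comp x
    rwa [h.eq_self x hx, h.fderiv_eq x hx, ContinuousLinearMap.comp_id] at this

theorem mul (h : IsC1Diffeo Ω Φ) (h' : IsC1Diffeo Ω Ψ) : IsC1Diffeo Ω (Φ * Ψ) where
  contDiff := h.contDiff.comp h'.contDiff
  contDiff_symm := h'.contDiff_symm.comp h.contDiff_symm
  eq_self x hx := by rw [Equiv.Perm.mul_apply, h'.eq_self x hx, h.eq_self x hx]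
  fderiv_eq x hx := by
    have h1 := (h.hasFDerivAt (Ψ x)).comp x (h'.hasFDerivAt x)
    have h2 : fderiv ℝ (Φ * Ψ : Equiv.Perm (E n)) x = _ := h1.fderiv
    rw [h2, h'.eq_self x hx, h.fderiv_eq x hx, h'.fderiv_eq x hx, ContinuousLinearMap.id_comp]

theorem continuous_fderiv (h : IsC1Diffeo Ω Φ) : Continuous (fderiv ℝ Φ) :=
  h.contDiff.continuous_fderiv (by simp)

/-- A continuous function of the derivative is bounded. -/
theorem exists_norm_le (hΩ : Bornology.IsBounded Ω) (h : IsC1Diffeo Ω Φ) {F : Type*}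
    [NormedAddCommGroup F] {g : (E n →L[ℝ] E n) → F} (hg : Continuous g) :
    ∃ c, 0 ≤ c ∧ ∀ x, ‖g (fderiv ℝ Φ x)‖ ≤ c := by
  obtain ⟨c, hc⟩ := hΩ.isCompact_closure.exists_bound_of_continuousOn
    (hg.comp h.continuous_fderiv).continuousOn
  refine ⟨max c ‖g (ContinuousLinearMap.id ℝ (E n))‖, le_max_of_le_right (norm_nonneg _),
    fun x => ?_⟩
  by_cases hx : x ∈ Ω
  · exact le_max_of_le_left (hc x (subset_closure hx))
  · rw [h.fderiv_eq x hx]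
    exact le_max_right _ _

theorem image_self (h : IsC1Diffeo Ω Φ) : Φ '' Ω = Ω := by
  have h1 : ∀ {Φ : Equiv.Perm (E n)}, IsC1Diffeo Ω Φ → ∀ x ∈ Ω, Φ x ∈ Ω := by
    intro Φ h x hx
    by_contra hn
    have := h.symm_eq_self hn
    rw [Equiv.symm_apply_apply] at this
    exact hn (this ▸ hx)
  refine Subset.antisymm (image_subset_iff.2 (h1 h)) fun x hx => ?_
  exact ⟨Φ.symm x, h1 h.symm x hx, by simp⟩

theorem image_diff (h : IsC1Diffeo Ω Φ) (K : Set (E n)) : Φ '' (Ω \ K) = Ω \ Φ '' K := by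
  rw [Set.image_sdiff Φ.injective, h.image_self]

/-- The underlying homeomorphism. -/
def homeomorph (h : IsC1Diffeo Ω Φ) : E n ≃ₜ E n where
  toEquiv := Φ
  continuous_toFun := h.contDiff.continuous
  continuous_invFun := h.contDiff_symm.continuous

theorem measurableEmbedding (h : IsC1Diffeo Ω Φ) : MeasurableEmbedding Φ :=
  h.homeomorph.measurableEmbedding

theorem isClosed_image (h : IsC1Diffeo Ω Φ) {K : Set (E n)} (hK : IsClosed K) :
    IsClosed (Φ '' K) := h.homeomorph.isClosedMap K hK

theorem integral_image (h : IsC1Diffeo Ω Φ) {S : Set (E n)} (hS : MeasurableSet S) (g : E n → ℝ) :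
    ∫ x in Φ '' S, g x = ∫ x in S, |(fderiv ℝ Φ x).det| * g (Φ x) :=
  integral_image_eq_integral_abs_det_fderiv_smul volume hS
    (fun x _ => (h.hasFDerivAt x).hasFDerivWithinAt) Φ.injective.injOn g

theorem integral_comp (h : IsC1Diffeo Ω Φ) (g : E n → ℝ) :
    ∫ x, g x = ∫ x, |(fderiv ℝ Φ x).det| * g (Φ x) := by
  have := h.integral_image MeasurableSet.univ g
  rwa [image_univ, Φ.surjective.range_eq, setIntegral_univ, setIntegral_univ] at this

/-- The volume of preimages is controlled. -/
theorem exists_map_le (hΩ : Bornology.IsBounded Ω) (h : IsC1Diffeo Ω Φ) :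
    ∃ c : ℝ≥0∞, c ≠ ⊤ ∧ c ≠ 0 ∧ Measure.map Φ volume ≤ c • (volume : Measure (E n)) := by
  obtain ⟨c, hc0, hc⟩ := h.symm.exists_norm_le hΩ ContinuousLinearMap.continuous_det
  -- The summand `1` keeps the factor nonzero, as the scaling rule for `L^p` norms requires.
  refine ⟨ENNReal.ofReal (c + 1), ENNReal.ofReal_ne_top, by simp; linarith,
    Measure.le_iff.2 fun A hA => ?_⟩
  rw [Measure.map_apply h.contDiff.continuous.measurable hA, ← Φ.image_symm_eq_preimage,
    ← setLIntegral_one, lintegral_image_eq_lintegral_abs_det_fderiv_mul volume hA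
    (fun x _ => (h.symm.hasFDerivAt x).hasFDerivWithinAt) Φ.symm.injective.injOn]
  calc ∫⁻ x in A, ENNReal.ofReal |(fderiv ℝ Φ.symm x).det| * 1
      ≤ ∫⁻ x in A, ENNReal.ofReal (c + 1) := by
        refine lintegral_mono fun x => ?_
        rw [mul_one]
        exact ENNReal.ofReal_le_ofReal ((hc x).trans (by linarith))
    _ = _ := by simp

theorem map_restrict_preimage_le {c : ℝ≥0∞} (h : IsC1Diffeo Ω Φ)
    (hc : Measure.map Φ volume ≤ c • (volume : Measure (E n))) {S : Set (E n)}
    (hS : MeasurableSet S) :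
    Measure.map Φ (volume.restrict (Φ ⁻¹' S)) ≤ c • volume.restrict S := by
  rw [← Measure.restrict_map h.contDiff.continuous.measurable hS, ← Measure.restrict_smul]
  exact Measure.restrict_mono subset_rfl hc

theorem quasiMeasurePreserving (hΩ : Bornology.IsBounded Ω) (h : IsC1Diffeo Ω Φ) :
    Measure.QuasiMeasurePreserving Φ volume volume := by
  obtain ⟨c, -, -, hc⟩ := h.exists_map_le hΩ
  exact ⟨h.contDiff.continuous.measurable,
    (Measure.absolutelyContinuous_of_le hc).trans (Measure.smul_absolutelyContinuous)⟩

theorem volume_image_eq_zero (hΩ : Bornology.IsBounded Ω) (h : IsC1Diffeo Ω Φ) {K : Set (E n)}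
    (hK : volume K = 0) : volume (Φ '' K) = 0 := by
  rw [Φ.image_eq_preimage_symm]
  exact (h.symm.quasiMeasurePreserving hΩ).preimage_null hK

/-- Composition is bounded on `L²`. -/
theorem exists_eLpNorm_comp_le (hΩ : Bornology.IsBounded Ω) (h : IsC1Diffeo Ω Φ) :
    ∃ c : ℝ≥0∞, c ≠ ⊤ ∧ ∀ S : Set (E n), MeasurableSet S → ∀ f : E n → ℝ,
      AEStronglyMeasurable f (volume.restrict S) →
      AEStronglyMeasurable (fun x => f (Φ x)) (volume.restrict (Φ ⁻¹' S)) ∧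
      eLpNorm (fun x => f (Φ x)) 2 (volume.restrict (Φ ⁻¹' S)) ≤
        c * eLpNorm f 2 (volume.restrict S) := by
  obtain ⟨c, hc, hc0, hle⟩ := h.exists_map_le hΩ
  refine ⟨c ^ (1 / (2 : ℝ≥0∞)).toReal, ENNReal.rpow_ne_top_of_nonneg (by positivity) hc,
    fun S hS f hf => ?_⟩
  have h1 := h.map_restrict_preimage_le hle hS
  have h2 : AEStronglyMeasurable f (Measure.map Φ (volume.restrict (Φ ⁻¹' S))) :=
    hf.mono_ac ((Measure.absolutelyContinuous_of_le h1).trans Measure.smul_absolutelyContinuous)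
  refine ⟨h2.comp_measurable h.contDiff.continuous.measurable, ?_⟩
  have h3 := eLpNorm_map_measure (p := 2) h2 h.contDiff.continuous.aemeasurable
  rw [Function.comp_def] at h3
  rw [← h3]
  refine (eLpNorm_mono_measure f h1).trans ?_
  rw [eLpNorm_smul_measure_of_ne_zero hc0, smul_eq_mul]

theorem memLp_comp (hΩ : Bornology.IsBounded Ω) (h : IsC1Diffeo Ω Φ) {S : Set (E n)}
    (hS : MeasurableSet S) {f : E n → ℝ} (hf : MemLp f 2 (volume.restrict S)) :
    MemLp (fun x => f (Φ x)) 2 (volume.restrict (Φ ⁻¹' S)) := by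
  obtain ⟨c, hc, H⟩ := h.exists_eLpNorm_comp_le hΩ
  obtain ⟨h1, h2⟩ := H S hS f hf.1
  exact ⟨h1, h2.trans_lt (ENNReal.mul_lt_top hc.lt_top hf.2)⟩

/-- Traces are invariant under diffeomorphisms that are the identity at the boundary. -/
theorem hasTrace_comp (hΩ : IsOpen Ω) (hΩb : Bornology.IsBounded Ω) (h : IsC1Diffeo Ω Φ)
    {u g : E n → E n} (hu : HasTrace Ω u g) : HasTrace Ω (fun x => u (Φ x)) g := by
  obtain ⟨c, hc, -, hle⟩ := h.exists_map_le hΩb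
  obtain ⟨L, hL0, hL⟩ := h.exists_norm_le hΩb continuous_id
  have hLip : LipschitzWith (L + 1).toNNReal Φ :=
    lipschitzWith_of_nnnorm_fderiv_le (𝕜 := ℝ) (h.contDiff.differentiable (by simp)) fun x => by
      rw [← NNReal.coe_le_coe, Real.coe_toNNReal _ (by linarith)]
      exact (hL x).trans (by linarith)
  have hL1 : 0 < L + 1 := by linarith
  have hmem : ∀ᵐ x ∂((Measure.hausdorffMeasure ((n : ℝ) - 1)).restrict (frontier Ω)),
      x ∈ frontier Ω := ae_restrict_mem isClosed_frontier.measurableSet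
  filter_upwards [hu, hmem] with x hx hxf
  -- Boundary points of an open set lie outside it, so `Φ` fixes `x`. Being Lipschitz, it maps `Ω ∩
  -- B(x, r)` into `Ω ∩ B(x, (L + 1) r)`.
  have hxΩ : x ∉ Ω := by
    rw [hΩ.frontier_eq] at hxf
    exact hxf.2
  have hsc : Tendsto (fun r : ℝ => (L + 1) * r) (𝓝[>] 0) (𝓝[>] 0) := by
    refine tendsto_nhdsWithin_iff.2 ⟨?_, ?_⟩
    · have : Tendsto (fun r : ℝ => (L + 1) * r) (𝓝 0) (𝓝 ((L + 1) * 0)) :=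
        tendsto_id.const_mul _
      rw [mul_zero] at this
      exact this.mono_left nhdsWithin_le_nhds
    · filter_upwards [self_mem_nhdsWithin] with r hr
      exact mul_pos hL1 hr
  have hlim := ENNReal.Tendsto.const_mul (a := ENNReal.ofReal ((L + 1) ^ n) * c) (hx.comp hsc)
    (Or.inr (ENNReal.mul_ne_top ENNReal.ofReal_ne_top hc))
  rw [mul_zero] at hlim
  refine tendsto_of_tendsto_of_tendsto_of_le_of_le' tendsto_const_nhds hlim
    (Eventually.of_forall fun _ => zero_le) ?_
  filter_upwards [self_mem_nhdsWithin] with r hr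
  have hr : 0 < r := hr
  set A := Ω ∩ Metric.ball x r with hA
  have hAo : IsOpen A := hΩ.inter Metric.isOpen_ball
  have hAm : MeasurableSet (Φ '' A) := h.measurableEmbedding.measurableSet_image.2 hAo.measurableSet
  have hsub : Φ '' A ⊆ Ω ∩ Metric.ball x ((L + 1) * r) := by
    rintro _ ⟨y, hy, rfl⟩
    refine ⟨h.image_self ▸ mem_image_of_mem Φ hy.1, ?_⟩
    have := hLip.dist_le_mul y x
    rw [h.eq_self x hxΩ, Real.coe_toNNReal _ hL1.le] at this
    exact this.trans_lt (by have := hy.2; rw [Metric.mem_ball] at this; gcongr)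
  have hInt : ∫⁻ y in A, ‖u (Φ y) - g x‖ₑ ≤
      c * ∫⁻ y in Ω ∩ Metric.ball x ((L + 1) * r), ‖u y - g x‖ₑ := by
    have h1 := h.map_restrict_preimage_le hle hAm
    rw [preimage_image_eq _ Φ.injective] at h1
    rw [← h.measurableEmbedding.lintegral_map (fun y => ‖u y - g x‖ₑ)]
    refine (lintegral_mono' h1 le_rfl).trans ?_
    rw [lintegral_smul_measure, smul_eq_mul]
    gcongr
  -- Normalizing by the larger radius costs the constant `(L + 1)^n`.
  have hpow : (ENNReal.ofReal (r ^ n))⁻¹ =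
      ENNReal.ofReal ((L + 1) ^ n) * (ENNReal.ofReal (((L + 1) * r) ^ n))⁻¹ := by
    rw [mul_pow, ENNReal.ofReal_mul (by positivity), ENNReal.mul_inv (by simp) (by simp),
      ← mul_assoc, ENNReal.mul_inv_cancel (by simp; positivity) ENNReal.ofReal_ne_top, one_mul]
  calc (ENNReal.ofReal (r ^ n))⁻¹ * ∫⁻ y in A, ‖u (Φ y) - g x‖ₑ
      ≤ (ENNReal.ofReal (r ^ n))⁻¹ *
        (c * ∫⁻ y in Ω ∩ Metric.ball x ((L + 1) * r), ‖u y - g x‖ₑ) := by gcongr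
    _ = _ := by
      rw [hpow]
      simp only [Function.comp]
      ring

end IsC1Diffeo

/-! ### The chain rule for weak derivatives under `C¹` diffeomorphisms. -/

theorem fderiv_apply_eq_sum {f : E n → ℝ} {x : E n} (v : E n) :
    fderiv ℝ f x v = ∑ k, coordDeriv k f x * v k := by
  have h : v = ∑ i, v i • EuclideanSpace.single i (1 : ℝ) := by
    ext j
    simp [Pi.single_apply]
  conv_lhs => rw [h]
  simp [map_sum, coordDeriv, mul_comm]

theorem continuous_grad_apply {Φ : E n → E n} (h : ContDiff ℝ 1 Φ) (k j : Fin n) :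
    Continuous fun x => grad Φ x k j :=
  (EuclideanSpace.proj k : E n →L[ℝ] ℝ).continuous.comp
    ((h.continuous_fderiv (by simp)).clm_apply continuous_const)

theorem abs_grad_apply_le (Φ : E n → E n) (x : E n) (k j : Fin n) :
    |grad Φ x k j| ≤ ‖fderiv ℝ Φ x‖ := by
  calc |grad Φ x k j| ≤ ‖fderiv ℝ Φ x (EuclideanSpace.single j 1)‖ :=
        PiLp.norm_apply_le (fderiv ℝ Φ x (EuclideanSpace.single j 1)) k
    _ ≤ ‖fderiv ℝ Φ x‖ * ‖EuclideanSpace.single j (1 : ℝ)‖ := ContinuousLinearMap.le_opNorm _ _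
    _ = _ := by simp

theorem memLp_mul_of_bound {μ : Measure (E n)} {f g : E n → ℝ} (hf : MemLp f 2 μ)
    (hg : AEStronglyMeasurable g μ) {c : ℝ} (hc : ∀ x, |g x| ≤ c) :
    MemLp (fun x => f x * g x) 2 μ := by
  refine hf.of_le_mul (c := c) (hf.1.mul hg) (Eventually.of_forall fun x => ?_)
  rw [norm_mul, mul_comm]
  gcongr
  exact hc x

namespace IsC1Diffeo

variable {Ω : Set (E n)} {Φ : Equiv.Perm (E n)}

/-- The chain rule for weak derivatives. -/
theorem hasWeakPartial_comp (h : IsC1Diffeo Ω Φ) {U : Set (E n)}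
    (hU : IsOpen U) {u : E n → ℝ} {G : Fin n → E n → ℝ}
    (hu : ∀ k, HasWeakPartial U 1 (fun _ => k) u (G k))
    (hi : LocallyIntegrableOn (fun x => u (Φ x)) (Φ ⁻¹' U)) (j : Fin n)
    (hi' : LocallyIntegrableOn (fun x => ∑ k, G k (Φ x) * grad Φ x k j) (Φ ⁻¹' U)) :
    HasWeakPartial (Φ ⁻¹' U) 1 (fun _ => j) (fun x => u (Φ x))
      (fun x => ∑ k, G k (Φ x) * grad Φ x k j) := by
  refine hasWeakPartial_of_integral hi hi' fun ζ hζ hc hs => ?_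
  rw [partialDeriv_eq_coordDerivs _ hζ]
  simp only [List.ofFn_succ, List.ofFn_zero, coordDerivs, pow_one, neg_mul, one_mul]
  have hΦc := h.contDiff.continuous
  have hΨc := h.contDiff_symm.continuous
  have hdet : Continuous fun x => |(fderiv ℝ Φ.symm x).det| :=
    (ContinuousLinearMap.continuous_det.comp h.symm.continuous_fderiv).abs
  have hdζ : Continuous (coordDeriv j ζ) := (contDiff_coordDeriv j hζ).continuous
  -- These are the test data `∂_j ζ` and `ζ ∂_j Φ` transported by `Φ`. The field `b` is merely
  -- continuous, since `Φ` is only `C¹`, but its distributional divergence is the continuous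
  -- function `a`.
  let a : E n → ℝ := fun x => |(fderiv ℝ Φ.symm x).det| * coordDeriv j ζ (Φ.symm x)
  let b : Fin n → E n → ℝ := fun k x =>
    |(fderiv ℝ Φ.symm x).det| * (grad Φ (Φ.symm x) k j * ζ (Φ.symm x))
  have hK : IsCompact (Φ '' tsupport ζ) := hc.isCompact.image hΦc
  have hmem : ∀ x ∉ Φ '' tsupport ζ, Φ.symm x ∉ tsupport ζ := fun x hx hx' =>
    hx ⟨Φ.symm x, hx', by simp⟩
  have key := integral_mul_add_sum_integral_mul_eq_zero (a := a) (b := b) (u := u) (G := G) hU hK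
    (image_subset_iff.2 hs) (hdet.mul (hdζ.comp hΨc))
    (fun k => hdet.mul (((continuous_grad_apply h.contDiff k j).comp hΨc).mul
      (hζ.continuous.comp hΨc)))
    (fun x hx => by
      simp only [a]
      rw [image_eq_zero_of_notMem_tsupport
        (fun h' => hmem x hx (tsupport_coordDeriv_subset j ζ h')), mul_zero])
    (fun k x hx => by
      simp only [b]
      rw [image_eq_zero_of_notMem_tsupport (hmem x hx), mul_zero, mul_zero])
    (fun f hf => ?_) hu (hu j).1
  · have h1 := h.symm.integral_comp
      (fun y => u (Φ y) * coordDeriv j ζ y + (∑ k, G k (Φ y) * grad Φ y k j) * ζ y)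
    have h2 : ∀ x, u x * a x + ∑ k, G k x * b k x = |(fderiv ℝ Φ.symm x).det| *
        (u (Φ (Φ.symm x)) * coordDeriv j ζ (Φ.symm x) +
          (∑ k, G k (Φ (Φ.symm x)) * grad Φ (Φ.symm x) k j) * ζ (Φ.symm x)) := by
      intro x
      simp only [a, b, Equiv.apply_symm_apply, mul_add, Finset.sum_mul, Finset.mul_sum]
      congr 1
      · ring
      · exact Finset.sum_congr rfl fun k _ => by ring
    simp only [h2] at key
    rw [key, integral_add (integrable_mul_of_tsupport_subset hi hdζ
      (hc.of_isClosed_subset (isClosed_tsupport _) (tsupport_coordDeriv_subset j ζ))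
      ((tsupport_coordDeriv_subset j ζ).trans hs))
      (integrable_mul_of_tsupport_subset hi' hζ.continuous hc hs)] at h1
    linarith
  -- It remains to verify `div b = a`. For smooth `f` the change of variables reduces it to
  -- integration by parts for the `C¹` function `f ∘ Φ` against `ζ`.
  · have h1 := h.symm.integral_comp
      (fun y => f (Φ y) * coordDeriv j ζ y + fderiv ℝ (fun y => f (Φ y)) y
        (EuclideanSpace.single j 1) * ζ y)
    have hfΦ : ContDiff ℝ 1 (fun y => f (Φ y)) := (hf.of_le (by simp)).comp h.contDiff
    have h3 : ∀ y, fderiv ℝ (fun y => f (Φ y)) y (EuclideanSpace.single j 1) =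
        ∑ k, coordDeriv k f (Φ y) * grad Φ y k j := by
      intro y
      have h4 := (hf.differentiable (by simp) (Φ y)).hasFDerivAt.comp y (h.hasFDerivAt y)
      have h5 : fderiv ℝ (fun y => f (Φ y)) y = _ := h4.fderiv
      rw [h5, ContinuousLinearMap.comp_apply, fderiv_apply_eq_sum]
      rfl
    have h2 : ∀ x, f x * a x + ∑ k, coordDeriv k f x * b k x = |(fderiv ℝ Φ.symm x).det| *
        (f (Φ (Φ.symm x)) * coordDeriv j ζ (Φ.symm x) +
          fderiv ℝ (fun y => f (Φ y)) (Φ.symm x) (EuclideanSpace.single j 1) * ζ (Φ.symm x)) := by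
      intro x
      rw [h3]
      simp only [a, b, Equiv.apply_symm_apply, mul_add, Finset.sum_mul, Finset.mul_sum]
      congr 1
      · ring
      · exact Finset.sum_congr rfl fun k _ => by ring
    simp only [h2]
    have hcd : HasCompactSupport (coordDeriv j ζ) :=
      hc.of_isClosed_subset (isClosed_tsupport _) (tsupport_coordDeriv_subset j ζ)
    have hci : Continuous fun y => fderiv ℝ (fun y => f (Φ y)) y (EuclideanSpace.single j 1) :=
      (hfΦ.continuous_fderiv (by simp)).clm_apply continuous_const
    have i1 : Integrable (fun y => f (Φ y) * coordDeriv j ζ y) :=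
      (hfΦ.continuous.mul hdζ).integrable_of_hasCompactSupport hcd.mul_left
    have i2 : Integrable (fun y => fderiv ℝ (fun y => f (Φ y)) y (EuclideanSpace.single j 1)
        * ζ y) := (hci.mul hζ.continuous).integrable_of_hasCompactSupport hc.mul_left
    rw [← h1, integral_add i1 i2]
    have := integral_mul_fderiv_eq_neg_fderiv_mul_of_integrable (f := fun y => f (Φ y)) (g := ζ)
      (v := EuclideanSpace.single j 1) (μ := volume) i2 i1
      ((hfΦ.continuous.mul hζ.continuous).integrable_of_hasCompactSupport hc.mul_left)
      (fun y _ => hfΦ.differentiable (by simp) y) (fun y _ => hζ.differentiable (by simp) y)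
    have h6 : ∫ y, f (Φ y) * coordDeriv j ζ y = _ := this
    rw [h6]
    ring

theorem memW12_comp (hΩb : Bornology.IsBounded Ω) (h : IsC1Diffeo Ω Φ) {U : Set (E n)}
    (hU : IsOpen U) {u : E n → E n} {G : E n → Mat n} (hu : MemW12 U u G) :
    MemW12 (Φ ⁻¹' U) (fun x => u (Φ x)) (fun x => G (Φ x) * grad Φ x) := by
  obtain ⟨L, hL0, hL⟩ := h.exists_norm_le hΩb continuous_id
  have h1 : ∀ i, MemLp (fun x => u (Φ x) i) 2 (volume.restrict (Φ ⁻¹' U)) := fun i =>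
    h.memLp_comp hΩb hU.measurableSet (hu.1 i)
  have h2 : ∀ i j, MemLp (fun x => ∑ k, G (Φ x) i k * grad Φ x k j) 2
      (volume.restrict (Φ ⁻¹' U)) := fun i j => by
    refine memLp_finsetSum _ fun k _ => memLp_mul_of_bound
      (h.memLp_comp hΩb hU.measurableSet (hu.2.1 i k))
      (continuous_grad_apply h.contDiff k j).aestronglyMeasurable
      fun x => (abs_grad_apply_le Φ x k j).trans (hL x)
  have hloc : ∀ {f : E n → ℝ}, MemLp f 2 (volume.restrict (Φ ⁻¹' U)) →
      LocallyIntegrableOn f (Φ ⁻¹' U) := fun hf => by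
    rw [locallyIntegrableOn_iff (hU.preimage h.contDiff.continuous).isLocallyClosed]
    intro k hkU hk
    have : IsFiniteMeasure (volume.restrict k) := ⟨by simpa using hk.measure_lt_top⟩
    have h3 := hf.mono_measure (Measure.restrict_mono_set volume hkU)
    exact (h3.mono_exponent (by norm_num)).integrable le_rfl
  refine ⟨h1, fun i j => h2 i j, fun i j => ?_⟩
  exact h.hasWeakPartial_comp hU (G := fun k x => G x i k) (fun k => hu.2.2 i k)
    (hloc (h1 i)) j (hloc (h2 i j))

end IsC1Diffeo

/-- The map is `C¹` on the whole space as a test limit plus the identity. Its derivative is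
invertible inside `Ω` because the inverse is `C¹` there, and outside `Ω` because it is the identity;
the inverse function theorem then makes the global inverse `C¹`, also across `∂Ω`. -/
theorem isC1Diffeo_of_mem_sobolevDiffeos {s : ℕ} {Ω : Set (E n)} (hΩ : IsOpen Ω)
    (hΩb : Bornology.IsBounded Ω) (hs : n + 1 ≤ s) {φ : Equiv.Perm (E n)}
    (hφ : φ ∈ sobolevDiffeos s Ω) : IsC1Diffeo Ω φ := by
  have hlim := isTestLimit_of_mem_sobolevDiffeos hΩ hΩb hφ
  obtain ⟨hid, hc, hcs, -⟩ := hφ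
  have hC : ContDiff ℝ 1 φ := by
    have := (hlim.contDiff hΩ hΩb hs).add (contDiff_id (𝕜 := ℝ) (n := 1))
    convert this using 1
    ext1 x
    simp
  have hd : ∀ x, HasFDerivAt φ (fderiv ℝ φ x) x := fun x =>
    (hC.differentiable (by simp) x).hasFDerivAt
  have hout : ∀ x ∉ Ω, fderiv ℝ φ x = ContinuousLinearMap.id ℝ (E n) := fun x hx => by
    have h1 := hlim.fderiv_eq_zero hΩ hΩb hs hx
    have h2 : fderiv ℝ (fun x => φ x - x) x = _ := ((hd x).sub (hasFDerivAt_id x)).fderiv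
    rw [h2] at h1
    exact sub_eq_zero.1 h1
  have hmaps : ∀ x ∈ Ω, φ x ∈ Ω := fun x hx => by
    by_contra hn
    have := hid _ hn
    rw [φ.injective this] at hn
    exact hn hx
  have hinv : ∀ x, ∃ A : E n ≃L[ℝ] E n, (A : E n →L[ℝ] E n) = fderiv ℝ φ x := by
    intro x
    by_cases hx : x ∈ Ω
    · have hds : HasFDerivAt φ.symm (fderiv ℝ φ.symm (φ x)) (φ x) :=
        ((hcs.contDiffAt (hΩ.mem_nhds (hmaps x hx))).differentiableAt (by simp)).hasFDerivAt
      have h1 : (fderiv ℝ φ.symm (φ x)).comp (fderiv ℝ φ x) = ContinuousLinearMap.id ℝ (E n) := by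
        have h2 := hds.comp x (hd x)
        have h3 : (φ.symm ∘ φ : E n → E n) = id := by ext1 y; simp
        rw [h3] at h2
        exact h2.unique (hasFDerivAt_id x)
      have h4 : (fderiv ℝ φ x).comp (fderiv ℝ φ.symm (φ x)) = ContinuousLinearMap.id ℝ (E n) := by
        have h2 := HasFDerivAt.comp (φ x) (g := φ) (g' := fderiv ℝ φ x)
          (by rw [Equiv.symm_apply_apply]; exact hd x) hds
        have h3 : (φ ∘ φ.symm : E n → E n) = id := by ext1 y; simp
        rw [h3] at h2
        exact h2.unique (hasFDerivAt_id _)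
      exact ⟨ContinuousLinearEquiv.equivOfInverse (fderiv ℝ φ x) (fderiv ℝ φ.symm (φ x))
        (fun v => DFunLike.congr_fun h1 v) (fun v => DFunLike.congr_fun h4 v), rfl⟩
    · exact ⟨ContinuousLinearEquiv.refl ℝ (E n), (hout x hx).symm⟩
  choose A hA using hinv
  have hopen : IsOpenMap φ := isOpenMap_of_hasStrictFDerivAt_equiv (f' := A) fun x => by
    rw [hA]
    exact hC.contDiffAt.hasStrictFDerivAt (by simp)
  let e : E n ≃ₜ E n := φ.toHomeomorphOfContinuousOpen hC.continuous hopen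
  refine ⟨hC, ?_, hid, hout⟩
  exact e.contDiff_symm (f₀' := A) (fun x => by rw [hA]; exact hd x) hC

/-! ### Traces -/

theorem HasTrace.add {Ω : Set (E n)} {u v g h : E n → E n} (hu : HasTrace Ω u g)
    (hv : HasTrace Ω v h) (hm : AEStronglyMeasurable u (volume.restrict Ω)) :
    HasTrace Ω (fun x => u x + v x) (fun x => g x + h x) := by
  filter_upwards [hu, hv] with x hx hx'
  refine tendsto_of_tendsto_of_tendsto_of_le_of_le tendsto_const_nhds
    (by simpa using hx.add hx') (fun _ => zero_le) fun r => ?_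
  simp only [← mul_add]
  gcongr
  rw [← lintegral_add_left']
  · refine lintegral_mono fun y => ?_
    have : u y + v y - (g x + h x) = (u y - g x) + (v y - h x) := by abel
    rw [this]
    exact enorm_add_le _ _
  · exact ((hm.mono_measure (Measure.restrict_mono_set _ inter_subset_left)).sub
      aestronglyMeasurable_const).enorm

theorem HasTrace.const_smul {Ω : Set (E n)} {u g : E n → E n} (hu : HasTrace Ω u g) (c : ℝ) :
    HasTrace Ω (fun x => c • u x) (fun x => c • g x) := by
  filter_upwards [hu] with x hx
  have := ENNReal.Tendsto.const_mul (a := ‖c‖ₑ) hx (Or.inr (by simp))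
  rw [mul_zero] at this
  refine this.congr fun r => ?_
  simp only [← smul_sub, enorm_smul]
  rw [lintegral_const_mul' _ _ (by simp)]
  ring

theorem aestronglyMeasurable_of_memLp {μ : Measure (E n)} {u : E n → E n}
    (hu : ∀ i, AEStronglyMeasurable (fun x => u x i) μ) : AEStronglyMeasurable u μ := by
  have h1 : AEStronglyMeasurable (fun x => (fun i => u x i : Fin n → ℝ)) μ :=
    (aemeasurable_pi_lambda _ fun i => (hu i).aemeasurable).aestronglyMeasurable
  exact (PiLp.continuous_toLp 2 _).comp_aestronglyMeasurable h1

theorem MemW12.aestronglyMeasurable {Ω K : Set (E n)} (hK : volume K = 0) {u : E n → E n}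
    {G : E n → Mat n} (hu : MemW12 (Ω \ K) u G) :
    AEStronglyMeasurable u (volume.restrict Ω) := by
  have h1 : volume.restrict (Ω \ K) = volume.restrict Ω :=
    Measure.restrict_congr_set (sdiff_null_ae_eq_self hK)
  rw [← h1]
  exact aestronglyMeasurable_of_memLp fun i => (hu.1 i).1

/-- Finite measure in dimension `n - 1` forces zero measure in dimension `n`, and `n`-dimensional
Hausdorff measure is a Haar measure. -/
theorem IsCrackSet.volume_eq_zero {Ω K : Set (E n)} (hK : IsCrackSet Ω K) : volume K = 0 := by
  have h1 : Measure.hausdorffMeasure (n : ℝ) K = 0 :=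
    (Measure.hausdorffMeasure_zero_or_top (show (n : ℝ) - 1 < n by linarith) K).resolve_right
      hK.finite_area.ne
  have : (Measure.hausdorffMeasure (n : ℝ) : Measure (E n)).IsAddHaarMeasure := by
    simpa using MeasureTheory.isAddHaarMeasure_hausdorffMeasure (E := EuclideanSpace ℝ (Fin n))
  exact Measure.absolutelyContinuous_isAddHaarMeasure volume
    (Measure.hausdorffMeasure (n : ℝ)) h1

/-! ### The velocity of a crack propagation curve -/

theorem neBot_nhdsWithin_Icc_diff {T t : ℝ} (hT : 0 < T) (ht : t ∈ Icc 0 T) :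
    (𝓝[Icc 0 T \ {t}] t).NeBot := by
  rcases ht.2.lt_or_eq with h | h
  · refine (nhdsGT_neBot t).mono ?_
    rw [← nhdsWithin_Ioc_eq_nhdsGT h]
    exact nhdsWithin_mono _ fun x hx => ⟨⟨ht.1.trans hx.1.le, hx.2⟩, hx.1.ne'⟩
  · subst h
    refine (nhdsLT_neBot t).mono ?_
    rw [← nhdsWithin_Ico_eq_nhdsLT hT]
    exact nhdsWithin_mono _ fun x hx => ⟨⟨hx.1, hx.2.le⟩, hx.2.ne⟩

namespace IsCrackCurve

variable {Ω K : Set (E n)} {s : ℕ} {T : ℝ} {φ : ℝ → Equiv.Perm (E n)}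

theorem isC1Diffeo (h : IsCrackCurve Ω K s T φ) (hΩ : IsOpen Ω) (hΩb : Bornology.IsBounded Ω)
    (hs : n + 1 ≤ s) {t : ℝ} (ht : t ∈ Icc 0 T) : IsC1Diffeo Ω (φ t) :=
  isC1Diffeo_of_mem_sobolevDiffeos hΩ hΩb hs (h.mem t ht)

theorem isTestLimit_slope (h : IsCrackCurve Ω K s T φ) (hΩ : IsOpen Ω)
    (hΩb : Bornology.IsBounded Ω) {t τ : ℝ} (ht : t ∈ Icc 0 T) (hτ : τ ∈ Icc 0 T) (hne : τ ≠ t) :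
    IsTestLimit s Ω (fun x => (τ - t)⁻¹ • (φ τ x - φ t x)) := by
  have := ((isTestLimit_of_mem_sobolevDiffeos hΩ hΩb (h.mem τ hτ)).sub
    (isTestLimit_of_mem_sobolevDiffeos hΩ hΩb (h.mem t ht))).const_smul
    (inv_ne_zero (sub_ne_zero.2 hne))
  simpa only [sub_sub_sub_cancel_right] using this

/-- The Sobolev velocity `v t` is determined only up to null sets, so it cannot serve as a pointwise
derivative. The slopes themselves are test limits, and closeness to `v t` in `W^{s,2}` makes them
uniformly Cauchy together with their derivatives; `w` is their pointwise limit. -/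
theorem exists_hasFDerivAt_slope_limit (h : IsCrackCurve Ω K s T φ) (hΩ : IsOpen Ω)
    (hΩb : Bornology.IsBounded Ω) (hs : n + 1 ≤ s) {t : ℝ} (ht : t ∈ Icc 0 T) :
    ∃ (w : E n → E n) (w' : E n → E n →L[ℝ] E n), (∀ x, HasFDerivAt w (w' x) x) ∧
      (∀ x, Tendsto (fun τ => (τ - t)⁻¹ • (φ τ x - φ t x)) (𝓝[Icc 0 T \ {t}] t) (𝓝 (w x))) ∧
      TendstoUniformly (fun τ x => (τ - t)⁻¹ • (fderiv ℝ (φ τ) x - fderiv ℝ (φ t) x)) w'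
        (𝓝[Icc 0 T \ {t}] t) := by
  obtain ⟨v, hv⟩ := h.c1
  have hne := neBot_nhdsWithin_Icc_diff h.pos ht
  set l := 𝓝[Icc 0 T \ {t}] t with hl
  let q : ℝ → E n → E n := fun τ x => (τ - t)⁻¹ • (φ τ x - φ t x)
  let q' : ℝ → E n → E n →L[ℝ] E n := fun τ x => (τ - t)⁻¹ • (fderiv ℝ (φ τ) x - fderiv ℝ (φ t) x)
  have hmem : ∀ᶠ τ in l, τ ∈ Icc 0 T \ {t} := self_mem_nhdsWithin
  have hq' : ∀ τ ∈ Icc 0 T \ {t}, ∀ x, HasFDerivAt (q τ) (q' τ x) x := fun τ hτ x =>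
    (((h.isC1Diffeo hΩ hΩb hs hτ.1).hasFDerivAt x).sub
      ((h.isC1Diffeo hΩ hΩb hs ht).hasFDerivAt x)).const_smul (τ - t)⁻¹
  have hN : Tendsto (fun τ => sobolevNorm s Ω (fun x => q τ x - v t x)) l (𝓝 0) := by
    refine tendsto_of_tendsto_of_tendsto_of_le_of_le tendsto_const_nhds (hv.deriv t ht)
      (fun _ => zero_le) fun τ => ?_
    simp only [sub_sub_sub_cancel_right]
    exact le_max_right _ _
  have hcauchy : ∀ ε > 0, ∀ᶠ p in l ×ˢ l, ∀ x, ‖q (p : ℝ × ℝ).1 x - q p.2 x‖ < ε ∧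
      ‖q' p.1 x - q' p.2 x‖ < ε := by
    intro ε hε
    have h1 : Tendsto (fun p : ℝ × ℝ => embeddingConst Ω *
        (sobolevNorm s Ω (fun x => q p.1 x - v t x) + sobolevNorm s Ω (fun x => q p.2 x - v t x)))
        (l ×ˢ l) (𝓝 0) := by
      have := ENNReal.Tendsto.const_mul (a := embeddingConst Ω)
        ((hN.comp tendsto_fst).add (hN.comp tendsto_snd))
        (Or.inr (embeddingConst_ne_top hΩb))
      simpa using this
    filter_upwards [h1.eventually_lt_const (ENNReal.ofReal_pos.2 hε), hmem.prod_inl l,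
      hmem.prod_inr l] with p hp hp1 hp2 x
    have h2 := ((h.isTestLimit_slope hΩ hΩb ht hp1.1 hp1.2).sub
      (h.isTestLimit_slope hΩ hΩb ht hp2.1 hp2.2)).enorm_le hΩ hΩb hs x
    have h3 : sobolevNorm s Ω (fun x => q p.1 x - q p.2 x) ≤
        sobolevNorm s Ω (fun x => q p.1 x - v t x) + sobolevNorm s Ω (fun x => q p.2 x - v t x) := by
      refine le_trans (le_of_eq ?_) (sobolevNorm_sub_le s Ω _ _)
      congr 1
      ext1 x
      abel
    have h4 : embeddingConst Ω * sobolevNorm s Ω (fun x => q p.1 x - q p.2 x) <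
        ENNReal.ofReal ε := lt_of_le_of_lt (by gcongr) hp
    have h5 : fderiv ℝ (fun x => q p.1 x - q p.2 x) x = q' p.1 x - q' p.2 x :=
      ((hq' _ hp1 x).sub (hq' _ hp2 x)).fderiv
    refine ⟨norm_lt_of_enorm_lt_ofReal (h2.1.trans_lt h4), norm_lt_of_enorm_lt_ofReal ?_⟩
    rw [← h5]
    exact h2.2.trans_lt h4
  have hlim : ∀ x, ∃ y, Tendsto (fun τ => q τ x) l (𝓝 y) := fun x => by
    refine cauchy_map_iff_exists_tendsto.1 (cauchy_map_iff.2 ⟨hne, ?_⟩)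
    rw [Metric.uniformity_basis_dist.tendsto_right_iff]
    intro ε hε
    filter_upwards [hcauchy ε hε] with p hp
    rw [dist_eq_norm]
    exact (hp x).1
  choose w hw using hlim
  obtain ⟨w', hw', hu⟩ := exists_hasFDerivAt_of_uniformCauchy (hmem.mono hq') hw
    fun ε hε => (hcauchy ε hε).mono fun p hp x => (hp x).2
  exact ⟨w, w', hw', hw, hu⟩

theorem fderiv_relative {φ₁ φ₂ : Equiv.Perm (E n)} (h₁ : IsC1Diffeo Ω φ₁) (h₂ : IsC1Diffeo Ω φ₂)
    (y : E n) : fderiv ℝ (φ₁ * φ₂⁻¹ : Equiv.Perm (E n)) y =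
      (fderiv ℝ φ₁ (φ₂.symm y)).comp (fderiv ℝ φ₂.symm y) :=
  ((h₁.hasFDerivAt (φ₂.symm y)).comp y (h₂.symm.hasFDerivAt y)).fderiv

/-- The relative deformations `φ_τ ∘ φ_t⁻¹` are differentiable at `τ = t`, in the `C¹` norm. -/
theorem tendstoUniformly_fderiv (h : IsCrackCurve Ω K s T φ) (hΩ : IsOpen Ω)
    (hΩb : Bornology.IsBounded Ω) (hs : n + 1 ≤ s) {t : ℝ} (ht : t ∈ Icc 0 T) :
    TendstoUniformly (fun τ y => (τ - t)⁻¹ •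
      (fderiv ℝ (φ τ * (φ t)⁻¹ : Equiv.Perm (E n)) y - ContinuousLinearMap.id ℝ (E n)))
      (fderiv ℝ (velocity T φ t)) (𝓝[Icc 0 T \ {t}] t) ∧
    ∃ c, ∀ y, ‖fderiv ℝ (velocity T φ t) y‖ ≤ c := by
  obtain ⟨w, w', hw', hw, hu⟩ := h.exists_hasFDerivAt_slope_limit hΩ hΩb hs ht
  have hne := neBot_nhdsWithin_Icc_diff h.pos ht
  have hd := h.isC1Diffeo hΩ hΩb hs ht
  -- The limit of the slopes is the velocity in the reference configuration; `η_t` is its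
  -- composition with `φ_t⁻¹`.
  have hvel : velocity T φ t = fun y => w ((φ t).symm y) := by
    ext1 y
    refine HasDerivWithinAt.derivWithin ?_ (uniqueDiffOn_Icc h.pos t ht)
    rw [hasDerivWithinAt_iff_tendsto_slope]
    exact hw ((φ t).symm y)
  have hDvel : ∀ y, fderiv ℝ (velocity T φ t) y =
      (w' ((φ t).symm y)).comp (fderiv ℝ (φ t).symm y) := fun y => by
    rw [hvel]
    exact ((hw' ((φ t).symm y)).comp y (hd.symm.hasFDerivAt y)).fderiv
  obtain ⟨L, hL0, hL⟩ := hd.symm.exists_norm_le hΩb continuous_id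
  simp only [id] at hL
  rw [Metric.tendstoUniformly_iff] at hu
  have hmem : ∀ᶠ τ in 𝓝[Icc 0 T \ {t}] t, τ ∈ Icc 0 T \ {t} := self_mem_nhdsWithin
  constructor
  · rw [Metric.tendstoUniformly_iff]
    intro ε hε
    filter_upwards [hu (ε / (L + 1)) (by positivity), hmem] with τ hτ hτm y
    rw [dist_eq_norm, hDvel, fderiv_relative (h.isC1Diffeo hΩ hΩb hs hτm.1) hd]
    have hid : ContinuousLinearMap.id ℝ (E n) =
        (fderiv ℝ (φ t) ((φ t).symm y)).comp (fderiv ℝ (φ t).symm y) := by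
      have := hd.symm.fderiv_symm_comp y
      rw [Equiv.symm_symm] at this
      exact this.symm
    have heq : (w' ((φ t).symm y)).comp (fderiv ℝ (φ t).symm y) - (τ - t)⁻¹ •
        ((fderiv ℝ (φ τ) ((φ t).symm y)).comp (fderiv ℝ (φ t).symm y) -
          ContinuousLinearMap.id ℝ (E n)) =
        (w' ((φ t).symm y) - (τ - t)⁻¹ • (fderiv ℝ (φ τ) ((φ t).symm y) -
          fderiv ℝ (φ t) ((φ t).symm y))).comp (fderiv ℝ (φ t).symm y) := by
      rw [hid]
      ext1 v
      simp
    rw [heq]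
    have h1 := hτ ((φ t).symm y)
    rw [dist_eq_norm] at h1
    calc _ ≤ _ * ‖fderiv ℝ (φ t).symm y‖ := ContinuousLinearMap.opNorm_comp_le _ _
      _ ≤ ε / (L + 1) * L := by gcongr; exact hL y
      _ < ε := by
        rw [div_mul_eq_mul_div, div_lt_iff₀ (by positivity)]
        nlinarith
  -- A single slope within distance `1` of the limit suffices, because each `φ_τ` has a bounded
  -- derivative.
  · obtain ⟨τ, hτ, hτm⟩ := ((hu 1 one_pos).and hmem).exists
    obtain ⟨M, hM0, hM⟩ := (h.isC1Diffeo hΩ hΩb hs hτm.1).exists_norm_le hΩb continuous_id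
    obtain ⟨M', hM0', hM'⟩ := hd.exists_norm_le hΩb continuous_id
    simp only [id] at hM hM'
    refine ⟨(1 + |(τ - t)⁻¹| * (M + M')) * L, fun y => ?_⟩
    rw [hDvel]
    refine (ContinuousLinearMap.opNorm_comp_le _ _).trans ?_
    gcongr
    · set x := (φ t).symm y
      have h1 := hτ x
      rw [dist_eq_norm] at h1
      calc ‖w' x‖ = ‖(w' x - (τ - t)⁻¹ • (fderiv ℝ (φ τ) x - fderiv ℝ (φ t) x)) +
            (τ - t)⁻¹ • (fderiv ℝ (φ τ) x - fderiv ℝ (φ t) x)‖ := by rw [sub_add_cancel]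
        _ ≤ 1 + |(τ - t)⁻¹| * (M + M') := by
          refine (norm_add_le _ _).trans (add_le_add h1.le ?_)
          rw [norm_smul, Real.norm_eq_abs]
          gcongr
          exact (norm_sub_le _ _).trans (add_le_add (hM x) (hM' x))
    · exact hL y

end IsCrackCurve

/-! ### Pulled-back elasticity tensors -/

theorem stress_add (D : Tensor4 n) (X Y : Mat n) : stress D (X + Y) = stress D X + stress D Y := by
  ext i j
  simp [stress, mul_add, Finset.sum_add_distrib]

theorem stress_smul (D : Tensor4 n) (c : ℝ) (X : Mat n) : stress D (c • X) = c • stress D X := by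
  ext i j
  simp only [stress, Matrix.smul_apply, smul_eq_mul, Finset.mul_sum]
  exact Finset.sum_congr rfl fun _ _ => Finset.sum_congr rfl fun _ _ => by ring

theorem contract_add_left (X Y Z : Mat n) : contract (X + Y) Z = contract X Z + contract Y Z := by
  simp [contract, add_mul, Finset.sum_add_distrib]

theorem contract_add_right (X Y Z : Mat n) : contract X (Y + Z) = contract X Y + contract X Z := by
  simp [contract, mul_add, Finset.sum_add_distrib]

theorem contract_smul_left (c : ℝ) (X Y : Mat n) : contract (c • X) Y = c * contract X Y := by
  simp [contract, Finset.mul_sum, mul_assoc]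

theorem contract_smul_right (c : ℝ) (X Y : Mat n) : contract X (c • Y) = c * contract X Y := by
  simp only [contract, Matrix.smul_apply, smul_eq_mul, Finset.mul_sum]
  exact Finset.sum_congr rfl fun _ _ => Finset.sum_congr rfl fun _ _ => by ring

theorem stress_tensor_smul_sub (c : ℝ) (D D' : Tensor4 n) (X : Mat n) :
    stress (fun i j k l => c * (D i j k l - D' i j k l)) X = c • (stress D X - stress D' X) := by
  ext i j
  simp only [stress, Matrix.smul_apply, Matrix.sub_apply, smul_eq_mul, ← Finset.sum_sub_distrib,
    Finset.mul_sum]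
  exact Finset.sum_congr rfl fun _ _ => Finset.sum_congr rfl fun _ _ => by ring

theorem contract_stress_comm {C : Tensor4 n} (hC : IsElasticityTensor C) (X Y : Mat n) :
    contract (stress C X) Y = contract (stress C Y) X := by
  simp only [contract, stress, Finset.sum_mul]
  have : ∀ F : Fin n → Fin n → Fin n → Fin n → ℝ,
      ∑ i, ∑ j, ∑ k, ∑ l, F i j k l = ∑ k, ∑ l, ∑ i, ∑ j, F i j k l := fun F => by
    rw [Finset.sum_congr rfl fun i _ => Finset.sum_comm, Finset.sum_comm]
    refine Finset.sum_congr rfl fun k _ => ?_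
    rw [Finset.sum_congr rfl fun i _ => Finset.sum_comm, Finset.sum_comm]
  rw [this]
  refine Finset.sum_congr rfl fun k _ => Finset.sum_congr rfl fun l _ => Finset.sum_congr rfl
    fun i _ => Finset.sum_congr rfl fun j _ => ?_
  rw [hC.major_symm]
  ring

theorem contract_stress_self_nonneg {C : Tensor4 n} (hC : IsElasticityTensor C) (X : Mat n) :
    0 ≤ contract (stress C X) X := by
  obtain ⟨c, c', hc, -, h⟩ := hC.growth
  have h1 := (h X).1
  have h2 : 0 ≤ c * ∑ i, ∑ j, ((X i j + X j i) / 2) ^ 2 := by positivity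
  unfold energyDensity at h1
  linarith

/-- A null direction of the energy carries no stress. -/
theorem contract_stress_eq_zero {C : Tensor4 n} (hC : IsElasticityTensor C) {X : Mat n}
    (hX : contract (stress C X) X = 0) (Y : Mat n) : contract (stress C X) Y = 0 := by
  have key : ∀ r : ℝ, 0 ≤ 2 * r * contract (stress C X) Y + r ^ 2 * contract (stress C Y) Y := by
    intro r
    have h := contract_stress_self_nonneg hC (X + r • Y)
    rw [stress_add, stress_smul, contract_add_left, contract_add_right, contract_add_right,
      contract_smul_left, contract_smul_right, contract_smul_left, contract_smul_right, hX,
      contract_stress_comm hC Y X] at h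
    linarith
  set a := contract (stress C X) Y
  set b := contract (stress C Y) Y
  have hb : 0 ≤ b := contract_stress_self_nonneg hC Y
  by_contra ha
  -- The quadratic `2ra + r²b` is negative at this `r` unless `a = 0`; using `b + 1` in place of `b`
  -- covers `b = 0`.
  have h1 := key (-a / (b + 1))
  have h2 : 2 * (-a / (b + 1)) * a + (-a / (b + 1)) ^ 2 * b = -(a ^ 2 * (b + 2)) / (b + 1) ^ 2 := by
    field_simp
    ring
  rw [h2] at h1
  have h3 : 0 < a ^ 2 * (b + 2) := by positivity
  have h4 : 0 < (b + 1) ^ 2 := by positivity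
  have := div_neg_of_neg_of_pos (neg_lt_zero.2 h3) h4
  linarith

/-- The tensor `|det A| ∑ C_{iakb} (A⁻¹)_{ja} (A⁻¹)_{lb}` of the pulled-back energy. -/
def pullbackTensor (C : Tensor4 n) (A : E n →L[ℝ] E n) : Tensor4 n := fun i j k l =>
  |A.det| * ∑ a, ∑ b, C i a k b * (Ring.inverse A (EuclideanSpace.single a 1) j *
    Ring.inverse A (EuclideanSpace.single b 1) l)

/-- The derivative of `pullbackTensor` at the identity, in the direction `H`. -/
def pullbackTensorDeriv (C : Tensor4 n) (H : Mat n) : Tensor4 n := fun i j k l =>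
  (∑ a, H a a) * C i j k l - (∑ a, C i a k l * H j a) - ∑ b, C i j k b * H l b

theorem sum_sum_mul_eq_contract_mul (S N Y : Mat n) :
    ∑ i, ∑ j, (∑ a, S i a * N j a) * Y i j = contract S (Y * N) := by
  simp only [contract, Matrix.mul_apply, Finset.sum_mul, Finset.mul_sum]
  refine Finset.sum_congr rfl fun i _ => ?_
  rw [Finset.sum_comm]
  exact Finset.sum_congr rfl fun _ _ => Finset.sum_congr rfl fun _ _ => by ring

theorem eshelbyTerm_eq (C : Tensor4 n) (G H : Mat n) :
    eshelbyTerm C G H = contract (stress C G) (G * H) := by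
  simp only [eshelbyTerm, contract, Matrix.mul_apply, Finset.mul_sum, mul_assoc]

theorem stress_mul (C : Tensor4 n) (X N : Mat n) (i j : Fin n) :
    stress C (X * N) i j = ∑ k, ∑ l, (∑ b, C i j k b * N l b) * X k l := by
  simp only [stress, Matrix.mul_apply, Finset.sum_mul, Finset.mul_sum]
  refine Finset.sum_congr rfl fun k _ => ?_
  rw [Finset.sum_comm]
  exact Finset.sum_congr rfl fun _ _ => Finset.sum_congr rfl fun _ _ => by ring

theorem sum_stress_mul (C : Tensor4 n) (X N : Mat n) (i j : Fin n) :
    ∑ a, stress C X i a * N j a = ∑ k, ∑ l, (∑ a, C i a k l * N j a) * X k l := by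
  simp only [stress, Finset.sum_mul]
  rw [Finset.sum_comm]
  refine Finset.sum_congr rfl fun k _ => ?_
  rw [Finset.sum_comm]
  exact Finset.sum_congr rfl fun _ _ => Finset.sum_congr rfl fun _ _ => by ring

/-- The determinant contributes the divergence, and each of the two inverse factors contributes
minus the Eshelby term; the two contributions agree by the major symmetry of `C`. This is where the
integrand of the proposition comes from. -/
theorem contract_stress_pullbackTensorDeriv {C : Tensor4 n} (hC : IsElasticityTensor C)
    (G H : Mat n) : contract (stress (pullbackTensorDeriv C H) G) G =
      contract (stress C G) G * (∑ a, H a a) - 2 * eshelbyTerm C G H := by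
  have h1 : stress (pullbackTensorDeriv C H) G = (∑ a, H a a) • stress C G +
      ((-1 : ℝ) • (Matrix.of fun i j => ∑ a, stress C G i a * H j a) +
        (-1 : ℝ) • stress C (G * H)) := by
    ext i j
    rw [Matrix.add_apply, Matrix.add_apply, Matrix.smul_apply, Matrix.smul_apply,
      Matrix.smul_apply, Matrix.of_apply, stress_mul, sum_stress_mul]
    simp only [stress, pullbackTensorDeriv, smul_eq_mul, neg_one_mul, sub_mul,
      Finset.sum_sub_distrib]
    rw [Finset.mul_sum]
    simp only [Finset.mul_sum _ _ (∑ a, H a a), mul_assoc]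
    ring
  rw [h1, contract_add_left, contract_add_left, contract_smul_left, contract_smul_left,
    contract_smul_left, contract_stress_comm hC (G * H) G, eshelbyTerm_eq]
  have h2 : contract (Matrix.of fun i j => ∑ a, stress C G i a * H j a) G = _ :=
    sum_sum_mul_eq_contract_mul (stress C G) H G
  rw [h2]
  ring

/-- With `N = A⁻¹`, this is the Jacobian times the energy form of the gradients pushed forward by
`A`, which is the integrand produced by a change of variables. -/
theorem contract_stress_pullbackTensor (C : Tensor4 n) (A : E n →L[ℝ] E n) (N X Y : Mat n)
    (hN : ∀ i j, Ring.inverse A (EuclideanSpace.single j 1) i = N i j) :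
    contract (stress (pullbackTensor C A) X) Y =
      |A.det| * contract (stress C (X * N)) (Y * N) := by
  have h1 : stress (pullbackTensor C A) X =
      |A.det| • (Matrix.of fun i j => ∑ a, stress C (X * N) i a * N j a) := by
    ext i j
    rw [Matrix.smul_apply, Matrix.of_apply, smul_eq_mul]
    simp only [stress_mul]
    simp only [stress, pullbackTensor, hN]
    simp only [Finset.mul_sum, Finset.sum_mul]
    rw [Finset.sum_congr rfl fun k _ => Finset.sum_comm, Finset.sum_comm]
    refine Finset.sum_congr rfl fun a _ => Finset.sum_congr rfl fun k _ =>
      Finset.sum_congr rfl fun l _ => Finset.sum_congr rfl fun b _ => by ring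
  rw [h1, contract_smul_left]
  congr 1
  exact sum_sum_mul_eq_contract_mul _ N Y

theorem det_eq_det_matrix (A : E n →L[ℝ] E n) :
    A.det = Matrix.det (Matrix.of fun i j => A (EuclideanSpace.single j 1) i) := by
  rw [ContinuousLinearMap.det,
    ← LinearMap.det_toMatrix (EuclideanSpace.basisFun (Fin n) ℝ).toBasis]
  congr 1

/-- The entry `A_{ij}` as a linear functional. -/
def entry (i j : Fin n) : (E n →L[ℝ] E n) →L[ℝ] ℝ :=
  (EuclideanSpace.proj i : E n →L[ℝ] ℝ).comp
    (ContinuousLinearMap.apply ℝ (E n) (EuclideanSpace.single j 1))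

theorem entry_apply (i j : Fin n) (A : E n →L[ℝ] E n) :
    entry i j A = A (EuclideanSpace.single j 1) i := rfl

theorem entry_one (i j : Fin n) : entry i j (1 : E n →L[ℝ] E n) = if i = j then 1 else 0 := by
  simp [entry_apply]

theorem hasFDerivAt_entry (i j : Fin n) (A : E n →L[ℝ] E n) :
    HasFDerivAt (fun A => entry i j A) (entry i j) A := (entry i j).hasFDerivAt

/-- Differentiating the explicit determinants of size two and three at the identity leaves the
products along the diagonal, hence the trace. -/
theorem hasFDerivAt_det_one (hn : n = 2 ∨ n = 3) :
    HasFDerivAt (fun A : E n →L[ℝ] E n => A.det) (∑ a, entry a a) 1 := by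
  have h0 : (fun A : E n →L[ℝ] E n => A.det) =
      fun A => Matrix.det (Matrix.of fun i j => entry i j A) := funext det_eq_det_matrix
  rw [h0]
  rcases hn with rfl | rfl
  · simp only [Matrix.det_fin_two, Matrix.of_apply]
    have h1 := (((hasFDerivAt_entry (n := 2) 0 0 1).mul (hasFDerivAt_entry 1 1 1))).sub
      ((hasFDerivAt_entry 0 1 1).mul (hasFDerivAt_entry 1 0 1))
    refine h1.congr_fderiv ?_
    ext A
    simp [entry_one, Fin.sum_univ_two]
    ring
  · simp only [Matrix.det_fin_three, Matrix.of_apply]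
    have e := fun i j => hasFDerivAt_entry (n := 3) i j 1
    have h1 := ((((((e 0 0).mul (e 1 1)).mul (e 2 2)).sub (((e 0 0).mul (e 1 2)).mul (e 2 1))).sub
      (((e 0 1).mul (e 1 0)).mul (e 2 2))).add (((e 0 1).mul (e 1 2)).mul (e 2 0))).add
      (((e 0 2).mul (e 1 0)).mul (e 2 1)) |>.sub (((e 0 2).mul (e 1 1)).mul (e 2 0))
    refine h1.congr_fderiv ?_
    ext A
    simp [entry_one, Fin.sum_univ_three]
    ring

/-- The product rule at the identity: the determinant varies by the trace, and inversion by `-A`. -/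
theorem hasFDerivAt_pullbackTensor (hn : n = 2 ∨ n = 3) (C : Tensor4 n) (i j k l : Fin n) :
    ∃ L : (E n →L[ℝ] E n) →L[ℝ] ℝ,
      HasFDerivAt (fun A => pullbackTensor C A i j k l) L (ContinuousLinearMap.id ℝ (E n)) ∧
      ∀ A, L A = pullbackTensorDeriv C (fun i j => A (EuclideanSpace.single j 1) i) i j k l := by
  have hinv : ∀ i j : Fin n, HasFDerivAt (fun A => entry i j (Ring.inverse A)) (-entry i j)
      (1 : E n →L[ℝ] E n) := fun i j => by
    have h1 := (entry i j).hasFDerivAt.comp (1 : E n →L[ℝ] E n)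
      (hasFDerivAt_ringInverse (𝕜 := ℝ) (1 : (E n →L[ℝ] E n)ˣ))
    refine h1.congr_fderiv ?_
    ext A
    simp
  have hdet : HasFDerivAt (fun A : E n →L[ℝ] E n => |A.det|) (∑ a, entry a a) 1 := by
    have h1 : (1 : E n →L[ℝ] E n).det = 1 := by simp [ContinuousLinearMap.det]
    have h2 := (hasDerivAt_abs_pos (x := (1 : E n →L[ℝ] E n).det) (by rw [h1]; exact one_pos))
    have h3 := h2.comp_hasFDerivAt (1 : E n →L[ℝ] E n) (hasFDerivAt_det_one hn)
    have h4 : HasFDerivAt (fun A : E n →L[ℝ] E n => |A.det|) _ 1 := h3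
    exact h4.congr_fderiv (by simp)
  have h1 : (1 : E n →L[ℝ] E n).det = 1 := by simp [ContinuousLinearMap.det]
  have key := hdet.mul (HasFDerivAt.fun_sum fun a (_ : a ∈ Finset.univ) =>
    HasFDerivAt.fun_sum fun b (_ : b ∈ Finset.univ) =>
      ((hinv j a).mul (hinv l b)).const_mul (C i a k b))
  refine ⟨_, key, fun A => ?_⟩
  simp only [_root_.add_apply, _root_.smul_apply,
    _root_.sum_apply, _root_.neg_apply, smul_eq_mul, Pi.mul_apply,
    Ring.inverse_one, entry_one, h1, abs_one, one_mul, mul_add, Finset.sum_add_distrib, ite_mul,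
    mul_ite, zero_mul, mul_zero, mul_one, Finset.sum_ite_eq, Finset.mem_univ, if_true,
    Finset.sum_ite_irrel, Finset.sum_const_zero, mul_neg, Finset.sum_neg_distrib,
    pullbackTensorDeriv]
  simp only [entry_apply]
  ring

/-! ### Convergence in `L²` and limits of integrals -/

/-- Convergence of scalar functions in `L²(μ)`. -/
structure L2Tendsto {ι : Type*} (l : Filter ι) (μ : Measure (E n)) (f : ι → E n → ℝ)
    (g : E n → ℝ) : Prop where
  mem : ∀ᶠ i in l, MemLp (f i) 2 μ
  memLp : MemLp g 2 μ
  lim : Tendsto (fun i => eLpNorm (fun x => f i x - g x) 2 μ) l (𝓝 0)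

namespace L2Tendsto

variable {ι : Type*} {l : Filter ι} {μ : Measure (E n)}

theorem const {g : E n → ℝ} (hg : MemLp g 2 μ) : L2Tendsto l μ (fun _ => g) g :=
  ⟨Eventually.of_forall fun _ => hg, hg, by simpa using tendsto_const_nhds⟩

theorem add {f f' : ι → E n → ℝ} {g g' : E n → ℝ} (h : L2Tendsto l μ f g)
    (h' : L2Tendsto l μ f' g') :
    L2Tendsto l μ (fun i x => f i x + f' i x) (fun x => g x + g' x) := by
  refine ⟨?_, h.memLp.add h'.memLp, ?_⟩
  · filter_upwards [h.mem, h'.mem] with i hi hi' using hi.add hi'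
  · refine tendsto_of_tendsto_of_tendsto_of_le_of_le' tendsto_const_nhds
      (by simpa using h.lim.add h'.lim) (Eventually.of_forall fun _ => zero_le) ?_
    filter_upwards [h.mem, h'.mem] with i hi hi'
    refine le_trans (le_of_eq ?_) (eLpNorm_add_le (hi.sub h.memLp).1 (hi'.sub h'.memLp).1
      (by norm_num))
    congr 1
    ext x
    simp only [Pi.add_apply]
    ring

theorem mono_set {S S' : Set (E n)} {f : ι → E n → ℝ} {g : E n → ℝ}
    (h : L2Tendsto l (volume.restrict S) f g) (hS : S' ⊆ S) :
    L2Tendsto l (volume.restrict S') f g :=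
  have hle := Measure.restrict_mono hS le_rfl
  ⟨h.mem.mono fun _ hi => hi.mono_measure hle, h.memLp.mono_measure hle,
    tendsto_of_tendsto_of_tendsto_of_le_of_le tendsto_const_nhds h.lim (fun _ => zero_le)
      fun _ => eLpNorm_mono_measure _ hle⟩

theorem sum {κ : Type*} (s : Finset κ) {f : κ → ι → E n → ℝ} {g : κ → E n → ℝ}
    (h : ∀ k ∈ s, L2Tendsto l μ (f k) (g k)) :
    L2Tendsto l μ (fun i x => ∑ k ∈ s, f k i x) (fun x => ∑ k ∈ s, g k x) := by
  classical
  induction s using Finset.induction_on with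
  | empty =>
    simp only [Finset.sum_empty]
    exact const MemLp.zero'
  | insert a s ha ih =>
    simp only [Finset.sum_insert ha]
    exact (h a (Finset.mem_insert_self a s)).add
      (ih fun k hk => h k (Finset.mem_insert_of_mem hk))

/-- Multiplication by uniformly convergent bounded functions. -/
theorem mul {f : ι → E n → ℝ} {g : E n → ℝ} (h : L2Tendsto l μ f g) {d : ι → E n → ℝ}
    {d₀ : E n → ℝ} (hd : TendstoUniformly d d₀ l) {M : ℝ} (hM : ∀ x, |d₀ x| ≤ M)
    (hm : ∀ᶠ i in l, AEStronglyMeasurable (d i) μ) (hm₀ : AEStronglyMeasurable d₀ μ) :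
    L2Tendsto l μ (fun i x => d i x * f i x) (fun x => d₀ x * g x) := by
  rw [Metric.tendstoUniformly_iff] at hd
  have hbd : ∀ᶠ i in l, ∀ x, |d i x| ≤ M + 1 := by
    filter_upwards [hd 1 one_pos] with i hi x
    have h1 := hi x
    rw [dist_comm, Real.dist_eq] at h1
    calc |d i x| = |(d i x - d₀ x) + d₀ x| := by rw [sub_add_cancel]
      _ ≤ _ := (abs_add_le _ _).trans (by linarith [hM x])
  have hmul : ∀ {d g : E n → ℝ} {c : ℝ}, MemLp g 2 μ → AEStronglyMeasurable d μ →
      (∀ x, |d x| ≤ c) → MemLp (fun x => d x * g x) 2 μ := fun hg hd hc => by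
    simpa only [mul_comm] using memLp_mul_of_bound hg hd hc
  have hnorm : ∀ {d g : E n → ℝ} {c : ℝ}, (∀ x, |d x| ≤ c) →
      eLpNorm (fun x => d x * g x) 2 μ ≤ ENNReal.ofReal c * eLpNorm g 2 μ := fun hc => by
    refine eLpNorm_le_mul_eLpNorm_of_ae_le_mul (Eventually.of_forall fun x => ?_) 2
    rw [norm_mul]
    gcongr
    exact hc x
  refine ⟨?_, hmul h.memLp hm₀ hM, ?_⟩
  · filter_upwards [h.mem, hbd, hm] with i h1 h2 h3 using hmul h1 h3 h2
  · rw [ENNReal.tendsto_nhds_zero]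
    intro ε hε
    -- The error is split as `d_i (f_i - g) + (d_i - d₀) g`. The first part is small by `L²`
    -- convergence and the bound `M + 1` on `d_i`, the second by uniform convergence within `δ`.
    obtain ⟨δ, hδ, hδε⟩ : ∃ δ : ℝ, 0 < δ ∧ ENNReal.ofReal δ * eLpNorm g 2 μ ≤ ε / 2 := by
      have h1 : Tendsto (fun δ : ℝ => ENNReal.ofReal δ * eLpNorm g 2 μ) (𝓝[>] 0) (𝓝 0) := by
        have := ENNReal.Tendsto.mul_const (b := eLpNorm g 2 μ)
          (ENNReal.tendsto_ofReal (tendsto_id (α := ℝ) (x := 𝓝 0))) (Or.inr h.memLp.2.ne)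
        simp only [id, ENNReal.ofReal_zero, zero_mul] at this
        exact this.mono_left nhdsWithin_le_nhds
      have h2 := h1.eventually_le_const (ENNReal.half_pos hε.ne')
      obtain ⟨δ, h3, h4⟩ := (h2.and self_mem_nhdsWithin).exists
      exact ⟨δ, h4, h3⟩
    have h3 : Tendsto (fun i => ENNReal.ofReal (M + 1) * eLpNorm (fun x => f i x - g x) 2 μ) l
        (𝓝 0) := by
      simpa using ENNReal.Tendsto.const_mul (a := ENNReal.ofReal (M + 1)) h.lim
        (Or.inr ENNReal.ofReal_ne_top)
    filter_upwards [h3.eventually_le_const (ENNReal.half_pos hε.ne'), hd δ hδ, h.mem, hbd, hm]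
      with i h4 h5 h6 h7 h8
    have h5' : ∀ x, |d i x - d₀ x| ≤ δ := fun x => by
      have := h5 x
      rw [dist_comm, Real.dist_eq] at this
      exact this.le
    have e1 := hmul (h6.sub h.memLp) h8 h7
    have e2 := hmul h.memLp (h8.sub hm₀) h5'
    calc eLpNorm (fun x => d i x * f i x - d₀ x * g x) 2 μ
        = eLpNorm ((fun x => d i x * (f i x - g x)) + fun x => (d i x - d₀ x) * g x) 2 μ := by
          congr 1
          ext x
          simp only [Pi.add_apply]
          ring
      _ ≤ _ := eLpNorm_add_le e1.1 e2.1 (by norm_num)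
      _ ≤ ε / 2 + ε / 2 := add_le_add ((hnorm h7).trans h4) ((hnorm h5').trans hδε)
      _ = ε := ENNReal.add_halves ε

theorem smul {f : ι → E n → ℝ} {g : E n → ℝ} (h : L2Tendsto l μ f g) {c : ι → ℝ} {c₀ : ℝ}
    (hc : Tendsto c l (𝓝 c₀)) : L2Tendsto l μ (fun i x => c i * f i x) (fun x => c₀ * g x) :=
  h.mul (d := fun i _ => c i) (M := |c₀|)
    (Metric.tendstoUniformly_iff.2 fun ε hε => by
      filter_upwards [Metric.tendsto_nhds.1 hc ε hε] with i hi _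
      rwa [dist_comm]) (fun _ => le_rfl)
    (Eventually.of_forall fun _ => aestronglyMeasurable_const) aestronglyMeasurable_const

theorem eLpNorm_one_mul_le {a b : E n → ℝ} (ha : AEStronglyMeasurable a μ)
    (hb : AEStronglyMeasurable b μ) :
    eLpNorm (fun x => a x * b x) 1 μ ≤ eLpNorm a 2 μ * eLpNorm b 2 μ := by
  have h := eLpNorm_smul_le_mul_eLpNorm (p := 2) (q := 2) (r := 1) hb ha
  exact h

theorem tendsto_integral_mul {f f' : ι → E n → ℝ} {g g' : E n → ℝ} (h : L2Tendsto l μ f g)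
    (h' : L2Tendsto l μ f' g') :
    (∀ᶠ i in l, Integrable (fun x => f i x * f' i x) μ) ∧
    Tendsto (fun i => ∫ x, f i x * f' i x ∂μ) l (𝓝 (∫ x, g x * g' x ∂μ)) := by
  have hInt : ∀ᶠ i in l, Integrable (fun x => f i x * f' i x) μ := by
    filter_upwards [h.mem, h'.mem] with i hi hi'
    exact hi.integrable_mul hi'
  refine ⟨hInt, tendsto_integral_of_L1' _ (h.memLp.1.mul h'.memLp.1) hInt ?_⟩
  have hlim : Tendsto (fun i => (eLpNorm (fun x => f i x - g x) 2 μ + eLpNorm g 2 μ) *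
      eLpNorm (fun x => f' i x - g' x) 2 μ + eLpNorm (fun x => f i x - g x) 2 μ *
      eLpNorm g' 2 μ) l (𝓝 0) := by
    have h0 : 0 + eLpNorm g 2 μ ≠ ⊤ := by rw [zero_add]; exact h.memLp.2.ne
    have h1 := ENNReal.Tendsto.mul (h.lim.add_const (eLpNorm g 2 μ))
      (Or.inr ENNReal.zero_ne_top) h'.lim (Or.inr h0)
    have h2 := ENNReal.Tendsto.mul_const (b := eLpNorm g' 2 μ) h.lim (Or.inr h'.memLp.2.ne)
    have h3 := h1.add h2
    rw [mul_zero, zero_mul, add_zero] at h3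
    exact h3
  refine tendsto_of_tendsto_of_tendsto_of_le_of_le' tendsto_const_nhds hlim
    (Eventually.of_forall fun _ => zero_le) ?_
  filter_upwards [h.mem, h'.mem] with i hi hi'
  have e1 : AEStronglyMeasurable (fun x => f i x - g x) μ := hi.1.sub h.memLp.1
  have e2 : AEStronglyMeasurable (fun x => f' i x - g' x) μ := hi'.1.sub h'.memLp.1
  have e3 : AEStronglyMeasurable (fun x => f i x * (f' i x - g' x)) μ := hi.1.mul e2
  have e4 : AEStronglyMeasurable (fun x => (f i x - g x) * g' x) μ := e1.mul h'.memLp.1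
  have e5 : eLpNorm (f i) 2 μ ≤ eLpNorm (fun x => f i x - g x) 2 μ + eLpNorm g 2 μ := by
    have h1 : f i = (fun x => f i x - g x) + g := by ext x; simp
    conv_lhs => rw [h1]
    exact eLpNorm_add_le e1 h.memLp.1 (by norm_num)
  -- The standard splitting of a difference of products; Hölder's inequality bounds each part in
  -- `L¹`.
  have e6 : ((fun x => f i x * f' i x) - fun x => g x * g' x) =
      (fun x => f i x * (f' i x - g' x)) + fun x => (f i x - g x) * g' x := by
    ext x
    simp only [Pi.add_apply, Pi.sub_apply]
    ring
  have e7 := eLpNorm_add_le e3 e4 le_rfl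
  rw [← e6] at e7
  refine e7.trans (add_le_add ((eLpNorm_one_mul_le hi.1 e2).trans ?_)
    (eLpNorm_one_mul_le e1 h'.memLp.1))
  gcongr

end L2Tendsto

/-! ### Limits of quadratic energies with variable tensors. -/

theorem tendsto_integral_contract_stress {ι : Type*} {l : Filter ι} {μ : Measure (E n)}
    {D : ι → E n → Tensor4 n} {D₀ : E n → Tensor4 n}
    (hD : ∀ i j k m, TendstoUniformly (fun a x => D a x i j k m) (fun x => D₀ x i j k m) l)
    {M : ℝ} (hM : ∀ x i j k m, |D₀ x i j k m| ≤ M)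
    (hm : ∀ᶠ a in l, ∀ i j k m, AEStronglyMeasurable (fun x => D a x i j k m) μ)
    (hm₀ : ∀ i j k m, AEStronglyMeasurable (fun x => D₀ x i j k m) μ)
    {X Y : ι → E n → Mat n} {X₀ Y₀ : E n → Mat n}
    (hX : ∀ i j, L2Tendsto l μ (fun a x => X a x i j) (fun x => X₀ x i j))
    (hY : ∀ i j, L2Tendsto l μ (fun a x => Y a x i j) (fun x => Y₀ x i j)) :
    (∀ᶠ a in l, Integrable (fun x => contract (stress (D a x) (X a x)) (Y a x)) μ) ∧
    Tendsto (fun a => ∫ x, contract (stress (D a x) (X a x)) (Y a x) ∂μ) l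
      (𝓝 (∫ x, contract (stress (D₀ x) (X₀ x)) (Y₀ x) ∂μ)) := by
  have hS : ∀ i j, L2Tendsto l μ (fun a x => stress (D a x) (X a x) i j)
      (fun x => stress (D₀ x) (X₀ x) i j) := fun i j =>
    L2Tendsto.sum _ fun k _ => L2Tendsto.sum _ fun m _ =>
      (hX k m).mul (hD i j k m) (fun x => hM x i j k m) (hm.mono fun a ha => ha i j k m)
        (hm₀ i j k m)
  have hInt : ∀ᶠ a in l, ∀ i j, Integrable (fun x => stress (D a x) (X a x) i j * Y a x i j) μ := by
    rw [eventually_all]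
    intro i
    rw [eventually_all]
    intro j
    exact ((hS i j).tendsto_integral_mul (hY i j)).1
  have hInt₀ : ∀ i j, Integrable (fun x => stress (D₀ x) (X₀ x) i j * Y₀ x i j) μ := fun i j =>
    (hS i j).memLp.integrable_mul (hY i j).memLp
  refine ⟨hInt.mono fun a ha => integrable_finsetSum _ fun i _ => integrable_finsetSum _
    fun j _ => ha i j, ?_⟩
  have heq : ∀ {S Z : E n → Mat n}, (∀ i j, Integrable (fun x => S x i j * Z x i j) μ) →
      ∫ x, contract (S x) (Z x) ∂μ = ∑ i, ∑ j, ∫ x, S x i j * Z x i j ∂μ := fun {S Z} h => by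
    simp only [contract]
    rw [integral_finsetSum _ fun i _ => integrable_finsetSum _ fun j _ => h i j]
    exact Finset.sum_congr rfl fun i _ => integral_finsetSum _ fun j _ => h i j
  rw [heq hInt₀]
  refine Tendsto.congr' (hInt.mono fun a ha => (heq ha).symm) ?_
  exact tendsto_finsetSum _ fun i _ => tendsto_finsetSum _ fun j _ =>
    ((hS i j).tendsto_integral_mul (hY i j)).2

theorem integrable_contract_stress {μ : Measure (E n)} {D : E n → Tensor4 n} {M : ℝ}
    (hM : ∀ x i j k m, |D x i j k m| ≤ M)
    (hm : ∀ i j k m, AEStronglyMeasurable (fun x => D x i j k m) μ) {X Y : E n → Mat n}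
    (hX : ∀ i j, MemLp (fun x => X x i j) 2 μ) (hY : ∀ i j, MemLp (fun x => Y x i j) 2 μ) :
    Integrable (fun x => contract (stress (D x) (X x)) (Y x)) μ := by
  -- Integrability is the case of a constant family, indexed by a one-point type.
  have := (tendsto_integral_contract_stress (l := (⊤ : Filter Unit)) (D := fun _ => D) (D₀ := D)
    (fun i j k m => Metric.tendstoUniformly_iff.2 fun ε hε => by simp [hε]) hM
    (Eventually.of_forall fun _ => hm) hm (fun i j => L2Tendsto.const (hX i j))
    (fun i j => L2Tendsto.const (hY i j))).1
  exact this.exists.choose_spec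

theorem exists_tensor_bound (C : Tensor4 n) : ∃ M : ℝ, ∀ i j k m, |C i j k m| ≤ M :=
  ⟨∑ i, ∑ j, ∑ k, ∑ m, |C i j k m|, fun i j k m => by
    calc |C i j k m| ≤ ∑ m, |C i j k m| :=
          Finset.single_le_sum (f := fun m => |C i j k m|) (fun _ _ => abs_nonneg _)
            (Finset.mem_univ m)
      _ ≤ ∑ k, ∑ m, |C i j k m| :=
          Finset.single_le_sum (f := fun k => ∑ m, |C i j k m|) (fun _ _ => by positivity)
            (Finset.mem_univ k)
      _ ≤ ∑ j, ∑ k, ∑ m, |C i j k m| :=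
          Finset.single_le_sum (f := fun j => ∑ k, ∑ m, |C i j k m|) (fun _ _ => by positivity)
            (Finset.mem_univ j)
      _ ≤ _ :=
          Finset.single_le_sum (f := fun i => ∑ j, ∑ k, ∑ m, |C i j k m|)
            (fun _ _ => by positivity) (Finset.mem_univ i)⟩

theorem integrable_contract_stress_const {μ : Measure (E n)} (C : Tensor4 n) {X Y : E n → Mat n}
    (hX : ∀ i j, MemLp (fun x => X x i j) 2 μ) (hY : ∀ i j, MemLp (fun x => Y x i j) 2 μ) :
    Integrable (fun x => contract (stress C (X x)) (Y x)) μ := by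
  obtain ⟨M, hM⟩ := exists_tensor_bound C
  exact integrable_contract_stress (D := fun _ => C) (fun _ => hM)
    (fun _ _ _ _ => aestronglyMeasurable_const) hX hY

/-- The slope of the energy of `X + (τ - t) V` with respect to a variable tensor. -/
theorem tendsto_slope_integral_contract_stress {l : Filter ℝ} {t : ℝ} (hl : l ≤ 𝓝[≠] t)
    {μ : Measure (E n)} {C : Tensor4 n} {P : ℝ → E n → Tensor4 n} {D₀ : E n → Tensor4 n}
    (hD : ∀ i j k m, TendstoUniformly (fun τ x => (τ - t)⁻¹ * (P τ x i j k m - C i j k m))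
      (fun x => D₀ x i j k m) l)
    {M : ℝ} (hM : ∀ x i j k m, |D₀ x i j k m| ≤ M)
    (hm : ∀ᶠ τ in l, ∀ i j k m, AEStronglyMeasurable (fun x => P τ x i j k m) μ)
    (hm₀ : ∀ i j k m, AEStronglyMeasurable (fun x => D₀ x i j k m) μ)
    {X V A : ℝ → E n → Mat n} {G V₀ : E n → Mat n}
    (hX : ∀ i j, L2Tendsto l μ (fun τ x => X τ x i j) (fun x => G x i j))
    (hV : ∀ i j, L2Tendsto l μ (fun τ x => V τ x i j) (fun x => V₀ x i j))
    (hA : ∀ τ x, A τ x = X τ x + (τ - t) • V τ x) :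
    Tendsto (fun τ => (τ - t)⁻¹ * (∫ x, contract (stress (P τ x) (A τ x)) (A τ x) ∂μ -
      ∫ x, contract (stress C (X τ x)) (X τ x) ∂μ)) l
      (𝓝 (∫ x, contract (stress (D₀ x) (G x)) (G x) ∂μ +
        (∫ x, contract (stress C (V₀ x)) (G x) ∂μ + ∫ x, contract (stress C (G x)) (V₀ x) ∂μ))) := by
  have hne : ∀ᶠ τ in l, τ ≠ t := hl self_mem_nhdsWithin
  have h0 : Tendsto (fun τ : ℝ => τ - t) l (𝓝 0) := by
    have : Tendsto (fun τ : ℝ => τ - t) (𝓝 t) (𝓝 (t - t)) := tendsto_id.sub_const t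
    rw [sub_self] at this
    exact this.mono_left (hl.trans nhdsWithin_le_nhds)
  have hA' : ∀ i j, L2Tendsto l μ (fun τ x => A τ x i j) (fun x => G x i j) := fun i j => by
    have h1 := (hX i j).add ((hV i j).smul h0)
    simp only [zero_mul, add_zero] at h1
    convert h1 using 3
    rw [hA]
    rfl
  obtain ⟨MC, hMC⟩ := exists_tensor_bound C
  have hCu : ∀ i j k m, TendstoUniformly (fun (_ : ℝ) (_ : E n) => C i j k m)
      (fun _ => C i j k m) l := fun i j k m =>
    Metric.tendstoUniformly_iff.2 fun ε hε => by simp [hε]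
  have hCm : ∀ i j k m, AEStronglyMeasurable (fun _ : E n => C i j k m) μ :=
    fun _ _ _ _ => aestronglyMeasurable_const
  obtain ⟨i1, t1⟩ := tendsto_integral_contract_stress
    (D := fun τ x i j k m => (τ - t)⁻¹ * (P τ x i j k m - C i j k m)) hD hM
    (hm.mono fun τ h i j k m => ((h i j k m).sub aestronglyMeasurable_const).const_mul _)
    hm₀ hA' hA'
  obtain ⟨i2, t2⟩ := tendsto_integral_contract_stress (D := fun _ _ => C) (D₀ := fun _ => C) hCu
    (fun _ => hMC) (Eventually.of_forall fun _ => hCm) hCm hV hA'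
  obtain ⟨i3, t3⟩ := tendsto_integral_contract_stress (D := fun _ _ => C) (D₀ := fun _ => C) hCu
    (fun _ => hMC) (Eventually.of_forall fun _ => hCm) hCm hX hV
  obtain ⟨i4, -⟩ := tendsto_integral_contract_stress (D := fun _ _ => C) (D₀ := fun _ => C) hCu
    (fun _ => hMC) (Eventually.of_forall fun _ => hCm) hCm hX hX
  refine (t1.add (t2.add t3)).congr' ?_
  filter_upwards [i1, i2, i3, i4, hne] with τ i1 i2 i3 i4 hτ
  have hτ' : τ - t ≠ 0 := sub_ne_zero.2 hτ
  -- Expanding `A = X + (τ - t) V` cancels the energy of `X` and leaves `τ - t` times three terms: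
  -- the slope of the tensor tested on `A`, and two cross terms with `V`. Each has a limit because
  -- `A` and `X` share the limit `G`.
  have hpt : ∀ x, contract (stress (P τ x) (A τ x)) (A τ x) =
      contract (stress C (X τ x)) (X τ x) + (τ - t) *
      (contract (stress (fun i j k m => (τ - t)⁻¹ * (P τ x i j k m - C i j k m)) (A τ x)) (A τ x) +
        (contract (stress C (V τ x)) (A τ x) + contract (stress C (X τ x)) (V τ x))) := by
    intro x
    rw [stress_tensor_smul_sub, contract_smul_left]
    have h1 : stress (P τ x) (A τ x) - stress C (A τ x) =
        stress (P τ x) (A τ x) + (-1 : ℝ) • stress C (A τ x) := by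
      rw [neg_one_smul, sub_eq_add_neg]
    have h2 : stress C (A τ x) = stress C (X τ x) + (τ - t) • stress C (V τ x) := by
      rw [hA, stress_add, stress_smul]
    have h3 : contract (stress C (X τ x)) (A τ x) = contract (stress C (X τ x)) (X τ x) +
        (τ - t) * contract (stress C (X τ x)) (V τ x) := by
      rw [hA, contract_add_right, contract_smul_right]
    rw [h1, contract_add_left, contract_smul_left, h2, contract_add_left, contract_smul_left, h3]
    field_simp
    ring
  simp only [hpt]
  have hadd : ∀ {a b c d : E n → ℝ} (r : ℝ), Integrable a μ → Integrable b μ → Integrable c μ →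
      Integrable d μ → ∫ x, a x + r * (b x + (c x + d x)) ∂μ =
        ∫ x, a x ∂μ + r * (∫ x, b x ∂μ + (∫ x, c x ∂μ + ∫ x, d x ∂μ)) := by
    intro a b c d r ha hb hc hd
    have h1 : Integrable (fun x => c x + d x) μ := hc.add hd
    have h2 : Integrable (fun x => b x + (c x + d x)) μ := hb.add h1
    rw [integral_add ha (h2.const_mul r), integral_const_mul, integral_add hb h1,
      integral_add hc hd]
  rw [hadd (τ - t) i4 i1 i2 i3, add_sub_cancel_left, inv_mul_cancel_left₀ hτ']

/-- Differentiability of `p` at the single point `b` gives a uniform statement, because all the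
curves pass through `b` and their slopes are uniformly bounded. -/
theorem tendstoUniformly_slope_comp {V : Type*} [NormedAddCommGroup V] [NormedSpace ℝ V]
    {p : V → ℝ} {p' : V →L[ℝ] ℝ} {b : V} (hp : HasFDerivAt p p' b) {l : Filter ℝ} {t : ℝ}
    (hl : l ≤ 𝓝[≠] t) {B : ℝ → E n → V} {β : E n → V}
    (hB : TendstoUniformly (fun τ y => (τ - t)⁻¹ • (B τ y - b)) β l) {c : ℝ}
    (hβ : ∀ y, ‖β y‖ ≤ c) :
    TendstoUniformly (fun τ y => (τ - t)⁻¹ * (p (B τ y) - p b)) (fun y => p' (β y)) l := by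
  rw [Metric.tendstoUniformly_iff] at hB ⊢
  intro ε hε
  have hc : 0 ≤ c := (norm_nonneg _).trans (hβ 0)
  have hne : ∀ᶠ τ in l, τ ≠ t := hl self_mem_nhdsWithin
  have h0 : Tendsto (fun τ : ℝ => |τ - t|) l (𝓝 0) := by
    have : Tendsto (fun τ : ℝ => |τ - t|) (𝓝 t) (𝓝 |t - t|) := (tendsto_id.sub_const t).abs
    rw [sub_self, abs_zero] at this
    exact this.mono_left (hl.trans nhdsWithin_le_nhds)
  -- The tolerances `κ` and `δ` allot half of `ε` to the remainder of the first-order expansion,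
  -- where slopes are at most `c + 1`, and half to the error `‖p'‖ δ` of the slopes.
  set κ : ℝ := ε / (2 * (c + 1)) with hκ
  have hκ0 : 0 < κ := by positivity
  set δ : ℝ := ε / (2 * (‖p'‖ + 1)) with hδ
  have hδ0 : 0 < δ := by positivity
  have hlit := (hasFDerivAt_iff_isLittleO.1 hp).def hκ0
  obtain ⟨r, hr, hball⟩ := Metric.eventually_nhds_iff.1 hlit
  have hsmall : ∀ᶠ τ in l, |τ - t| * (c + 1) < r := by
    have : Tendsto (fun τ : ℝ => |τ - t| * (c + 1)) l (𝓝 (0 * (c + 1))) := h0.mul_const _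
    rw [zero_mul] at this
    exact this.eventually_lt_const hr
  filter_upwards [hB δ hδ0, hB 1 one_pos, hsmall, hne] with τ h1 h2 h3 h4 y
  have hτ : τ - t ≠ 0 := sub_ne_zero.2 h4
  set q := (τ - t)⁻¹ • (B τ y - b) with hq
  have hq1 : ‖q‖ ≤ c + 1 := by
    have := h2 y
    rw [dist_comm, dist_eq_norm] at this
    calc ‖q‖ = ‖(q - β y) + β y‖ := by rw [sub_add_cancel]
      _ ≤ _ := (norm_add_le _ _).trans (by linarith [hβ y])
  have hBq : B τ y - b = (τ - t) • q := by rw [hq, smul_inv_smul₀ hτ]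
  have hd : dist (B τ y) b < r := by
    rw [dist_eq_norm, hBq, norm_smul, Real.norm_eq_abs]
    exact lt_of_le_of_lt (by gcongr) h3
  have hrem := hball hd
  rw [hBq, norm_smul, map_smul, smul_eq_mul] at hrem
  have e1 : |(τ - t)⁻¹ * (p (B τ y) - p b) - p' q| ≤ κ * (c + 1) := by
    have : (τ - t)⁻¹ * (p (B τ y) - p b) - p' q =
        (τ - t)⁻¹ * (p (B τ y) - p b - (τ - t) * p' q) := by field_simp
    rw [this, abs_mul, abs_inv, inv_mul_le_iff₀ (abs_pos.2 hτ)]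
    refine hrem.trans ?_
    rw [Real.norm_eq_abs]
    calc κ * (|τ - t| * ‖q‖) = |τ - t| * (κ * ‖q‖) := by ring
      _ ≤ _ := by gcongr
  have e2 : |p' q - p' (β y)| ≤ ‖p'‖ * δ := by
    rw [← map_sub]
    refine (p'.le_opNorm _).trans ?_
    have := h1 y
    rw [dist_comm, dist_eq_norm] at this
    gcongr
  rw [dist_comm, Real.dist_eq]
  have e3 : κ * (c + 1) = ε / 2 := by rw [hκ]; field_simp
  have e4 : ‖p'‖ * δ < ε / 2 := by
    rw [hδ, mul_div_assoc', div_lt_div_iff₀ (by positivity) (by norm_num)]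
    nlinarith [norm_nonneg p']
  calc |(τ - t)⁻¹ * (p (B τ y) - p b) - p' (β y)|
      ≤ |(τ - t)⁻¹ * (p (B τ y) - p b) - p' q| + |p' q - p' (β y)| := abs_sub_le _ _ _
    _ < ε := by linarith

/-! ### Change of variables in the energy -/

theorem entry_comp (i j : Fin n) (A B : E n →L[ℝ] E n) :
    entry i j (A.comp B) = ∑ k, entry i k A * entry k j B := by
  have h : B (EuclideanSpace.single j 1) =
      ∑ k, entry k j B • EuclideanSpace.single k (1 : ℝ) := by
    ext m
    simp [entry_apply, Finset.sum_apply, Pi.single_apply]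
  rw [entry_apply, ContinuousLinearMap.comp_apply, h, map_sum]
  simp only [map_smul]
  simp only [entry_apply, WithLp.ofLp_sum, WithLp.ofLp_smul, Finset.sum_apply, Pi.smul_apply,
    smul_eq_mul]
  exact Finset.sum_congr rfl fun _ _ => mul_comm _ _

namespace IsC1Diffeo

variable {Ω : Set (E n)} {Φ : Equiv.Perm (E n)}

theorem fderiv_comp_symm (h : IsC1Diffeo Ω Φ) (x : E n) :
    (fderiv ℝ Φ x).comp (fderiv ℝ Φ.symm (Φ x)) = ContinuousLinearMap.id ℝ (E n) := by
  simpa using h.symm.fderiv_symm_comp (Φ x)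

theorem ringInverse_fderiv (h : IsC1Diffeo Ω Φ) (x : E n) :
    Ring.inverse (fderiv ℝ Φ x) = fderiv ℝ Φ.symm (Φ x) := by
  let a : (E n →L[ℝ] E n)ˣ :=
    ⟨fderiv ℝ Φ x, fderiv ℝ Φ.symm (Φ x), h.fderiv_comp_symm x, h.fderiv_symm_comp x⟩
  exact Ring.inverse_unit a

theorem grad_mul_grad_symm (h : IsC1Diffeo Ω Φ) (x : E n) :
    grad Φ x * grad Φ.symm (Φ x) = 1 := by
  ext i j
  calc _ = entry i j ((fderiv ℝ Φ x).comp (fderiv ℝ Φ.symm (Φ x))) := by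
        rw [entry_comp, Matrix.mul_apply]
        rfl
    _ = _ := by
        rw [h.fderiv_comp_symm, Matrix.one_apply]
        exact entry_one i j

theorem grad_symm_mul_grad (h : IsC1Diffeo Ω Φ) (x : E n) :
    grad Φ.symm (Φ x) * grad Φ x = 1 :=
  mul_eq_one_comm.1 (h.grad_mul_grad_symm x)

theorem continuous_pullbackTensor (h : IsC1Diffeo Ω Φ) (C : Tensor4 n) (i j k l : Fin n) :
    Continuous fun y => pullbackTensor C (fderiv ℝ Φ y) i j k l := by
  have h1 : ∀ i j : Fin n, Continuous fun y =>
      Ring.inverse (fderiv ℝ Φ y) (EuclideanSpace.single j 1) i := fun i j => by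
    simp only [h.ringInverse_fderiv]
    exact (continuous_grad_apply h.contDiff_symm i j).comp h.contDiff.continuous
  have h2 : Continuous fun y => (fderiv ℝ Φ y).det := by
    simp only [det_eq_det_matrix]
    refine Continuous.matrix_det (continuous_matrix fun i j => ?_)
    exact continuous_grad_apply h.contDiff i j
  unfold pullbackTensor
  exact h2.abs.mul (continuous_finsetSum _ fun a _ => continuous_finsetSum _ fun b _ =>
    continuous_const.mul ((h1 j a).mul (h1 l b)))

theorem integral_contract_stress_image (h : IsC1Diffeo Ω Φ) (C : Tensor4 n) {S : Set (E n)}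
    (hS : MeasurableSet S) (X Y : E n → Mat n) :
    ∫ x in Φ '' S, contract (stress C (X x)) (Y x) =
      ∫ y in S, contract (stress (pullbackTensor C (fderiv ℝ Φ y)) (X (Φ y) * grad Φ y))
        (Y (Φ y) * grad Φ y) := by
  rw [h.integral_image hS]
  congr 1
  ext y
  rw [contract_stress_pullbackTensor C (fderiv ℝ Φ y) (grad Φ.symm (Φ y)) _ _ fun i j => by
    rw [h.ringInverse_fderiv]; rfl]
  rw [Matrix.mul_assoc, Matrix.mul_assoc, h.grad_mul_grad_symm, Matrix.mul_one, Matrix.mul_one]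

end IsC1Diffeo

theorem pullbackTensor_id (C : Tensor4 n) :
    pullbackTensor C (ContinuousLinearMap.id ℝ (E n)) = C := by
  have h1 : (1 : E n →L[ℝ] E n).det = 1 := by simp [ContinuousLinearMap.det]
  have h2 : Ring.inverse (1 : E n →L[ℝ] E n) = 1 := Ring.inverse_one _
  ext i j k l
  change pullbackTensor C 1 i j k l = _
  simp only [pullbackTensor, h1, h2]
  simp

/-! ### Properties of equilibrium displacements -/

section Equilibrium

variable {C : Tensor4 n} {Ω K : Set (E n)}

theorem HasTrace.sub {u v g h : E n → E n} (hu : HasTrace Ω u g) (hv : HasTrace Ω v h)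
    (hm : AEStronglyMeasurable u (volume.restrict Ω)) :
    HasTrace Ω (fun x => u x - v x) (fun x => g x - h x) := by
  simpa only [neg_one_smul, ← sub_eq_add_neg] using hu.add (hv.const_smul (-1)) hm

/-- Two fields with the same trace differ by an admissible test field, so the virtual work of the
stress depends on the boundary value alone. -/
theorem IsEquilibrium.integral_contract_eq {u₀ u : E n → E n} {G : E n → Mat n} {v₀ v w : E n → E n}
    {H I : E n → Mat n} (h : IsEquilibrium C Ω K u₀ u G) (hK : volume K = 0)
    (hv : MemW12 (Ω \ K) v H) (hv₀ : HasTrace Ω v v₀) (hw : MemW12 (Ω \ K) w I)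
    (hw₀ : HasTrace Ω w v₀) :
    ∫ x in Ω \ K, contract (stress C (G x)) (H x) =
      ∫ x in Ω \ K, contract (stress C (G x)) (I x) := by
  have h1 := h.weak _ _ (hv.sub hw) (by simpa using hv₀.sub hw₀ (hv.aestronglyMeasurable hK))
  have h2 : ∀ x, contract (stress C (G x)) (H x - I x) =
      contract (stress C (G x)) (H x) - contract (stress C (G x)) (I x) := fun x => by
    rw [sub_eq_add_neg, ← neg_one_smul ℝ (I x), contract_add_right, contract_smul_right]
    ring
  simp only [h2] at h1
  rw [integral_sub (integrable_contract_stress_const C h.mem.2.1 hv.2.1)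
    (integrable_contract_stress_const C h.mem.2.1 hw.2.1)] at h1
  exact sub_eq_zero.1 h1

/-- Equilibrium displacements minimize the energy. -/
theorem IsEquilibrium.integral_le (hC : IsElasticityTensor C) {u₀ u v : E n → E n}
    {G H : E n → Mat n} (h : IsEquilibrium C Ω K u₀ u G) (hK : volume K = 0)
    (hv : MemW12 (Ω \ K) v H) (hv₀ : HasTrace Ω v u₀) :
    ∫ x in Ω \ K, contract (stress C (G x)) (G x) ≤
      ∫ x in Ω \ K, contract (stress C (H x)) (H x) := by
  have h1 := h.integral_contract_eq hK hv hv₀ h.mem h.trace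
  have iGG := integrable_contract_stress_const C h.mem.2.1 h.mem.2.1
  have iGH := integrable_contract_stress_const C h.mem.2.1 hv.2.1
  have iHH := integrable_contract_stress_const C hv.2.1 hv.2.1
  -- This is the nonnegativity of the energy of `H - G`. After integration `∫ CG : H = ∫ CG : G`,
  -- and the comparison follows.
  have h2 : ∀ x, 2 * contract (stress C (G x)) (H x) - contract (stress C (G x)) (G x) ≤
      contract (stress C (H x)) (H x) := fun x => by
    have h3 := contract_stress_self_nonneg hC (H x + (-1 : ℝ) • G x)
    rw [stress_add, stress_smul, contract_add_left, contract_add_right, contract_add_right,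
      contract_smul_left, contract_smul_right, contract_smul_left, contract_smul_right,
      contract_stress_comm hC (H x) (G x)] at h3
    linarith
  have h4 := integral_mono ((iGH.const_mul 2).sub iGG) iHH h2
  simp only [Pi.sub_apply] at h4
  rw [integral_sub (iGH.const_mul 2) iGG, integral_const_mul, h1] at h4
  linarith

/-- The definition rests on an arbitrary choice. Changing the extension is harmless by the weak
equation; the difference of two equilibria has zero energy, so it carries no stress although it need
not vanish. -/
theorem IsEquilibrium.dirichletToNeumann_eq (hC : IsElasticityTensor C) {u₀ u : E n → E n}
    {G : E n → Mat n} {v₀ v : E n → E n} {H : E n → Mat n} (h : IsEquilibrium C Ω K u₀ u G)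
    (hK : volume K = 0) (hv : MemW12 (Ω \ K) v H) (hv₀ : HasTrace Ω v v₀) :
    dirichletToNeumann C Ω K u₀ v₀ = ∫ x in Ω \ K, contract (stress C (G x)) (H x) := by
  have hex : ∃ p : (E n → Mat n) × (E n → Mat n),
      (∃ u, IsEquilibrium C Ω K u₀ u p.1) ∧ ∃ v, MemW12 (Ω \ K) v p.2 ∧ HasTrace Ω v v₀ :=
    ⟨(G, H), ⟨u, h⟩, v, hv, hv₀⟩
  rw [dirichletToNeumann, dif_pos hex]
  obtain ⟨⟨u', h'⟩, v', hv', hv₀'⟩ := hex.choose_spec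
  set G' := hex.choose.1
  set H' := hex.choose.2
  rw [h'.integral_contract_eq hK hv' hv₀' hv hv₀]
  have hd := h'.mem.sub h.mem
  have ht : HasTrace Ω (fun x => u' x - u x) (fun _ => 0) := by
    simpa using h'.trace.sub h.trace (h'.mem.aestronglyMeasurable hK)
  have hneg : ∀ x, G' x - G x = G' x + (-1 : ℝ) • G x := fun x => by
    rw [neg_one_smul, sub_eq_add_neg]
  have e1 := h'.weak _ _ hd ht
  have e2 := h.weak _ _ hd ht
  have h3 : ∫ x in Ω \ K, contract (stress C (G' x - G x)) (G' x - G x) = 0 := by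
    have h4 : ∀ x, contract (stress C (G' x - G x)) (G' x - G x) =
        contract (stress C (G' x)) (G' x - G x) - contract (stress C (G x)) (G' x - G x) := by
      intro x
      conv_lhs => rw [hneg x, stress_add, stress_smul, contract_add_left, contract_smul_left,
        ← hneg x]
      ring
    simp only [h4]
    rw [integral_sub (integrable_contract_stress_const C h'.mem.2.1 hd.2.1)
      (integrable_contract_stress_const C h.mem.2.1 hd.2.1), e1, e2, sub_zero]
  rw [integral_eq_zero_iff_of_nonneg (fun x => contract_stress_self_nonneg hC _)
    (integrable_contract_stress_const C hd.2.1 hd.2.1)] at h3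
  refine integral_congr_ae (h3.mono fun x hx => ?_)
  have h5 := contract_stress_eq_zero hC hx (H x)
  rw [hneg, stress_add, stress_smul, contract_add_left, contract_smul_left] at h5
  simp only
  linarith

end Equilibrium

/-! ### Extensions of boundary velocities -/

/-- The slopes of a `C¹` curve of boundary values have extensions whose gradients converge. -/
theorem IsC1Curve.exists_extension {Ω : Set (E n)} (hΩ : IsOpen Ω) {T : ℝ} (hT : 0 < T)
    {g g' : ℝ → E n → E n} (hg : IsC1Curve (hHalfNorm Ω) T g g') {t : ℝ} (ht : t ∈ Icc 0 T) :
    ∃ (v : E n → E n) (V : E n → Mat n) (w : ℝ → E n → E n) (W : ℝ → E n → Mat n),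
      MemW12 Ω v V ∧ HasTrace Ω v (g' t) ∧
      (∀ᶠ τ in 𝓝[Icc 0 T \ {t}] t, MemW12 Ω (w τ) (W τ) ∧
        HasTrace Ω (w τ) (fun x => (τ - t)⁻¹ • (g τ x - g t x))) ∧
      ∀ i j, L2Tendsto (𝓝[Icc 0 T \ {t}] t) (volume.restrict Ω) (fun τ x => W τ x i j)
        (fun x => V x i j) := by
  have hne := neBot_nhdsWithin_Icc_diff hT ht
  set l := 𝓝[Icc 0 T \ {t}] t with hl
  have hmeas : ∀ {u : E n → E n} {G : E n → Mat n}, MemW12 Ω u G →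
      AEStronglyMeasurable u (volume.restrict Ω) := fun {u G} hu =>
    MemW12.aestronglyMeasurable (K := ∅) (by simp) (by simpa using hu)
  have hext : ∀ {f : E n → E n} {c : ℝ≥0∞}, hHalfNorm Ω f < c →
      ∃ (u : E n → E n) (G : E n → Mat n), MemW12 Ω u G ∧ HasTrace Ω u f ∧
        sobolevNorm 1 Ω u < c := fun {f c} hf => by
    obtain ⟨u, hu⟩ := iInf_lt_iff.1 hf
    obtain ⟨hu, hc⟩ := iInf_lt_iff.1 hu
    obtain ⟨G, hG⟩ := exists_memW12_of_sobolevNorm_lt_top hΩ (hc.trans_le le_top)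
    exact ⟨u, G, hG, hu, hc⟩
  let d : ℝ → E n → E n := fun τ x => (τ - t)⁻¹ • (g τ x - g t x) - g' t x
  have hd : Tendsto (fun τ => hHalfNorm Ω (d τ)) l (𝓝 0) := hg.deriv t ht
  have hmem : ∀ᶠ τ in l, τ ∈ Icc 0 T \ {t} := self_mem_nhdsWithin
  have hdtop : ∀ᶠ τ in l, hHalfNorm Ω (d τ) < ⊤ := hd.eventually_lt_const ENNReal.zero_lt_top
  -- That the velocity `g' t` is itself a trace is not part of the hypothesis; it is recovered as
  -- one slope of `g` minus its remainder.
  obtain ⟨v, V, hv, hvt⟩ : ∃ (v : E n → E n) (V : E n → Mat n), MemW12 Ω v V ∧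
      HasTrace Ω v (g' t) := by
    obtain ⟨τ, h1, h2⟩ := (hmem.and hdtop).exists
    obtain ⟨a, A, hA, ha, -⟩ := hext (hg.mem τ h1.1)
    obtain ⟨b, B, hB, hb, -⟩ := hext (hg.mem t ht)
    obtain ⟨c, D, hD, hc, -⟩ := hext h2
    have hab := (hA.sub hB).const_smul (τ - t)⁻¹
    refine ⟨_, _, hab.sub hD, ?_⟩
    simpa [d] using ((ha.sub hb (hmeas hA)).const_smul (τ - t)⁻¹).sub hc (hmeas hab)
  -- Only the remainder `d τ` is extended, almost optimally. The positive slack `|τ - t|` makes the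
  -- infimum accessible and still tends to zero.
  have hch : ∀ τ, ∃ (w : E n → E n) (W : E n → Mat n), hHalfNorm Ω (d τ) < ⊤ ∧ τ ≠ t →
      MemW12 Ω w W ∧ HasTrace Ω w (d τ) ∧
        sobolevNorm 1 Ω w < hHalfNorm Ω (d τ) + ‖τ - t‖ₑ := by
    intro τ
    by_cases h : hHalfNorm Ω (d τ) < ⊤ ∧ τ ≠ t
    · obtain ⟨w, W, h1⟩ := hext (f := d τ) (c := hHalfNorm Ω (d τ) + ‖τ - t‖ₑ)
        (ENNReal.lt_add_right h.1.ne (by simpa [sub_eq_zero] using h.2))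
      exact ⟨w, W, fun _ => h1⟩
    · exact ⟨0, 0, fun h' => absurd h' h⟩
  choose w W hw using hch
  have hev : ∀ᶠ τ in l, hHalfNorm Ω (d τ) < ⊤ ∧ τ ≠ t := by
    filter_upwards [hdtop, hmem] with τ h1 h2 using ⟨h1, h2.2⟩
  refine ⟨v, V, fun τ x => v x + w τ x, fun τ x => V x + W τ x, hv, hvt, ?_, fun i j => ?_⟩
  · filter_upwards [hev] with τ hτ
    obtain ⟨h1, h2, -⟩ := hw τ hτ
    exact ⟨hv.add h1, by simpa [d] using hvt.add h2 (hmeas hv)⟩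
  · refine ⟨?_, hv.2.1 i j, ?_⟩
    · filter_upwards [hev] with τ hτ using (hv.add (hw τ hτ).1).2.1 i j
    · have h0 : Tendsto (fun τ : ℝ => ‖τ - t‖ₑ) l (𝓝 0) := by
        have h1 : Continuous fun τ : ℝ => ‖τ - t‖ₑ := by fun_prop
        have h2 := h1.tendsto t
        simp only [sub_self, enorm_zero] at h2
        exact h2.mono_left nhdsWithin_le_nhds
      refine tendsto_of_tendsto_of_tendsto_of_le_of_le' tendsto_const_nhds
        (by simpa using hd.add h0) (Eventually.of_forall fun _ => zero_le) ?_
      filter_upwards [hev] with τ hτ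
      obtain ⟨h1, -, h3⟩ := hw τ hτ
      refine le_trans (le_of_eq ?_) ((h1.eLpNorm_le_sobolevNorm hΩ i j).trans h3.le)
      simp

/-! ### The pulled-back tensors along a crack propagation curve -/

theorem IsCrackCurve.tendstoUniformly_pullbackTensor (hn : n = 2 ∨ n = 3) {Ω K : Set (E n)}
    {s : ℕ} {T : ℝ} {φ : ℝ → Equiv.Perm (E n)} (h : IsCrackCurve Ω K s T φ) (hΩ : IsOpen Ω)
    (hΩb : Bornology.IsBounded Ω) (hs : n + 1 ≤ s) {t : ℝ} (ht : t ∈ Icc 0 T) (C : Tensor4 n)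
    (i j k m : Fin n) :
    TendstoUniformly (fun τ y => (τ - t)⁻¹ *
        (pullbackTensor C (fderiv ℝ (φ τ * (φ t)⁻¹ : Equiv.Perm (E n)) y) i j k m - C i j k m))
      (fun y => pullbackTensorDeriv C (grad (velocity T φ t) y) i j k m)
      (𝓝[Icc 0 T \ {t}] t) := by
  obtain ⟨h1, c, hc⟩ := h.tendstoUniformly_fderiv hΩ hΩb hs ht
  obtain ⟨L, hL, hL'⟩ := hasFDerivAt_pullbackTensor hn C i j k m
  have := tendstoUniformly_slope_comp hL (nhdsWithin_mono _ fun x hx => hx.2) h1 hc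
  simp only [hL', pullbackTensor_id] at this
  exact this

theorem IsCrackCurve.exists_abs_pullbackTensorDeriv_le {Ω K : Set (E n)}
    {s : ℕ} {T : ℝ} {φ : ℝ → Equiv.Perm (E n)} (h : IsCrackCurve Ω K s T φ) (hΩ : IsOpen Ω)
    (hΩb : Bornology.IsBounded Ω) (hs : n + 1 ≤ s) {t : ℝ} (ht : t ∈ Icc 0 T) (C : Tensor4 n) :
    ∃ M, ∀ y i j k m, |pullbackTensorDeriv C (grad (velocity T φ t) y) i j k m| ≤ M := by
  obtain ⟨-, c, hc⟩ := h.tendstoUniformly_fderiv hΩ hΩb hs ht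
  obtain ⟨M, hM⟩ := exists_tensor_bound C
  have hg : ∀ y i j, |grad (velocity T φ t) y i j| ≤ c := fun y i j =>
    (abs_grad_apply_le _ _ _ _).trans (hc y)
  -- One summand for each of the three terms of `pullbackTensorDeriv`, with entries of the tensor
  -- bounded by `M` and of the gradient by `c`.
  refine ⟨n * c * M + n * (M * c) + n * (M * c), fun y i j k m => ?_⟩
  have hc0 : 0 ≤ c := (abs_nonneg _).trans (hg y i i)
  have hM0 : 0 ≤ M := (abs_nonneg _).trans (hM i i i i)
  have hsum : ∀ {f : Fin n → ℝ} {r : ℝ}, (∀ a, |f a| ≤ r) → |∑ a, f a| ≤ n * r := fun {f r} hf =>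
    (Finset.abs_sum_le_sum_abs _ _).trans ((Finset.sum_le_sum fun a _ => hf a).trans (by simp))
  have hmul : ∀ {a b r r' : ℝ}, 0 ≤ r → |a| ≤ r → |b| ≤ r' → |a * b| ≤ r * r' :=
    fun hr ha hb => by
      rw [abs_mul]
      exact mul_le_mul ha hb (abs_nonneg _) hr
  unfold pullbackTensorDeriv
  refine (abs_sub _ _).trans (add_le_add ((abs_sub _ _).trans (add_le_add ?_ ?_)) ?_)
  · exact hmul (by positivity) (hsum fun a => hg y a a) (hM i j k m)
  · exact hsum fun a => hmul hM0 (hM i a k m) (hg y j a)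
  · exact hsum fun a => hmul hM0 (hM i j k a) (hg y m a)

theorem measurable_pullbackTensorDeriv (C : Tensor4 n) (η : E n → E n) (i j k m : Fin n) :
    Measurable fun y => pullbackTensorDeriv C (grad η y) i j k m := by
  have h1 : ∀ i j, Measurable fun y => grad η y i j := fun i j =>
    (EuclideanSpace.proj i : E n →L[ℝ] ℝ).measurable.comp
      (measurable_fderiv_apply_const ℝ η (EuclideanSpace.single j 1))
  unfold pullbackTensorDeriv
  fun_prop

theorem IsC1Diffeo.l2Tendsto_comp {Ω : Set (E n)} {Φ : Equiv.Perm (E n)}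
    (hΩb : Bornology.IsBounded Ω) (h : IsC1Diffeo Ω Φ) {S : Set (E n)} (hS : MeasurableSet S)
    {ι : Type*} {l : Filter ι} {f : ι → E n → ℝ} {g : E n → ℝ}
    (hf : L2Tendsto l (volume.restrict S) f g) :
    L2Tendsto l (volume.restrict (Φ ⁻¹' S)) (fun i x => f i (Φ x)) (fun x => g (Φ x)) := by
  obtain ⟨c, hc, hle⟩ := h.exists_eLpNorm_comp_le hΩb
  refine ⟨hf.mem.mono fun i hi => h.memLp_comp hΩb hS hi, h.memLp_comp hΩb hS hf.memLp, ?_⟩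
  have h1 := ENNReal.Tendsto.const_mul (a := c) hf.lim (Or.inr hc)
  rw [mul_zero] at h1
  refine tendsto_of_tendsto_of_tendsto_of_le_of_le' tendsto_const_nhds h1
    (Eventually.of_forall fun _ => zero_le) ?_
  filter_upwards [hf.mem] with i hi
  exact (hle S hS (fun x => f i x - g x) (hi.sub hf.memLp).1).2

/-! ### Bounds for the slopes of the energy -/

theorem grad_relative {Ω : Set (E n)} {φ₁ φ₂ : Equiv.Perm (E n)} (h₁ : IsC1Diffeo Ω φ₁)
    (h₂ : IsC1Diffeo Ω φ₂) (y : E n) : grad (φ₁ * φ₂⁻¹ : Equiv.Perm (E n)) y =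
      grad φ₁ (φ₂.symm y) * grad φ₂.symm y := by
  ext i j
  change entry i j (fderiv ℝ (φ₁ * φ₂⁻¹ : Equiv.Perm (E n)) y) = _
  rw [IsCrackCurve.fderiv_relative h₁ h₂, entry_comp, Matrix.mul_apply]
  rfl

namespace IsCrackCurve

variable {Ω K : Set (E n)} {s : ℕ} {T : ℝ} {φ : ℝ → Equiv.Perm (E n)}

theorem isC1Diffeo_relative (h : IsCrackCurve Ω K s T φ) (hΩ : IsOpen Ω)
    (hΩb : Bornology.IsBounded Ω) (hs : n + 1 ≤ s) {t τ : ℝ} (ht : t ∈ Icc 0 T)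
    (hτ : τ ∈ Icc 0 T) : IsC1Diffeo Ω (φ τ * (φ t)⁻¹) :=
  (h.isC1Diffeo hΩ hΩb hs hτ).mul (h.isC1Diffeo hΩ hΩb hs ht).symm

theorem relative_image (h : IsCrackCurve Ω K s T φ) (hΩ : IsOpen Ω)
    (hΩb : Bornology.IsBounded Ω) (hs : n + 1 ≤ s) {t τ : ℝ} (ht : t ∈ Icc 0 T)
    (hτ : τ ∈ Icc 0 T) :
    (φ τ * (φ t)⁻¹ : Equiv.Perm (E n)) '' (Ω \ φ t '' K) = Ω \ φ τ '' K := by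
  rw [(h.isC1Diffeo_relative hΩ hΩb hs ht hτ).image_diff, image_image]
  simp

theorem relative_preimage (h : IsCrackCurve Ω K s T φ) (hΩ : IsOpen Ω)
    (hΩb : Bornology.IsBounded Ω) (hs : n + 1 ≤ s) {t τ : ℝ} (ht : t ∈ Icc 0 T)
    (hτ : τ ∈ Icc 0 T) :
    (φ τ * (φ t)⁻¹ : Equiv.Perm (E n)) ⁻¹' (Ω \ φ τ '' K) = Ω \ φ t '' K := by
  rw [← h.relative_image hΩ hΩb hs ht hτ, preimage_image_eq _ (Equiv.injective _)]

theorem isOpen_diff_image (h : IsCrackCurve Ω K s T φ) (hΩ : IsOpen Ω)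
    (hΩb : Bornology.IsBounded Ω) (hs : n + 1 ≤ s) (hK : IsClosed K) {t : ℝ}
    (ht : t ∈ Icc 0 T) : IsOpen (Ω \ φ t '' K) :=
  hΩ.sdiff ((h.isC1Diffeo hΩ hΩb hs ht).isClosed_image hK)

variable {C : Tensor4 n} {g g' : ℝ → E n → E n} {u : ℝ → E n → E n} {G : ℝ → E n → Mat n}

theorem integrableOn_variationIntegrand (h : IsCrackCurve Ω K s T φ) (hΩ : IsOpen Ω)
    (hΩb : Bornology.IsBounded Ω) (hs : n + 1 ≤ s) (hC : IsElasticityTensor C) {t : ℝ}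
    (ht : t ∈ Icc 0 T) {S : Set (E n)} {H : E n → Mat n}
    (hH : ∀ i j, MemLp (fun x => H x i j) 2 (volume.restrict S)) :
    IntegrableOn (variationIntegrand C (velocity T φ t) H) S := by
  obtain ⟨M, hM⟩ := h.exists_abs_pullbackTensorDeriv_le hΩ hΩb hs ht C
  have := integrable_contract_stress hM (fun i j k m =>
    (measurable_pullbackTensorDeriv C (velocity T φ t) i j k m).aestronglyMeasurable) hH hH
  simp only [contract_stress_pullbackTensorDeriv hC] at this
  exact this

/-- The slope of the energy of `X + (τ - t) W`, pulled back to the crack at time `t`. -/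
theorem tendsto_slope_energy (hn : n = 2 ∨ n = 3) (h : IsCrackCurve Ω K s T φ) (hΩ : IsOpen Ω)
    (hΩb : Bornology.IsBounded Ω) (hs : n + 1 ≤ s) (hC : IsElasticityTensor C) {t : ℝ}
    (ht : t ∈ Icc 0 T) {S : Set (E n)} {X W A : ℝ → E n → Mat n} {H V : E n → Mat n}
    (hX : ∀ i j, L2Tendsto (𝓝[Icc 0 T \ {t}] t) (volume.restrict S) (fun τ x => X τ x i j)
      (fun x => H x i j))
    (hW : ∀ i j, L2Tendsto (𝓝[Icc 0 T \ {t}] t) (volume.restrict S) (fun τ x => W τ x i j)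
      (fun x => V x i j))
    (hA : ∀ τ x, A τ x = X τ x + (τ - t) • W τ x) :
    Tendsto (fun τ => (τ - t)⁻¹ * ((∫ y in S, contract (stress (pullbackTensor C
        (fderiv ℝ (φ τ * (φ t)⁻¹ : Equiv.Perm (E n)) y)) (A τ y)) (A τ y)) -
      ∫ y in S, contract (stress C (X τ y)) (X τ y))) (𝓝[Icc 0 T \ {t}] t)
      (𝓝 ((∫ y in S, variationIntegrand C (velocity T φ t) H y) +
        2 * ∫ y in S, contract (stress C (H y)) (V y))) := by
  obtain ⟨M, hM⟩ := h.exists_abs_pullbackTensorDeriv_le hΩ hΩb hs ht C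
  have key := tendsto_slope_integral_contract_stress (t := t)
    (nhdsWithin_mono _ fun x hx => hx.2)
    (h.tendstoUniformly_pullbackTensor hn hΩ hΩb hs ht C) hM
    (eventually_nhdsWithin_of_forall fun τ hτ i j k m =>
      ((h.isC1Diffeo_relative hΩ hΩb hs ht hτ.1).continuous_pullbackTensor C i j k
        m).aestronglyMeasurable)
    (fun i j k m =>
      (measurable_pullbackTensorDeriv C (velocity T φ t) i j k m).aestronglyMeasurable) hX hW hA
  simp only [contract_stress_pullbackTensorDeriv hC, contract_stress_comm hC (V _) (H _),
    ← two_mul] at key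
  exact key

/-- The competitor at time `τ` is `u_t + (τ - t) w_τ`, transported to the new crack by the relative
deformation. The bound is valid on both sides of `t`, and no regularity of `τ ↦ u_τ` enters. -/
theorem exists_upper_slope (hn : n = 2 ∨ n = 3) (h : IsCrackCurve Ω K s T φ) (hΩ : IsOpen Ω)
    (hΩb : Bornology.IsBounded Ω) (hs : n + 1 ≤ s) (hC : IsElasticityTensor C)
    (hK : IsCrackSet Ω K) (hg : IsC1Curve (hHalfNorm Ω) T g g')
    (hu : ∀ t ∈ Icc 0 T, IsEquilibrium C Ω (φ t '' K) (g t) (u t) (G t)) {t : ℝ}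
    (ht : t ∈ Icc 0 T) :
    ∃ U : ℝ → ℝ, Tendsto U (𝓝[Icc 0 T \ {t}] t)
        (𝓝 ((∫ x in Ω \ φ t '' K, variationIntegrand C (velocity T φ t) (G t) x) +
          2 * power C Ω K φ g g' t)) ∧
      ∀ᶠ τ in 𝓝[Icc 0 T \ {t}] t, (∫ x in Ω \ φ τ '' K, contract (stress C (G τ x)) (G τ x)) -
        ∫ x in Ω \ φ t '' K, contract (stress C (G t x)) (G t x) ≤ (τ - t) * U τ := by
  have hS := h.isOpen_diff_image hΩ hΩb hs hK.closed ht
  have hvol : ∀ {τ}, τ ∈ Icc 0 T → volume (φ τ '' K) = 0 := fun hτ =>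
    (h.isC1Diffeo hΩ hΩb hs hτ).volume_image_eq_zero hΩb hK.volume_eq_zero
  obtain ⟨v, V, w, W, hv, hvt, hw, hW⟩ := hg.exists_extension hΩ h.pos ht
  have hWS : ∀ i j, L2Tendsto (𝓝[Icc 0 T \ {t}] t) (volume.restrict (Ω \ φ t '' K))
      (fun τ x => W τ x i j) (fun x => V x i j) := fun i j => (hW i j).mono_set sdiff_subset
  have key := h.tendsto_slope_energy hn hΩ hΩb hs hC ht
    (X := fun _ => G t) (A := fun τ x => G t x + (τ - t) • W τ x)
    (fun i j => L2Tendsto.const ((hu t ht).mem.2.1 i j)) hWS (fun τ x => rfl)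
  rw [power, (hu t ht).dirichletToNeumann_eq hC (hvol ht) (hv.mono sdiff_subset) hvt]
  refine ⟨_, key, ?_⟩
  filter_upwards [hw, self_mem_nhdsWithin] with τ ⟨hw, hwt⟩ hτ
  have hτ0 : τ - t ≠ 0 := sub_ne_zero.2 hτ.2
  have hψ := h.isC1Diffeo_relative hΩ hΩb hs ht hτ.1
  rw [mul_inv_cancel_left₀ hτ0]
  refine sub_le_sub_right ?_ _
  have hcomp := (hu t ht).mem.add ((hw.mono (sdiff_subset (t := φ t '' K))).const_smul (τ - t))
  have htr : HasTrace Ω (fun x => u t x + (τ - t) • w τ x) (g τ) := by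
    have := (hu t ht).trace.add (hwt.const_smul (τ - t))
      ((hu t ht).mem.aestronglyMeasurable (hvol ht))
    simpa only [smul_inv_smul₀ hτ0, add_sub_cancel] using this
  have hm := hψ.symm.memW12_comp hΩb hS hcomp
  rw [← Equiv.image_eq_preimage_symm, h.relative_image hΩ hΩb hs ht hτ.1] at hm
  have htr' := hψ.symm.hasTrace_comp hΩ hΩb htr
  have hmin := (hu τ hτ.1).integral_le hC (hvol hτ.1) hm htr'
  refine hmin.trans (le_of_eq ?_)
  rw [← h.relative_image hΩ hΩb hs ht hτ.1,
    hψ.integral_contract_stress_image C hS.measurableSet]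
  refine integral_congr_ae (Eventually.of_forall fun y => ?_)
  -- Pulling back undoes the transport, so the gradient of the competitor becomes `G t + (τ - t) • W
  -- τ` on the old domain.
  have hy : ∀ A : Mat n, A * grad (φ τ * (φ t)⁻¹ : Equiv.Perm (E n)).symm
      ((φ τ * (φ t)⁻¹ : Equiv.Perm (E n)) y) * grad (φ τ * (φ t)⁻¹ : Equiv.Perm (E n)) y = A :=
    fun A => by rw [Matrix.mul_assoc, hψ.grad_symm_mul_grad, Matrix.mul_one]
  simp only [Equiv.symm_apply_apply, hy]

/-- The pulled-back gradients of a `C¹` fracture curve are continuous in `L²`. -/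
theorem l2Tendsto_relative_gradient (h : IsCrackCurve Ω K s T φ) (hΩ : IsOpen Ω)
    (hΩb : Bornology.IsBounded Ω) (hs : n + 1 ≤ s) (hK : IsClosed K)
    (hu : ∀ t ∈ Icc 0 T, MemW12 (Ω \ φ t '' K) (u t) (G t)) (hc : IsC1FractureCurve Ω K T φ u)
    {t : ℝ} (ht : t ∈ Icc 0 T) (i j : Fin n) :
    L2Tendsto (𝓝[Icc 0 T \ {t}] t) (volume.restrict (Ω \ φ t '' K))
      (fun τ x => (G τ ((φ τ * (φ t)⁻¹ : Equiv.Perm (E n)) x) *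
        grad (φ τ * (φ t)⁻¹ : Equiv.Perm (E n)) x) i j) (fun x => G t x i j) := by
  obtain ⟨v, hv⟩ := hc
  have hne := neBot_nhdsWithin_Icc_diff h.pos ht
  have hU := hΩ.sdiff hK
  have hpre : ∀ {τ}, τ ∈ Icc 0 T → φ τ ⁻¹' (Ω \ φ τ '' K) = Ω \ K := fun {τ} hτ => by
    rw [← (h.isC1Diffeo hΩ hΩb hs hτ).image_diff, preimage_image_eq _ (Equiv.injective _)]
  have hmem : ∀ {τ}, τ ∈ Icc 0 T → MemW12 (Ω \ K) (fun x => u τ (φ τ x))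
      (fun x => G τ (φ τ x) * grad (φ τ) x) := fun {τ} hτ => by
    have := (h.isC1Diffeo hΩ hΩb hs hτ).memW12_comp hΩb
      (h.isOpen_diff_image hΩ hΩb hs hK hτ) (hu τ hτ)
    rwa [hpre hτ] at this
  set l := 𝓝[Icc 0 T \ {t}] t
  let q : ℝ → E n → E n := fun τ x => (τ - t)⁻¹ • (u τ (φ τ x) - u t (φ t x))
  have hq : Tendsto (fun τ => sobolevNorm 1 (Ω \ K) (fun x => q τ x - v t x)) l (𝓝 0) :=
    hv.deriv t ht
  -- The velocity has finite norm, being one slope minus its remainder. The distance from time `t`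
  -- is therefore at most `|τ - t|` times a bounded quantity.
  have hvt : sobolevNorm 1 (Ω \ K) (v t) ≠ ⊤ := by
    obtain ⟨τ, hτ, h1⟩ := ((eventually_mem_nhdsWithin (a := t) (s := Icc 0 T \ {t})).and
      (hq.eventually_lt_const ENNReal.zero_lt_top)).exists
    have h2 : sobolevNorm 1 (Ω \ K) (q τ) < ⊤ :=
      (sobolevNorm_const_smul_le 1 _ _ (inv_ne_zero (sub_ne_zero.2 hτ.2))).trans_lt
        (ENNReal.mul_lt_top enorm_lt_top ((sobolevNorm_sub_le 1 _ _ _).trans_lt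
          (ENNReal.add_lt_top.2 ⟨hv.mem τ hτ.1, hv.mem t ht⟩)))
    have h3 := sobolevNorm_sub_le 1 (Ω \ K) (q τ) (fun x => q τ x - v t x)
    simp only [sub_sub_cancel] at h3
    exact (h3.trans_lt (ENNReal.add_lt_top.2 ⟨h2, h1⟩)).ne
  have h0 : Tendsto (fun τ : ℝ => ‖τ - t‖ₑ) l (𝓝 0) := by
    have h1 : Continuous fun τ : ℝ => ‖τ - t‖ₑ := by fun_prop
    have h2 := h1.tendsto t
    simp only [sub_self, enorm_zero] at h2
    exact h2.mono_left nhdsWithin_le_nhds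
  have hlim : Tendsto (fun τ => ‖τ - t‖ₑ * (sobolevNorm 1 (Ω \ K) (fun x => q τ x - v t x) +
      sobolevNorm 1 (Ω \ K) (v t))) l (𝓝 0) := by
    have := ENNReal.Tendsto.mul h0 (Or.inr (by simpa using hvt))
      (hq.add (tendsto_const_nhds (x := sobolevNorm 1 (Ω \ K) (v t)))) (Or.inr (by simp))
    simpa using this
  have hL : ∀ i j, L2Tendsto l (volume.restrict (Ω \ K))
      (fun τ x => (G τ (φ τ x) * grad (φ τ) x) i j)
      (fun x => (G t (φ t x) * grad (φ t) x) i j) := fun i j => by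
    refine ⟨eventually_nhdsWithin_of_forall fun τ hτ => (hmem hτ.1).2.1 i j, (hmem ht).2.1 i j,
      tendsto_of_tendsto_of_tendsto_of_le_of_le' tendsto_const_nhds hlim
        (Eventually.of_forall fun _ => zero_le) ?_⟩
    refine eventually_nhdsWithin_of_forall fun τ hτ => ?_
    have hτ0 : τ - t ≠ 0 := sub_ne_zero.2 hτ.2
    refine (((hmem hτ.1).sub (hmem ht)).eLpNorm_le_sobolevNorm hU i j).trans ?_
    have h2 := sobolevNorm_const_smul_le 1 (Ω \ K) (q τ) hτ0
    simp only [q, smul_inv_smul₀ hτ0] at h2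
    refine h2.trans (mul_le_mul_right ?_ _)
    have h3 := sobolevNorm_add_le 1 (Ω \ K) (fun x => q τ x - v t x) (v t)
    simpa only [sub_add_cancel] using h3
  have hφ := h.isC1Diffeo hΩ hΩb hs ht
  obtain ⟨c, -, hcb⟩ := hφ.symm.exists_norm_le hΩb continuous_id
  -- Composition with `φ_t⁻¹` and multiplication by its gradient move the convergence from the
  -- initial crack to the crack at time `t`.
  have hsum := L2Tendsto.sum Finset.univ fun k _ =>
    (hφ.symm.l2Tendsto_comp hΩb hU.measurableSet (hL i k)).mul
      (d := fun _ x => grad (φ t).symm x k j) (d₀ := fun x => grad (φ t).symm x k j)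
      (Metric.tendstoUniformly_iff.2 fun ε hε => by simp [hε])
      (fun x => (abs_grad_apply_le _ x k j).trans (hcb x))
      (Eventually.of_forall fun _ =>
        (continuous_grad_apply hφ.contDiff_symm k j).aestronglyMeasurable)
      (continuous_grad_apply hφ.contDiff_symm k j).aestronglyMeasurable
  rw [← Equiv.image_eq_preimage_symm, hφ.image_diff] at hsum
  have hmul : ∀ (A B : Mat n), ∑ k, B k j * A i k = (A * B) i j := fun A B => by
    rw [Matrix.mul_apply]
    exact Finset.sum_congr rfl fun _ _ => mul_comm _ _
  simp only [hmul, Matrix.mul_assoc, Equiv.apply_symm_apply] at hsum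
  have hid : ∀ x, grad (φ t) ((φ t).symm x) * grad (φ t).symm x = 1 := fun x => by
    simpa using hφ.symm.grad_symm_mul_grad x
  simp only [hid, Matrix.mul_one] at hsum
  refine ⟨?_, hsum.memLp, hsum.lim.congr' ?_⟩
  · filter_upwards [hsum.mem, self_mem_nhdsWithin] with τ h1 hτ
    simp only [grad_relative (h.isC1Diffeo hΩ hΩb hs hτ.1) hφ]
    exact h1
  · filter_upwards [self_mem_nhdsWithin] with τ hτ
    simp only [grad_relative (h.isC1Diffeo hΩ hΩb hs hτ.1) hφ]
    rfl

/-- The converse comparison: `u_τ`, pulled back to the crack at time `t` and corrected by `-(τ - t)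
w_τ`, has trace `g t` and competes with `u_t`. The curve assumption enters only through the `L²`
convergence of the pulled-back gradients. -/
theorem exists_lower_slope (hn : n = 2 ∨ n = 3) (h : IsCrackCurve Ω K s T φ) (hΩ : IsOpen Ω)
    (hΩb : Bornology.IsBounded Ω) (hs : n + 1 ≤ s) (hC : IsElasticityTensor C)
    (hK : IsCrackSet Ω K) (hg : IsC1Curve (hHalfNorm Ω) T g g')
    (hu : ∀ t ∈ Icc 0 T, IsEquilibrium C Ω (φ t '' K) (g t) (u t) (G t))
    (hc : IsC1FractureCurve Ω K T φ u) {t : ℝ} (ht : t ∈ Icc 0 T) :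
    ∃ U : ℝ → ℝ, Tendsto U (𝓝[Icc 0 T \ {t}] t)
        (𝓝 ((∫ x in Ω \ φ t '' K, variationIntegrand C (velocity T φ t) (G t) x) +
          2 * power C Ω K φ g g' t)) ∧
      ∀ᶠ τ in 𝓝[Icc 0 T \ {t}] t, (τ - t) * U τ ≤
        (∫ x in Ω \ φ τ '' K, contract (stress C (G τ x)) (G τ x)) -
          ∫ x in Ω \ φ t '' K, contract (stress C (G t x)) (G t x) := by
  have hS := h.isOpen_diff_image hΩ hΩb hs hK.closed ht
  have hvol : ∀ {τ}, τ ∈ Icc 0 T → volume (φ τ '' K) = 0 := fun hτ =>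
    (h.isC1Diffeo hΩ hΩb hs hτ).volume_image_eq_zero hΩb hK.volume_eq_zero
  obtain ⟨v, V, w, W, hv, hvt, hw, hW⟩ := hg.exists_extension hΩ h.pos ht
  have hWS : ∀ i j, L2Tendsto (𝓝[Icc 0 T \ {t}] t) (volume.restrict (Ω \ φ t '' K))
      (fun τ x => W τ x i j) (fun x => V x i j) := fun i j => (hW i j).mono_set sdiff_subset
  let B : ℝ → E n → Mat n := fun τ x => G τ ((φ τ * (φ t)⁻¹ : Equiv.Perm (E n)) x) *
    grad (φ τ * (φ t)⁻¹ : Equiv.Perm (E n)) x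
  have hB := h.l2Tendsto_relative_gradient hΩ hΩb hs hK.closed (fun τ hτ => (hu τ hτ).mem) hc ht
  have h0 : Tendsto (fun τ : ℝ => -(τ - t)) (𝓝[Icc 0 T \ {t}] t) (𝓝 0) := by
    have h1 : Continuous fun τ : ℝ => -(τ - t) := by fun_prop
    have h2 := h1.tendsto t
    simp only [sub_self, neg_zero] at h2
    exact h2.mono_left nhdsWithin_le_nhds
  have hX : ∀ i j, L2Tendsto (𝓝[Icc 0 T \ {t}] t) (volume.restrict (Ω \ φ t '' K))
      (fun τ x => (B τ x + (-(τ - t)) • W τ x) i j) (fun x => G t x i j) := fun i j => by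
    have := (hB i j).add ((hWS i j).smul h0)
    simp only [zero_mul, add_zero] at this
    exact this
  -- Here the competitor plays the role of `X` and the pulled-back gradient that of `A`, so the
  -- limit is the same as in the upper estimate.
  have key := h.tendsto_slope_energy hn hΩ hΩb hs hC ht hX hWS (A := B) fun τ x => by
    rw [neg_smul, neg_add_cancel_right]
  rw [power, (hu t ht).dirichletToNeumann_eq hC (hvol ht) (hv.mono sdiff_subset) hvt]
  refine ⟨_, key, ?_⟩
  filter_upwards [hw, self_mem_nhdsWithin] with τ ⟨hw, hwt⟩ hτ
  have hτ0 : τ - t ≠ 0 := sub_ne_zero.2 hτ.2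
  have hψ := h.isC1Diffeo_relative hΩ hΩb hs ht hτ.1
  rw [mul_inv_cancel_left₀ hτ0]
  have hm := hψ.memW12_comp hΩb (h.isOpen_diff_image hΩ hΩb hs hK.closed hτ.1) (hu τ hτ.1).mem
  rw [h.relative_preimage hΩ hΩb hs ht hτ.1] at hm
  have hcomp := hm.add ((hw.mono (sdiff_subset (t := φ t '' K))).const_smul (-(τ - t)))
  have htr : HasTrace Ω (fun x => u τ ((φ τ * (φ t)⁻¹ : Equiv.Perm (E n)) x) +
      (-(τ - t)) • w τ x) (g t) := by
    have := (hψ.hasTrace_comp hΩ hΩb (hu τ hτ.1).trace).add (hwt.const_smul (-(τ - t)))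
      (hm.aestronglyMeasurable (hvol ht))
    simpa only [neg_smul, smul_inv_smul₀ hτ0, ← sub_eq_add_neg, sub_sub_cancel] using this
  have hmin := (hu t ht).integral_le hC (hvol ht) hcomp htr
  rw [← h.relative_image hΩ hΩb hs ht hτ.1,
    hψ.integral_contract_stress_image C hS.measurableSet]
  exact sub_le_sub_left hmin _

end IsCrackCurve

/-! ### One-sided bounds for derivatives -/

theorem eventually_nhdsGT_of_nhdsWithin_Icc_diff {T t : ℝ} (ht : t ∈ Ico 0 T) {p : ℝ → Prop}
    (h : ∀ᶠ τ in 𝓝[Icc 0 T \ {t}] t, p τ) : ∀ᶠ τ in 𝓝[>] t, p τ := by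
  rw [← nhdsWithin_Ioc_eq_nhdsGT ht.2]
  have hsub : Ioc t T ⊆ Icc 0 T \ {t} := fun x hx => ⟨⟨ht.1.trans hx.1.le, hx.2⟩, hx.1.ne'⟩
  exact nhdsWithin_mono _ hsub h

theorem rightDiniLE_of_slope_le {T t b : ℝ} (ht : t ∈ Ico 0 T) {f U : ℝ → ℝ}
    (hU : Tendsto U (𝓝[Icc 0 T \ {t}] t) (𝓝 b))
    (h : ∀ᶠ τ in 𝓝[Icc 0 T \ {t}] t, f τ - f t ≤ (τ - t) * U τ) : RightDiniLE f t b := by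
  intro r hr
  filter_upwards [eventually_nhdsGT_of_nhdsWithin_Icc_diff ht (hU.eventually_lt_const hr),
    eventually_nhdsGT_of_nhdsWithin_Icc_diff ht h, self_mem_nhdsWithin] with τ h1 h2 h3
  have h4 : 0 < τ - t := sub_pos.2 h3
  rw [div_lt_iff₀ h4]
  nlinarith

theorem RightDiniLE.derivWithin_le {T t b : ℝ} (ht : t ∈ Ico 0 T) {f : ℝ → ℝ}
    (h : RightDiniLE f t b) (hf : DifferentiableWithinAt ℝ f (Icc 0 T) t) :
    derivWithin f (Icc 0 T) t ≤ b := by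
  have h1 := hasDerivWithinAt_iff_tendsto_slope.1 hf.hasDerivWithinAt
  have h2 : Tendsto (slope f t) (𝓝[>] t) (𝓝 (derivWithin f (Icc 0 T) t)) := fun s hs =>
    eventually_nhdsGT_of_nhdsWithin_Icc_diff ht (h1 hs)
  refine le_of_forall_gt_imp_ge_of_dense fun r hr => le_of_tendsto h2 ?_
  filter_upwards [h r hr] with τ hτ
  rw [slope_def_field]
  exact hτ.le

/-- Dividing by `τ - t` reverses the inequalities when `τ < t`, so the two bounds trade roles; their
minimum and maximum squeeze the slope on both sides. -/
theorem hasDerivWithinAt_of_slope_bounds {s : Set ℝ} {t b : ℝ} {f U U' : ℝ → ℝ}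
    (hU : Tendsto U (𝓝[s \ {t}] t) (𝓝 b)) (h : ∀ᶠ τ in 𝓝[s \ {t}] t, f τ - f t ≤ (τ - t) * U τ)
    (hU' : Tendsto U' (𝓝[s \ {t}] t) (𝓝 b))
    (h' : ∀ᶠ τ in 𝓝[s \ {t}] t, (τ - t) * U' τ ≤ f τ - f t) : HasDerivWithinAt f b s t := by
  rw [hasDerivWithinAt_iff_tendsto_slope]
  have hmin := hU.min hU'
  have hmax := hU.max hU'
  rw [min_self] at hmin
  rw [max_self] at hmax
  have hpt : ∀ᶠ τ in 𝓝[s \ {t}] t, min (U τ) (U' τ) ≤ slope f t τ ∧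
      slope f t τ ≤ max (U τ) (U' τ) := by
    filter_upwards [h, h', self_mem_nhdsWithin] with τ h1 h2 hτ
    rw [slope_def_field]
    rcases lt_or_gt_of_ne (show τ ≠ t from hτ.2) with hlt | hgt
    · have h3 : τ - t < 0 := sub_neg.2 hlt
      refine ⟨(min_le_left _ _).trans ?_, le_trans ?_ (le_max_right _ _)⟩
      · rwa [le_div_iff_of_neg h3, mul_comm]
      · rwa [div_le_iff_of_neg h3, mul_comm]
    · have h3 : 0 < τ - t := sub_pos.2 hgt
      refine ⟨(min_le_right _ _).trans ?_, le_trans ?_ (le_max_left _ _)⟩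
      · rwa [le_div_iff₀ h3, mul_comm]
      · rwa [div_le_iff₀ h3, mul_comm]
  exact tendsto_of_tendsto_of_tendsto_of_le_of_le' hmin hmax (hpt.mono fun _ h => h.1)
    (hpt.mono fun _ h => h.2)

/-! ### The energy release rate -/

theorem energyCurve_eq (C : Tensor4 n) (Ω K : Set (E n)) (φ : ℝ → Equiv.Perm (E n))
    (G : ℝ → E n → Mat n) (t : ℝ) : energyCurve C Ω K φ G t =
      1 / 2 * ∫ x in Ω \ φ t '' K, contract (stress C (G t x)) (G t x) := by
  simp only [energyCurve, elasticEnergy, energyDensity, integral_const_mul]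

theorem integral_variationIntegrand (C : Tensor4 n) (Ω K : Set (E n)) (η : E n → E n)
    (G : E n → Mat n) :
    ∫ x in Ω \ K, variationIntegrand C η G x = -2 * riceIntegral C Ω K η G := by
  rw [riceIntegral, ← integral_const_mul]
  congr 1
  ext x
  simp only [variationIntegrand]
  ring

theorem sobolevNorm_zero (m : ℕ) (U : Set (E n)) : sobolevNorm m U (fun _ => 0) = 0 := by
  unfold sobolevNorm
  refine Finset.sum_eq_zero fun k _ => Finset.sum_eq_zero fun J _ => Finset.sum_eq_zero
    fun i _ => le_antisymm (iInf₂_le_of_le (fun _ => 0) ⟨?_, ?_, fun ζ _ _ _ => by simp⟩ ?_)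
      zero_le
  · simpa using (locallyIntegrable_zero (μ := volume) (ε'' := ℝ)).locallyIntegrableOn U
  · exact (locallyIntegrable_zero (μ := volume) (ε'' := ℝ)).locallyIntegrableOn U
  · simp

theorem hasTrace_zero (Ω : Set (E n)) : HasTrace Ω (fun _ => 0) (fun _ => 0) :=
  Eventually.of_forall fun x => by simp

theorem hHalfNorm_zero (Ω : Set (E n)) : hHalfNorm Ω (fun _ => 0) = 0 :=
  le_antisymm (iInf₂_le_of_le (fun _ => 0) (hasTrace_zero Ω) (sobolevNorm_zero 1 Ω).le) zero_le

theorem isC1Curve_hHalfNorm_const {Ω : Set (E n)} {u₀ : E n → E n} (h : hHalfNorm Ω u₀ < ⊤)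
    (T : ℝ) : IsC1Curve (hHalfNorm Ω) T (fun _ => u₀) (fun _ _ => 0) :=
  ⟨fun _ _ => h, fun _ _ => by simpa [hHalfNorm_zero] using tendsto_const_nhds,
    fun _ _ => by simpa [hHalfNorm_zero] using tendsto_const_nhds⟩

namespace IsCrackCurve

variable {Ω K : Set (E n)} {s : ℕ} {T : ℝ} {φ : ℝ → Equiv.Perm (E n)} {C : Tensor4 n}
  {g g' : ℝ → E n → E n} {u : ℝ → E n → E n} {G : ℝ → E n → Mat n}

theorem rightDiniLE_energyCurve (hn : n = 2 ∨ n = 3) (h : IsCrackCurve Ω K s T φ) (hΩ : IsOpen Ω)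
    (hΩb : Bornology.IsBounded Ω) (hs : n + 1 ≤ s) (hC : IsElasticityTensor C)
    (hK : IsCrackSet Ω K) (hg : IsC1Curve (hHalfNorm Ω) T g g')
    (hu : ∀ t ∈ Icc 0 T, IsEquilibrium C Ω (φ t '' K) (g t) (u t) (G t)) {t : ℝ}
    (ht : t ∈ Ico 0 T) :
    RightDiniLE (energyCurve C Ω K φ G) t
      (power C Ω K φ g g' t - riceIntegral C Ω (φ t '' K) (velocity T φ t) (G t)) := by
  obtain ⟨U, hU, hle⟩ := h.exists_upper_slope hn hΩ hΩb hs hC hK hg hu (Ico_subset_Icc_self ht)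
  refine rightDiniLE_of_slope_le ht (U := fun τ => 1 / 2 * U τ) ?_ (hle.mono fun τ hτ => ?_)
  · convert hU.const_mul (1 / 2 : ℝ) using 2
    rw [integral_variationIntegrand]
    ring
  · rw [energyCurve_eq, energyCurve_eq]
    linarith

theorem hasDerivWithinAt_energyCurve (hn : n = 2 ∨ n = 3) (h : IsCrackCurve Ω K s T φ)
    (hΩ : IsOpen Ω) (hΩb : Bornology.IsBounded Ω) (hs : n + 1 ≤ s) (hC : IsElasticityTensor C)
    (hK : IsCrackSet Ω K) (hg : IsC1Curve (hHalfNorm Ω) T g g')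
    (hu : ∀ t ∈ Icc 0 T, IsEquilibrium C Ω (φ t '' K) (g t) (u t) (G t))
    (hc : IsC1FractureCurve Ω K T φ u) {t : ℝ} (ht : t ∈ Icc 0 T) :
    HasDerivWithinAt (energyCurve C Ω K φ G)
      (power C Ω K φ g g' t - riceIntegral C Ω (φ t '' K) (velocity T φ t) (G t)) (Icc 0 T) t := by
  obtain ⟨U, hU, hle⟩ := h.exists_upper_slope hn hΩ hΩb hs hC hK hg hu ht
  obtain ⟨U', hU', hle'⟩ := h.exists_lower_slope hn hΩ hΩb hs hC hK hg hu hc ht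
  refine hasDerivWithinAt_of_slope_bounds (U := fun τ => 1 / 2 * U τ)
    (U' := fun τ => 1 / 2 * U' τ) ?_ (hle.mono fun τ hτ => ?_) ?_ (hle'.mono fun τ hτ => ?_)
  · convert hU.const_mul (1 / 2 : ℝ) using 2
    rw [integral_variationIntegrand]
    ring
  · rw [energyCurve_eq, energyCurve_eq]
    linarith
  · convert hU'.const_mul (1 / 2 : ℝ) using 2
    rw [integral_variationIntegrand]
    ring
  · rw [energyCurve_eq, energyCurve_eq]
    linarith

variable {u₀ : E n → E n}

theorem responseForm_eq (h : IsCrackCurve Ω K s T φ) (hΩ : IsOpen Ω)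
    (hΩb : Bornology.IsBounded Ω) (hs : n + 1 ≤ s) (hC : IsElasticityTensor C)
    (hK : IsCrackSet Ω K)
    (hu : ∀ t ∈ Icc 0 T, IsEquilibrium C Ω (φ t '' K) u₀ (u t) (G t)) {t : ℝ}
    (ht : t ∈ Icc 0 T) : responseForm C Ω K φ u₀ t = 2 * energyCurve C Ω K φ G t := by
  rw [responseForm, (hu t ht).dirichletToNeumann_eq hC
    ((h.isC1Diffeo hΩ hΩb hs ht).volume_image_eq_zero hΩb hK.volume_eq_zero) (hu t ht).mem
    (hu t ht).trace, energyCurve_eq]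
  ring

theorem power_const (h : IsCrackCurve Ω K s T φ) (hΩ : IsOpen Ω)
    (hΩb : Bornology.IsBounded Ω) (hs : n + 1 ≤ s) (hC : IsElasticityTensor C)
    (hK : IsCrackSet Ω K)
    (hu : ∀ t ∈ Icc 0 T, IsEquilibrium C Ω (φ t '' K) u₀ (u t) (G t)) {t : ℝ}
    (ht : t ∈ Icc 0 T) : power C Ω K φ (fun _ => u₀) (fun _ _ => 0) t = 0 := by
  -- The zero field, written as `0 • u_t`, extends the boundary velocity zero.
  have hv := (hu t ht).mem.const_smul 0
  have hv₀ := (hu t ht).trace.const_smul 0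
  simp only [zero_smul] at hv hv₀
  rw [power, (hu t ht).dirichletToNeumann_eq hC
    ((h.isC1Diffeo hΩ hΩb hs ht).volume_image_eq_zero hΩb hK.volume_eq_zero) hv hv₀]
  exact (hu t ht).weak _ _ hv hv₀

theorem rightDiniLE_responseForm (hn : n = 2 ∨ n = 3) (h : IsCrackCurve Ω K s T φ) (hΩ : IsOpen Ω)
    (hΩb : Bornology.IsBounded Ω) (hs : n + 1 ≤ s) (hC : IsElasticityTensor C)
    (hK : IsCrackSet Ω K) (hu₀ : hHalfNorm Ω u₀ < ⊤)
    (hu : ∀ t ∈ Icc 0 T, IsEquilibrium C Ω (φ t '' K) u₀ (u t) (G t)) {t : ℝ}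
    (ht : t ∈ Ico 0 T) :
    RightDiniLE (responseForm C Ω K φ u₀) t
      (∫ x in Ω \ φ t '' K, variationIntegrand C (velocity T φ t) (G t) x) := by
  have key := h.rightDiniLE_energyCurve hn hΩ hΩb hs hC hK (isC1Curve_hHalfNorm_const hu₀ T) hu ht
  rw [h.power_const hΩ hΩb hs hC hK hu (Ico_subset_Icc_self ht)] at key
  rw [integral_variationIntegrand]
  intro r hr
  filter_upwards [key (r / 2) (by linarith), Ioc_mem_nhdsGT ht.2] with τ h1 h2
  rw [h.responseForm_eq hΩ hΩb hs hC hK hu ⟨ht.1.trans h2.1.le, h2.2⟩,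
    h.responseForm_eq hΩ hΩb hs hC hK hu (Ico_subset_Icc_self ht), ← mul_sub, mul_div_assoc]
  linarith

theorem hasDerivWithinAt_responseForm (hn : n = 2 ∨ n = 3) (h : IsCrackCurve Ω K s T φ)
    (hΩ : IsOpen Ω) (hΩb : Bornology.IsBounded Ω) (hs : n + 1 ≤ s) (hC : IsElasticityTensor C)
    (hK : IsCrackSet Ω K) (hu₀ : hHalfNorm Ω u₀ < ⊤)
    (hu : ∀ t ∈ Icc 0 T, IsEquilibrium C Ω (φ t '' K) u₀ (u t) (G t))
    (hc : IsC1FractureCurve Ω K T φ u) {t : ℝ} (ht : t ∈ Icc 0 T) :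
    HasDerivWithinAt (responseForm C Ω K φ u₀)
      (∫ x in Ω \ φ t '' K, variationIntegrand C (velocity T φ t) (G t) x) (Icc 0 T) t := by
  have key := (h.hasDerivWithinAt_energyCurve hn hΩ hΩb hs hC hK
    (isC1Curve_hHalfNorm_const hu₀ T) hu hc ht).const_mul 2
  rw [h.power_const hΩ hΩb hs hC hK hu ht] at key
  rw [integral_variationIntegrand]
  refine (key.congr (fun τ hτ => h.responseForm_eq hΩ hΩb hs hC hK hu hτ)
    (h.responseForm_eq hΩ hΩb hs hC hK hu ht)).congr_deriv ?_
  ring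

end IsCrackCurve

end

end BrittleCrack

/-! ### The proposition. -/

open BrittleCrack in
theorem proposition5p1 {n : ℕ} (hn : n = 2 ∨ n = 3)
    (Ω : Set (E n)) (hΩ : IsOpen Ω) (hΩb : Bornology.IsBounded Ω)
    (C : Tensor4 n) (hC : IsElasticityTensor C)
    (K : Set (E n)) (hK : IsCrackSet Ω K)
    (s : ℕ) (hs : (n : ℝ) / 2 + 2 ≤ s)
    (T : ℝ) (φ : ℝ → Equiv.Perm (E n)) (hφ : IsCrackCurve Ω K s T φ) :
    -- the derivative of the Dirichlet-to-Neumann map, for a fixed boundary displacement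
    (∀ (u₀ : E n → E n), hHalfNorm Ω u₀ < ⊤ →
      ∀ (u : ℝ → E n → E n) (G : ℝ → E n → Mat n),
      (∀ t ∈ Icc 0 T, IsEquilibrium C Ω (φ t '' K) u₀ (u t) (G t)) →
      (∀ t ∈ Icc 0 T,
        IntegrableOn (variationIntegrand C (velocity T φ t) (G t)) (Ω \ φ t '' K)) ∧
      (∀ t ∈ Ico 0 T,
        RightDiniLE (responseForm C Ω K φ u₀) t
          (∫ x in Ω \ φ t '' K, variationIntegrand C (velocity T φ t) (G t) x) ∧
        (DifferentiableWithinAt ℝ (responseForm C Ω K φ u₀) (Icc 0 T) t →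
          derivWithin (responseForm C Ω K φ u₀) (Icc 0 T) t ≤
            ∫ x in Ω \ φ t '' K, variationIntegrand C (velocity T φ t) (G t) x)) ∧
      (IsC1FractureCurve Ω K T φ u → ∀ t ∈ Icc 0 T,
        DifferentiableWithinAt ℝ (responseForm C Ω K φ u₀) (Icc 0 T) t ∧
        derivWithin (responseForm C Ω K φ u₀) (Icc 0 T) t ≤
          ∫ x in Ω \ φ t '' K, variationIntegrand C (velocity T φ t) (G t) x)) ∧
    -- the energy release rate, for a curve of boundary displacements
    (∀ (g g' : ℝ → E n → E n), IsC1Curve (hHalfNorm Ω) T g g' →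
      ∀ (u : ℝ → E n → E n) (G : ℝ → E n → Mat n),
      (∀ t ∈ Icc 0 T, IsEquilibrium C Ω (φ t '' K) (g t) (u t) (G t)) →
      (∀ t ∈ Ico 0 T,
        RightDiniLE (energyCurve C Ω K φ G) t
          (power C Ω K φ g g' t - riceIntegral C Ω (φ t '' K) (velocity T φ t) (G t)) ∧
        (DifferentiableWithinAt ℝ (energyCurve C Ω K φ G) (Icc 0 T) t →
          riceIntegral C Ω (φ t '' K) (velocity T φ t) (G t) ≤
            energyReleaseRate C Ω K T φ g g' G t)) ∧
      (IsC1FractureCurve Ω K T φ u → ∀ t ∈ Icc 0 T,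
        DifferentiableWithinAt ℝ (energyCurve C Ω K φ G) (Icc 0 T) t ∧
        riceIntegral C Ω (φ t '' K) (velocity T φ t) (G t) ≤
          energyReleaseRate C Ω K T φ g g' G t)) := by
  -- In dimension two `s ≥ 3`. In dimension three `s ≥ 7/2`, and integrality gives `s ≥ 4`.
  have hs' : n + 1 ≤ s := by
    rcases hn with rfl | rfl
    · have : (3 : ℝ) ≤ s := by norm_num at hs ⊢; linarith
      exact_mod_cast this
    · have h1 : (3 : ℝ) < s := by norm_num at hs; linarith
      have h2 : 3 < s := by exact_mod_cast h1
      omega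
  have huniq : ∀ t ∈ Icc 0 T, UniqueDiffWithinAt ℝ (Icc 0 T) t := uniqueDiffOn_Icc hφ.pos
  refine ⟨fun u₀ hu₀ u G hu => ⟨fun t ht => ?_, fun t ht => ?_, fun hc t ht => ?_⟩,
    fun g g' hg u G hu => ⟨fun t ht => ?_, fun hc t ht => ?_⟩⟩
  · exact hφ.integrableOn_variationIntegrand hΩ hΩb hs' hC ht (hu t ht).mem.2.1
  · have h := hφ.rightDiniLE_responseForm hn hΩ hΩb hs' hC hK hu₀ hu ht
    exact ⟨h, h.derivWithin_le ht⟩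
  · have h := hφ.hasDerivWithinAt_responseForm hn hΩ hΩb hs' hC hK hu₀ hu hc ht
    exact ⟨h.differentiableWithinAt, (h.derivWithin (huniq t ht)).le⟩
  · have h := hφ.rightDiniLE_energyCurve hn hΩ hΩb hs' hC hK hg hu ht
    refine ⟨h, fun hd => ?_⟩
    have := h.derivWithin_le ht hd
    rw [energyReleaseRate]
    linarith
  · have h := hφ.hasDerivWithinAt_energyCurve hn hΩ hΩb hs' hC hK hg hu hc ht
    refine ⟨h.differentiableWithinAt, ?_⟩
    rw [energyReleaseRate, h.derivWithin (huniq t ht)]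
    linarith
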